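/- Let $\mathcal A$ be an affine space over a real normed vector space (possibly infinite dimensional), $B$ a smooth Hausdorff manifold (modelled on a real normed space, of any dimension) such that every open covering of $B$ has a subordinate smooth partition of unity (automatic if $B$ is finite dimensional and paracompact), and $\pi:\mathcal A\to B$ a smooth (locally trivial) fibre bundle. Let $\{U_\lambda\}$ be a good open covering of $B$, i.e. all non-empty finite intersections $U_{\lambda_0}\cap\dots\cap U_{\lambda_p}$ are contractible, and let $k\ge 1$. Forms are smooth and complex valued. A "closed $k$-manifold in $X$" means a smooth map $f:S\to X$ from a compact oriented $k$-manifold $S$ without boundary, and $\int_S\eta$ means $\int_S f^*\eta$; it lies in a fibre if $\pi\circ f$ is constant. Let $\Omega^k(\mathcal A\to B)=\Omega^k(\mathcal A)/\pi^*\Omega^k(B)$, and let $H^k_{dR}(\mathcal A\to B)$ be the cohomology of $\Omega^\bullet(\mathcal A\to B)$ with the coboundary operator induced by the exterior derivative. Let $H^k_{dR,0}(\mathcal A\to B)$ be the subgroup of the classes that are represented by a form $\hat\omega\in\Omega^k(\mathcal A)$ with $\int_S\hat\omega\in 2\pi i\mathbb Z$ for every closed $k$-manifold $S$ in a fibre of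 $\pi$. Let $\tilde\Omega^k$ be the abelian group of families $\tilde\omega=\{\tilde\omega_\lambda\}$ of $k$-forms on the sets $\pi^{-1}(U_\lambda)$ of the type $\tilde\omega_\lambda=\hat\omega|_{\pi^{-1}(U_\lambda)}-\pi^*\omega_\lambda$ with $\hat\omega\in\Omega^k(\mathcal A)$ and $\omega_\lambda\in\Omega^k(U_\lambda)$, and let $\tilde H^k(\mathcal A\to B)$ be the cohomology of $\tilde\Omega^\bullet$ with the exterior derivative. Let $\tilde H^k_0(\mathcal A\to B)$ be the subgroup of the classes that are represented by a family with $\int_S\tilde\omega_\lambda\in 2\pi i\mathbb Z$ for every $\lambda$ and every closed $k$-manifold $S$ in $\pi^{-1}(U_\lambda)$. Then $\tilde H^k_0(\mathcal A\to B)$ and $H^k_{dR,0}(\mathcal A\to B)$ are isomorphic abelian groups; more precisely there is an isomorphism that sends the class of a cocycle $\{\hat\omega|_{\pi^{-1}(U_\lambda)}-\pi^*\omega_\lambda\}$ to the class of $\hat\omega$. -/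

import Mathlib

open TopologicalSpace
open scoped Manifold ContDiff Topology

noncomputable section

open Set Function Filter

namespace FibredDeRham

section AltComp
variable {E F G : Type*} [NormedAddCommGroup E] [NormedSpace ℝ E]
  [NormedAddCommGroup F] [NormedSpace ℝ F] [NormedAddCommGroup G] [NormedSpace ℝ G]

/-- Alternatization of multilinear forms, as a continuous linear map. -/
def altCLM (E : Type*) [NormedAddCommGroup E] [NormedSpace ℝ E] (k : ℕ) :
    ContinuousMultilinearMap ℝ (fun _ : Fin k => E) ℂ →L[ℝ] E [⋀^Fin k]→L[ℝ] ℂ :=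
  LinearMap.mkContinuous
    { toFun := fun f => f.alternatization
      map_add' := fun f g => map_add _ f g
      map_smul' := fun c f => by
        ext v
        simp [ContinuousMultilinearMap.alternatization_apply_apply, Finset.smul_sum,
          smul_comm c] }
    (Fintype.card (Equiv.Perm (Fin k)))
    (fun f => by
      refine ContinuousAlternatingMap.opNorm_le_bound _ (by positivity) fun v => ?_
      change ‖f.alternatization v‖ ≤ _
      rw [ContinuousMultilinearMap.alternatization_apply_apply]
      calc ‖∑ σ : Equiv.Perm (Fin k), Equiv.Perm.sign σ • f (v ∘ σ)‖
          ≤ ∑ σ : Equiv.Perm (Fin k), ‖f‖ * ∏ i, ‖v i‖ := by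
            refine norm_sum_le_of_le _ fun σ _ => ?_
            have h1 : ‖Equiv.Perm.sign σ • f (v ∘ σ)‖ = ‖f (v ∘ σ)‖ := by
              rcases Int.units_eq_one_or (Equiv.Perm.sign σ) with h | h <;> simp [h]
            rw [h1]
            refine (f.le_opNorm _).trans (le_of_eq ?_)
            congr 1
            exact Equiv.prod_comp σ (fun i => ‖v i‖)
        _ = _ := by simp [mul_assoc])

theorem altCLM_apply {k : ℕ} (α : E [⋀^Fin k]→L[ℝ] ℂ) :
    altCLM E k α.toContinuousMultilinearMap = (k.factorial : ℝ) • α := by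
  ext v
  change (α.toContinuousMultilinearMap.alternatization) v = _
  rw [ContinuousMultilinearMap.alternatization_apply_apply]
  have : ∀ σ : Equiv.Perm (Fin k),
      Equiv.Perm.sign σ • α.toContinuousMultilinearMap (v ∘ σ) = α v := by
    intro σ
    have := α.toAlternatingMap.map_perm v σ
    change α (v ∘ σ) = _ • α v at this
    change Equiv.Perm.sign σ • α (v ∘ σ) = _
    rw [this, smul_smul]
    simp
  rw [Finset.sum_congr rfl fun σ _ => this σ]
  simp [Fintype.card_perm]

/-- The pullback of alternating forms along linear maps depends smoothly on both. -/
theorem contDiffAt_compCLM {k : ℕ} {f : G → F [⋀^Fin k]→L[ℝ] ℂ} {L : G → E →L[ℝ] F} {x : G}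
    (hf : ContDiffAt ℝ ∞ f x) (hL : ContDiffAt ℝ ∞ L x) :
    ContDiffAt ℝ ∞ (fun y => (f y).compContinuousLinearMap (L y)) x := by
  have key : (fun y => (f y).compContinuousLinearMap (L y)) = fun y =>
      ((k.factorial : ℝ)⁻¹) • altCLM E k
        (ContinuousMultilinearMap.compContinuousLinearMapContinuousMultilinear ℝ
          (fun _ : Fin k => E) (fun _ => F) ℂ (fun _ => L y)
          (ContinuousAlternatingMap.toContinuousMultilinearMapCLM ℝ (f y))) := by
    funext y
    have h2 := altCLM_apply ((f y).compContinuousLinearMap (L y))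
    have h3 : (k.factorial : ℝ) ≠ 0 := by exact_mod_cast k.factorial_ne_zero
    rw [← inv_smul_smul₀ h3 ((f y).compContinuousLinearMap (L y)), ← h2]
    rfl
  rw [key]
  refine ContDiffAt.const_smul _ ((altCLM E k).contDiff.contDiffAt.comp x ?_)
  refine ContDiffAt.clm_apply ?_ ?_
  · refine (ContinuousMultilinearMap.contDiff _).contDiffAt.comp x ?_
    exact contDiffAt_pi.2 fun _ => hL
  · exact (ContinuousAlternatingMap.toContinuousMultilinearMapCLM ℝ).contDiff.contDiffAt.comp x hf

end AltComp

section Forms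
variable {E M : Type*} [NormedAddCommGroup E] [NormedSpace ℝ E] [TopologicalSpace M]
  [ChartedSpace E M]
variable {E' N : Type*} [NormedAddCommGroup E'] [NormedSpace ℝ E'] [TopologicalSpace N]
  [ChartedSpace E' N]

/-- The differential of `f : M → N` at `x`, as a map between the model spaces.  In Mathlib the
tangent space of `M` at `x` is the model space `E`, identified through the preferred chart at `x`. -/
def tangentCLM (f : M → N) (x : M) : E →L[ℝ] E' := mfderiv 𝓘(ℝ, E) 𝓘(ℝ, E') f x

/-- The expression in the chart at `x₀` of a (not necessarily smooth) complex-valued `k`-form `α`,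
i.e. the pullback of `α` along the inverse chart.  Here `α x` is an alternating form on the tangent
space of `M` at `x`, which is `E` as above. -/
def localRep {k : ℕ} (α : M → E [⋀^Fin k]→L[ℝ] ℂ) (x₀ : M) (y : E) : E [⋀^Fin k]→L[ℝ] ℂ :=
  (α ((chartAt E x₀).symm y)).compContinuousLinearMap
    (tangentCLM (E := E) (E' := E) (chartAt E x₀).symm y)

/-- Smoothness of a form: its expression in every (preferred) chart is smooth. -/
def IsSmoothForm {k : ℕ} (α : M → E [⋀^Fin k]→L[ℝ] ℂ) : Prop :=
  ∀ x₀ : M, ContDiffOn ℝ ∞ (localRep α x₀) (chartAt E x₀).target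

/-- Pullback of a (rough) form along a map. -/
def pullbackRaw {k : ℕ} (f : M → N) (α : N → E' [⋀^Fin k]→L[ℝ] ℂ) (x : M) :
    E [⋀^Fin k]→L[ℝ] ℂ :=
  (α (f x)).compContinuousLinearMap (tangentCLM (E := E) (E' := E') f x)

/-- The exterior derivative, computed at `x` in the chart at `x`. -/
def extDerivRaw {k : ℕ} (α : M → E [⋀^Fin k]→L[ℝ] ℂ) (x : M) : E [⋀^Fin (k + 1)]→L[ℝ] ℂ :=
  extDeriv (localRep α x) (chartAt E x x)

theorem localRep_add {k : ℕ} (α β : M → E [⋀^Fin k]→L[ℝ] ℂ) (x₀ : M) :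
    localRep (α + β) x₀ = localRep α x₀ + localRep β x₀ := rfl

theorem localRep_neg {k : ℕ} (α : M → E [⋀^Fin k]→L[ℝ] ℂ) (x₀ : M) :
    localRep (-α) x₀ = -localRep α x₀ := rfl

theorem localRep_zero {k : ℕ} (x₀ : M) :
    localRep (0 : M → E [⋀^Fin k]→L[ℝ] ℂ) x₀ = 0 := rfl

theorem IsSmoothForm.contDiffAt {k : ℕ} {α : M → E [⋀^Fin k]→L[ℝ] ℂ} (h : IsSmoothForm α)
    (x₀ : M) {y : E} (hy : y ∈ (chartAt E x₀).target) : ContDiffAt ℝ ∞ (localRep α x₀) y :=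
  (h x₀).contDiffAt ((chartAt E x₀).open_target.mem_nhds hy)

/-- The expression of a map in the charts at `x₀` and `n₀`. -/
def localMap (f : M → N) (x₀ : M) (n₀ : N) (y : E) : E' :=
  chartAt E' n₀ (f ((chartAt E x₀).symm y))

theorem mfderiv_eq_localMap {f : M → N} (hf : ContMDiff 𝓘(ℝ, E) 𝓘(ℝ, E') ∞ f) (x : M) :
    tangentCLM (E := E) (E' := E') f x =
      fderiv ℝ (localMap (E := E) (E' := E') f x (f x)) (chartAt E x x) := by
  have h : MDifferentiableAt 𝓘(ℝ, E) 𝓘(ℝ, E') f x := hf.contMDiffAt.mdifferentiableAt (by simp)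
  unfold tangentCLM mfderiv
  refine (if_pos h).trans ?_
  rw [ModelWithCorners.range_eq_univ, fderivWithin_univ]
  rfl

theorem pullbackRaw_id {k : ℕ} (α : M → E [⋀^Fin k]→L[ℝ] ℂ) : pullbackRaw (id : M → M) α = α := by
  funext x
  ext v
  have h : tangentCLM (E := E) (E' := E) (id : M → M) x = ContinuousLinearMap.id ℝ E := mfderiv_id
  rw [pullbackRaw, h]
  rfl

variable [IsManifold 𝓘(ℝ, E) ∞ M] [IsManifold 𝓘(ℝ, E') ∞ N]

theorem contMDiffAt_chart_symm (x₀ : M) {y : E} (hy : y ∈ (chartAt E x₀).target) :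
    ContMDiffAt 𝓘(ℝ, E) 𝓘(ℝ, E) ∞ (chartAt E x₀).symm y :=
  (contMDiffOn_chart_symm (I := 𝓘(ℝ, E)) (n := ∞)).contMDiffAt
    ((chartAt E x₀).open_target.mem_nhds hy)

theorem contMDiffAt_chart (x₀ : M) {x : M} (hx : x ∈ (chartAt E x₀).source) :
    ContMDiffAt 𝓘(ℝ, E) 𝓘(ℝ, E) ∞ (chartAt E x₀) x :=
  (contMDiffOn_chart (I := 𝓘(ℝ, E)) (n := ∞)).contMDiffAt
    ((chartAt E x₀).open_source.mem_nhds hx)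

theorem contDiffAt_localMap {f : M → N} (hf : ContMDiff 𝓘(ℝ, E) 𝓘(ℝ, E') ∞ f) (x₀ : M) (n₀ : N)
    {y : E} (hy : y ∈ (chartAt E x₀).target)
    (hn : f ((chartAt E x₀).symm y) ∈ (chartAt E' n₀).source) :
    ContDiffAt ℝ ∞ (localMap (E := E) (E' := E') f x₀ n₀) y := by
  rw [← contMDiffAt_iff_contDiffAt]
  exact (contMDiffAt_chart n₀ hn).comp y (hf.contMDiffAt.comp y (contMDiffAt_chart_symm x₀ hy))

theorem localRep_pullback {k : ℕ} {f : M → N} (hf : ContMDiff 𝓘(ℝ, E) 𝓘(ℝ, E') ∞ f)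
    (α : N → E' [⋀^Fin k]→L[ℝ] ℂ) (x₀ : M) (n₀ : N)
    {y : E} (hy : y ∈ (chartAt E x₀).target)
    (hn : f ((chartAt E x₀).symm y) ∈ (chartAt E' n₀).source) :
    localRep (pullbackRaw f α) x₀ y =
      (localRep α n₀ (localMap (E' := E') f x₀ n₀ y)).compContinuousLinearMap
        (fderiv ℝ (localMap (E := E) (E' := E') f x₀ n₀) y) := by
  have hn' : localMap (E' := E') f x₀ n₀ y ∈ (chartAt E' n₀).target := (chartAt E' n₀).map_source hn
  have hg : MDifferentiableAt 𝓘(ℝ, E) 𝓘(ℝ, E') (localMap (E := E) (E' := E') f x₀ n₀) y :=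
    ((contDiffAt_localMap hf x₀ n₀ hy hn).differentiableAt (by simp)).mdifferentiableAt
  have hs : MDifferentiableAt 𝓘(ℝ, E) 𝓘(ℝ, E) (chartAt E x₀).symm y :=
    (contMDiffAt_chart_symm x₀ hy).mdifferentiableAt (by simp)
  have hs' : MDifferentiableAt 𝓘(ℝ, E') 𝓘(ℝ, E') (chartAt E' n₀).symm (localMap (E' := E') f x₀ n₀ y) :=
    (contMDiffAt_chart_symm n₀ hn').mdifferentiableAt (by simp)
  have hfd : MDifferentiableAt 𝓘(ℝ, E) 𝓘(ℝ, E') f ((chartAt E x₀).symm y) :=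
    hf.contMDiffAt.mdifferentiableAt (by simp)
  have e1 : (chartAt E' n₀).symm (localMap (E' := E') f x₀ n₀ y) = f ((chartAt E x₀).symm y) :=
    (chartAt E' n₀).left_inv hn
  have e2 : ((chartAt E' n₀).symm ∘ localMap (E := E) (E' := E') f x₀ n₀) =ᶠ[𝓝 y] (f ∘ (chartAt E x₀).symm) := by
    have h1 : ContinuousAt (fun z => f ((chartAt E x₀).symm z)) y :=
      hf.continuous.continuousAt.comp ((chartAt E x₀).continuousAt_symm hy)
    filter_upwards [h1.preimage_mem_nhds ((chartAt E' n₀).open_source.mem_nhds hn)] with z hz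
    exact (chartAt E' n₀).left_inv hz
  have e3 := e2.mfderiv_eq (I := 𝓘(ℝ, E)) (I' := 𝓘(ℝ, E'))
  rw [mfderiv_comp y hs' hg, mfderiv_comp y hfd hs, mfderiv_eq_fderiv] at e3
  unfold localRep pullbackRaw
  rw [e1]
  ext v
  simp only [ContinuousAlternatingMap.compContinuousLinearMap_apply]
  congr 1
  funext i
  exact (DFunLike.congr_fun e3 (v i)).symm


theorem mfderiv_chart_symm_eq (x₀ : M) {y : E} (hy : y ∈ (chartAt E x₀).target) :
    tangentCLM (E := E) (E' := E) (chartAt E x₀).symm y =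
      fderiv ℝ (localMap (E := E) (E' := E) (id : M → M) x₀ ((chartAt E x₀).symm y)) y := by
  have h : MDifferentiableAt 𝓘(ℝ, E) 𝓘(ℝ, E) (chartAt E x₀).symm y :=
    (contMDiffAt_chart_symm x₀ hy).mdifferentiableAt (by simp)
  unfold tangentCLM mfderiv
  refine (if_pos h).trans ?_
  rw [ModelWithCorners.range_eq_univ, fderivWithin_univ]
  rfl

theorem eventually_localRep_pullback {k : ℕ} {f : M → N}
    (hf : ContMDiff 𝓘(ℝ, E) 𝓘(ℝ, E') ∞ f) (α : N → E' [⋀^Fin k]→L[ℝ] ℂ) (x₀ : M) (n₀ : N)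
    {y : E} (hy : y ∈ (chartAt E x₀).target)
    (hn : f ((chartAt E x₀).symm y) ∈ (chartAt E' n₀).source) :
    localRep (pullbackRaw f α) x₀ =ᶠ[𝓝 y] fun z =>
      (localRep α n₀ (localMap (E' := E') f x₀ n₀ z)).compContinuousLinearMap
        (fderiv ℝ (localMap (E := E) (E' := E') f x₀ n₀) z) := by
  have h1 : ContinuousAt (fun z => f ((chartAt E x₀).symm z)) y :=
    hf.continuous.continuousAt.comp ((chartAt E x₀).continuousAt_symm hy)
  filter_upwards [h1.preimage_mem_nhds ((chartAt E' n₀).open_source.mem_nhds hn),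
    (chartAt E x₀).open_target.mem_nhds hy] with z hz hz'
  exact localRep_pullback hf α x₀ n₀ hz' hz

theorem IsSmoothForm.pullback {k : ℕ} {f : M → N} (hf : ContMDiff 𝓘(ℝ, E) 𝓘(ℝ, E') ∞ f)
    {α : N → E' [⋀^Fin k]→L[ℝ] ℂ} (hα : IsSmoothForm α) :
    IsSmoothForm (pullbackRaw (E := E) f α) := by
  intro x₀ y hy
  set n₀ := f ((chartAt E x₀).symm y)
  have hn : f ((chartAt E x₀).symm y) ∈ (chartAt E' n₀).source := mem_chart_source _ _
  have hn' : localMap (E' := E') f x₀ n₀ y ∈ (chartAt E' n₀).target :=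
    (chartAt E' n₀).map_source hn
  have hg := contDiffAt_localMap hf x₀ n₀ hy hn
  refine ContDiffAt.contDiffWithinAt ?_
  refine ContDiffAt.congr_of_eventuallyEq ?_ (eventually_localRep_pullback hf α x₀ n₀ hy hn)
  exact contDiffAt_compCLM ((hα.contDiffAt n₀ hn').comp y hg) (hg.fderiv_right (by simp))

theorem extDeriv_localRep_pullback {k : ℕ} {f : M → N} (hf : ContMDiff 𝓘(ℝ, E) 𝓘(ℝ, E') ∞ f)
    {α : N → E' [⋀^Fin k]→L[ℝ] ℂ} (hα : IsSmoothForm α) (x₀ : M) (n₀ : N)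
    {y : E} (hy : y ∈ (chartAt E x₀).target)
    (hn : f ((chartAt E x₀).symm y) ∈ (chartAt E' n₀).source) :
    extDeriv (localRep (pullbackRaw f α) x₀) y =
      (extDeriv (localRep α n₀) (localMap (E' := E') f x₀ n₀ y)).compContinuousLinearMap
        (fderiv ℝ (localMap (E := E) (E' := E') f x₀ n₀) y) := by
  have hn' : localMap (E' := E') f x₀ n₀ y ∈ (chartAt E' n₀).target :=
    (chartAt E' n₀).map_source hn
  rw [(eventually_localRep_pullback hf α x₀ n₀ hy hn).extDeriv_eq]
  exact extDeriv_pullback ((hα.contDiffAt n₀ hn').differentiableAt (by simp))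
    (contDiffAt_localMap hf x₀ n₀ hy hn)
    (by simpa using (WithTop.coe_le_coe.2 (le_top : (2 : ℕ∞) ≤ ⊤) : (2 : ℕ∞ω) ≤ ∞))

theorem localRep_extDerivRaw {k : ℕ} {α : M → E [⋀^Fin k]→L[ℝ] ℂ} (hα : IsSmoothForm α) (x₀ : M)
    {y : E} (hy : y ∈ (chartAt E x₀).target) :
    localRep (extDerivRaw α) x₀ y = extDeriv (localRep α x₀) y := by
  have h := extDeriv_localRep_pullback (contMDiff_id (I := 𝓘(ℝ, E)) (M := M) (n := ∞)) hα x₀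
    ((chartAt E x₀).symm y) hy (mem_chart_source _ _)
  rw [pullbackRaw_id] at h
  rw [h, localRep, mfderiv_chart_symm_eq x₀ hy]
  rfl

theorem IsSmoothForm.extDerivRaw {k : ℕ} {α : M → E [⋀^Fin k]→L[ℝ] ℂ} (hα : IsSmoothForm α) :
    IsSmoothForm (extDerivRaw α) := by
  intro x₀
  have h : ContDiffOn ℝ ∞ (extDeriv (localRep α x₀)) (chartAt E x₀).target := by
    intro y hy
    refine ContDiffAt.contDiffWithinAt ?_
    have := (hα.contDiffAt x₀ hy).fderiv_right (m := ∞) (by simp)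
    exact (ContinuousAlternatingMap.alternatizeUncurryFinCLM ℝ E ℂ).contDiff.contDiffAt.comp y this
  exact h.congr fun y hy => localRep_extDerivRaw hα x₀ hy

theorem extDerivRaw_pullback {k : ℕ} {f : M → N} (hf : ContMDiff 𝓘(ℝ, E) 𝓘(ℝ, E') ∞ f)
    {α : N → E' [⋀^Fin k]→L[ℝ] ℂ} (hα : IsSmoothForm α) :
    extDerivRaw (pullbackRaw (E := E) f α) = pullbackRaw f (extDerivRaw α) := by
  funext x
  have hx : (chartAt E x).symm (chartAt E x x) = x := (chartAt E x).left_inv (mem_chart_source _ _)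
  have h := extDeriv_localRep_pullback hf hα x (f x) (mem_chart_target E x)
    (by rw [hx]; exact mem_chart_source _ _)
  rw [extDerivRaw, h, pullbackRaw, mfderiv_eq_localMap hf, extDerivRaw, localMap, hx]

end Forms

/-- The abelian group `Ω^k(M, ℂ)` of smooth complex-valued `k`-forms on the manifold `M` modelled
on `E`. -/
def Form (E : Type*) [NormedAddCommGroup E] [NormedSpace ℝ E] (M : Type*) [TopologicalSpace M]
    [ChartedSpace E M] (k : ℕ) : AddSubgroup (M → E [⋀^Fin k]→L[ℝ] ℂ) where
  carrier := {α | IsSmoothForm α}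
  add_mem' := fun ha hb x₀ => (ha x₀).add (hb x₀)
  zero_mem' := fun x₀ => by
    rw [localRep_zero]
    exact contDiffOn_const
  neg_mem' := fun ha x₀ => (ha x₀).neg

section Ops
variable {E M : Type*} [NormedAddCommGroup E] [NormedSpace ℝ E] [TopologicalSpace M]
  [ChartedSpace E M] [IsManifold 𝓘(ℝ, E) ∞ M]
variable {E' N : Type*} [NormedAddCommGroup E'] [NormedSpace ℝ E'] [TopologicalSpace N]
  [ChartedSpace E' N] [IsManifold 𝓘(ℝ, E') ∞ N]

/-- The exterior derivative `d : Ω^k(M) → Ω^{k+1}(M)`. -/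
def dForm (k : ℕ) : Form E M k →+ Form E M (k + 1) where
  toFun := fun α => ⟨extDerivRaw α.1, IsSmoothForm.extDerivRaw α.2⟩
  map_zero' := by
    apply Subtype.ext
    funext x
    change ContinuousAlternatingMap.alternatizeUncurryFin
      (fderiv ℝ (fun _ : E => (0 : E [⋀^Fin k]→L[ℝ] ℂ)) _) = 0
    rw [fderiv_const_apply]
    exact map_zero (ContinuousAlternatingMap.alternatizeUncurryFinCLM ℝ E ℂ)
  map_add' := fun α β => by
    apply Subtype.ext
    funext x
    exact extDeriv_add
      ((IsSmoothForm.contDiffAt α.2 x (mem_chart_target E x)).differentiableAt (by simp))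
      ((IsSmoothForm.contDiffAt β.2 x (mem_chart_target E x)).differentiableAt (by simp))

/-- The pullback `f^* : Ω^k(N) → Ω^k(M)` along a smooth map `f : M → N`. -/
def pullback (f : C^∞⟮𝓘(ℝ, E), M; 𝓘(ℝ, E'), N⟯) (k : ℕ) : Form E' N k →+ Form E M k where
  toFun := fun α => ⟨pullbackRaw f α.1, IsSmoothForm.pullback f.contMDiff α.2⟩
  map_zero' := rfl
  map_add' := fun _ _ => rfl

theorem dForm_pullback (f : C^∞⟮𝓘(ℝ, E), M; 𝓘(ℝ, E'), N⟯) (k : ℕ) (α : Form E' N k) :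
    dForm k (pullback f k α) = pullback f (k + 1) (dForm k α) :=
  Subtype.ext (extDerivRaw_pullback f.contMDiff α.2)

theorem dForm_dForm (k : ℕ) (α : Form E M k) : dForm (k + 1) (dForm k α) = 0 := by
  apply Subtype.ext
  funext x
  have hx := mem_chart_target E x
  have h : localRep (extDerivRaw α.1) x =ᶠ[𝓝 (chartAt E x x)] extDeriv (localRep α.1 x) := by
    filter_upwards [(chartAt E x).open_target.mem_nhds hx] with y hy
    exact localRep_extDerivRaw α.2 x hy
  change extDeriv (localRep (extDerivRaw α.1) x) (chartAt E x x) = 0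
  rw [h.extDeriv_eq]
  exact extDeriv_extDeriv_apply (IsSmoothForm.contDiffAt α.2 x hx)
    (by simpa using (WithTop.coe_le_coe.2 (le_top : (2 : ℕ∞) ≤ ⊤) : (2 : ℕ∞ω) ≤ ∞))

end Ops

/-- A closed oriented smooth `k`-manifold (`k ≥ 1`): compact, Hausdorff, without boundary, with an
oriented atlas, i.e. all transition maps have positive Jacobian.  It need not be connected. -/
structure ClosedOrientedManifold (k : ℕ) where
  /-- The underlying set. -/
  carrier : Type
  [top : TopologicalSpace carrier]
  [t2 : T2Space carrier]
  [compact : CompactSpace carrier]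
  [charted : ChartedSpace (EuclideanSpace ℝ (Fin k)) carrier]
  [smooth : IsManifold 𝓘(ℝ, EuclideanSpace ℝ (Fin k)) ∞ carrier]
  oriented : ∀ e ∈ atlas (EuclideanSpace ℝ (Fin k)) carrier,
    ∀ e' ∈ atlas (EuclideanSpace ℝ (Fin k)) carrier, ∀ y ∈ (e.symm.trans e').source,
      0 < (fderiv ℝ (fun z => e' (e.symm z)) y).det

namespace ClosedOrientedManifold

attribute [instance] top t2 compact charted smooth

variable {k : ℕ} (S : ClosedOrientedManifold k)

/-- A smooth partition of unity on `S` subordinate to the chart domains. -/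
def partition :
    SmoothPartitionOfUnity S.carrier 𝓘(ℝ, EuclideanSpace ℝ (Fin k)) S.carrier univ :=
  (SmoothPartitionOfUnity.exists_isSubordinate_chartAt_source
    𝓘(ℝ, EuclideanSpace ℝ (Fin k)) S.carrier).choose

theorem partition_subordinate :
    S.partition.IsSubordinate fun x => (chartAt (EuclideanSpace ℝ (Fin k)) x).source :=
  (SmoothPartitionOfUnity.exists_isSubordinate_chartAt_source
    𝓘(ℝ, EuclideanSpace ℝ (Fin k)) S.carrier).choose_spec

/-- The coefficient of `dy₁ ∧ ⋯ ∧ dy_k` in the expression of `ρ_x α` in the chart at `x`. -/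
def density (α : S.carrier → EuclideanSpace ℝ (Fin k) [⋀^Fin k]→L[ℝ] ℂ) (x : S.carrier)
    (y : EuclideanSpace ℝ (Fin k)) : ℂ :=
  S.partition x ((chartAt (EuclideanSpace ℝ (Fin k)) x).symm y) •
    localRep α x y fun i => EuclideanSpace.single i 1

theorem density_integrableOn {α : S.carrier → EuclideanSpace ℝ (Fin k) [⋀^Fin k]→L[ℝ] ℂ}
    (hα : IsSmoothForm α) (x : S.carrier) :
    MeasureTheory.IntegrableOn (S.density α x)
      (chartAt (EuclideanSpace ℝ (Fin k)) x).target := by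
  set φ := chartAt (EuclideanSpace ℝ (Fin k)) x
  have hsub : tsupport (S.partition x) ⊆ φ.source := S.partition_subordinate x
  have hK : IsCompact (φ '' tsupport (S.partition x)) :=
    (isClosed_tsupport _).isCompact.image_of_continuousOn (φ.continuousOn.mono hsub)
  have hKt : φ '' tsupport (S.partition x) ⊆ φ.target := by
    rintro _ ⟨z, hz, rfl⟩
    exact φ.map_source (hsub hz)
  have hc : ContinuousOn (S.density α x) φ.target := by
    refine ContinuousOn.smul (M := ℝ) (X := ℂ) ?_ ?_
    · exact (S.partition x).contMDiff.continuous.comp_continuousOn φ.continuousOn_symm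
    · have h1 := (hα x).continuousOn
      have h2 : Continuous fun L : EuclideanSpace ℝ (Fin k) [⋀^Fin k]→L[ℝ] ℂ =>
          L fun i => EuclideanSpace.single i (1 : ℝ) :=
        (ContinuousAlternatingMap.apply ℝ (EuclideanSpace ℝ (Fin k)) ℂ
          (fun i => EuclideanSpace.single i (1 : ℝ))).continuous
      exact h2.comp_continuousOn h1
  refine ((hc.mono hKt).integrableOn_compact hK).of_forall_sdiff_eq_zero
    φ.open_target.measurableSet ?_
  rintro y ⟨hy, hyK⟩
  have h0 : S.partition x (φ.symm y) = 0 := by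
    by_contra h
    exact hyK ⟨φ.symm y, subset_tsupport _ h, φ.right_inv hy⟩
  rw [density]
  change S.partition x (φ.symm y) • _ = _
  rw [h0, zero_smul]

theorem density_finite (α : S.carrier → EuclideanSpace ℝ (Fin k) [⋀^Fin k]→L[ℝ] ℂ) :
    (support fun x => ∫ y in (chartAt (EuclideanSpace ℝ (Fin k)) x).target,
      S.density α x y).Finite := by
  refine (S.partition.locallyFinite.finite_nonempty_of_compact).subset fun x hx => ?_
  by_contra h
  apply hx
  rw [mem_ofPred_eq, not_nonempty_iff_eq_empty, support_eq_empty_iff] at h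
  have h1 : ∀ y, S.density α x y = 0 := by
    intro y
    have := congrFun h ((chartAt (EuclideanSpace ℝ (Fin k)) x).symm y)
    rw [density, this]
    exact zero_smul _ _
  simp [h1]

/-- The integral `∫_S α` of smooth `k`-forms over the closed oriented `k`-manifold `S`:
`∑_x ∫_{ℝ^k} (ρ_x α)` computed in the charts, for a partition of unity `ρ` subordinate to the
chart domains (it does not depend on the choice of `ρ`). -/
def integral : Form (EuclideanSpace ℝ (Fin k)) S.carrier k →+ ℂ where
  toFun := fun α => ∑ᶠ x : S.carrier,
    ∫ y in (chartAt (EuclideanSpace ℝ (Fin k)) x).target, S.density α.1 x y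
  map_zero' := by
    have h : ∀ x y, S.density 0 x y = 0 := fun x y => smul_zero _
    change ∑ᶠ x : S.carrier, ∫ y in (chartAt (EuclideanSpace ℝ (Fin k)) x).target,
      S.density 0 x y = 0
    simp [h]
  map_add' := fun α β => by
    rw [← finsum_add_distrib (S.density_finite α.1) (S.density_finite β.1)]
    refine finsum_congr fun x => ?_
    rw [← MeasureTheory.integral_add (S.density_integrableOn α.2 x)
      (S.density_integrableOn β.2 x)]
    congr 1
    funext y
    exact smul_add _ _ _

end ClosedOrientedManifold

section Cohomology
variable {C : ℕ → Type*} [∀ k, AddCommGroup (C k)] (d : ∀ k, C k →+ C (k + 1))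

/-- The coboundaries of degree `k` of a cochain complex of abelian groups in degrees `≥ 0`. -/
def coboundaries : ∀ k, AddSubgroup (C k)
  | 0 => ⊥
  | k + 1 => (d k).range

/-- The cohomology of a cochain complex: cocycles modulo coboundaries. -/
def Cohomology (k : ℕ) : Type _ :=
  (d k).ker ⧸ (coboundaries d k).addSubgroupOf (d k).ker

instance (k : ℕ) : AddCommGroup (Cohomology d k) :=
  inferInstanceAs (AddCommGroup ((d k).ker ⧸ (coboundaries d k).addSubgroupOf (d k).ker))

/-- The cohomology class of a cocycle. -/
def cohClass (k : ℕ) : (d k).ker →+ Cohomology d k :=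
  QuotientAddGroup.mk' ((coboundaries d k).addSubgroupOf (d k).ker)

end Cohomology

/-- Every open covering of the manifold `B` modelled on `E` has a subordinate smooth partition of
unity. -/
def AdmitsSmoothPartitionsOfUnity.{u, v} (E : Type v) [NormedAddCommGroup E] [NormedSpace ℝ E]
    (B : Type u) [TopologicalSpace B] [ChartedSpace E B] : Prop :=
  ∀ (J : Type u) (W : J → Set B), (∀ j, IsOpen (W j)) → ⋃ j, W j = univ →
    ∃ ρ : SmoothPartitionOfUnity J 𝓘(ℝ, E) B univ, ρ.IsSubordinate W

/-- A good (Leray) covering: an open covering all of whose non-empty finite intersections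
`U_{λ₀} ∩ ⋯ ∩ U_{λ_p}` are contractible. -/
structure IsGoodCovering {B ι : Type*} [TopologicalSpace B] (U : ι → Opens B) : Prop where
  covers : ∀ b : B, ∃ i, b ∈ U i
  contractible : ∀ s : Finset ι, s.Nonempty → (⋂ i ∈ s, (U i : Set B)).Nonempty →
    ContractibleSpace (⋂ i ∈ s, (U i : Set B) : Set B)

section Bundle
variable {V A : Type*} [NormedAddCommGroup V] [NormedSpace ℝ V] [TopologicalSpace A]
  [ChartedSpace V A]
variable {E B : Type*} [NormedAddCommGroup E] [NormedSpace ℝ E] [TopologicalSpace B]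
  [ChartedSpace E B]

/-- `π : A → B` is a smooth fibre bundle with typical fibre the manifold `F`: near every point of
`B` there is a smooth local trivialization, i.e. a diffeomorphism `π⁻¹(W) ≅ W × F` over `W`. -/
def IsSmoothFibreBundle {EF : Type*} [NormedAddCommGroup EF] [NormedSpace ℝ EF]
    (F : Type*) [TopologicalSpace F] [ChartedSpace EF F]
    (π : C^∞⟮𝓘(ℝ, V), A; 𝓘(ℝ, E), B⟯) : Prop :=
  ∀ b : B, ∃ e : Bundle.Trivialization F π, b ∈ e.baseSet ∧
    ContMDiffOn 𝓘(ℝ, V) (𝓘(ℝ, E).prod 𝓘(ℝ, EF)) ∞ e e.source ∧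
    ContMDiffOn (𝓘(ℝ, E).prod 𝓘(ℝ, EF)) 𝓘(ℝ, V) ∞ e.toOpenPartialHomeomorph.symm e.target

/-- The inclusion of an open subset, as a smooth map. -/
def inclusion (U : Opens B) : C^∞⟮𝓘(ℝ, E), U; 𝓘(ℝ, E), B⟯ :=
  ⟨Subtype.val, contMDiff_subtype_val⟩

/-- The open subset `π⁻¹(U)` of `A`. -/
def preimage (π : C^∞⟮𝓘(ℝ, V), A; 𝓘(ℝ, E), B⟯) (U : Opens B) : Opens A :=
  ⟨π ⁻¹' U, U.isOpen.preimage π.contMDiff.continuous⟩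

/-- The restriction `π⁻¹(U) → U` of `π`. -/
def restrict (π : C^∞⟮𝓘(ℝ, V), A; 𝓘(ℝ, E), B⟯) (U : Opens B) :
    C^∞⟮𝓘(ℝ, V), preimage π U; 𝓘(ℝ, E), U⟯ :=
  ⟨fun x => ⟨π x, x.2⟩, (ContMDiff.subtypeVal_comp_iff U _).1
    (π.contMDiff.comp contMDiff_subtype_val)⟩

variable [IsManifold 𝓘(ℝ, V) ∞ A] [IsManifold 𝓘(ℝ, E) ∞ B]
variable (π : C^∞⟮𝓘(ℝ, V), A; 𝓘(ℝ, E), B⟯)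

/-- `Ω^k(A → B)`: the quotient of `Ω^k(A)` by the forms `π^* β`, `β ∈ Ω^k(B)`. -/
def RelForm (k : ℕ) : Type _ := Form V A k ⧸ (pullback π k).range

instance (k : ℕ) : AddCommGroup (RelForm π k) :=
  inferInstanceAs (AddCommGroup (Form V A k ⧸ (pullback π k).range))

/-- The class in `Ω^k(A → B)` of a form on `A`. -/
def relClass (k : ℕ) : Form V A k →+ RelForm π k := QuotientAddGroup.mk' (pullback π k).range

/-- The coboundary operator of `Ω^•(A → B)`, induced by the exterior derivative. -/
def relD (k : ℕ) : RelForm π k →+ RelForm π (k + 1) :=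
  QuotientAddGroup.map _ _ (dForm k) (by
    rintro _ ⟨β, rfl⟩
    exact ⟨dForm k β, (dForm_pullback π k β).symm⟩)

/-- `H^k_{dR}(A → B)`. -/
abbrev HRel (k : ℕ) : Type _ := Cohomology (relD π) k

/-- The forms `η` in `Ω^k(A)` such that `∫_S η ∈ 2πiℤ` for every closed oriented `k`-manifold `S`
in a fibre of `π`, i.e. for every smooth map `f : S → A` with image in one fibre. -/
def fibreIntegralForms (k : ℕ) : AddSubgroup (Form V A k) where
  carrier := {η | ∀ (S : ClosedOrientedManifold k)
    (f : C^∞⟮𝓘(ℝ, EuclideanSpace ℝ (Fin k)), S.carrier; 𝓘(ℝ, V), A⟯),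
    (∃ b : B, ∀ s, π (f s) = b) →
      S.integral (pullback f k η) ∈ AddSubgroup.zmultiples (2 * Real.pi * Complex.I)}
  add_mem' := fun ha hb S f hf => by
    rw [map_add, map_add]
    exact add_mem (ha S f hf) (hb S f hf)
  zero_mem' := fun S f _ => by
    rw [map_zero, map_zero]
    exact zero_mem _
  neg_mem' := fun ha S f hf => by
    rw [map_neg, map_neg]
    exact neg_mem (ha S f hf)

/-- `H^k_{dR,0}(A → B)`: the subgroup of `H^k_{dR}(A → B)` of the classes represented by a form on
`A` with integrals in `2πiℤ` over the closed `k`-manifolds in the fibres. -/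
def HRelInt (k : ℕ) : AddSubgroup (HRel π k) :=
  (((fibreIntegralForms π k).map (relClass π k)).addSubgroupOf (relD π k).ker).map
    (cohClass (relD π) k)

variable {ι : Type*} (U : ι → Opens B)

/-- The family of the `k`-forms `η|_{π⁻¹(U_λ)} - π^* β_λ` on `π⁻¹(U_λ)`, for `η ∈ Ω^k(A)` and
`β_λ ∈ Ω^k(U_λ)`. -/
def tildeFamily (k : ℕ) :
    Form V A k × (∀ i, Form E (U i) k) →+ ∀ i, Form V (preimage π (U i)) k :=
  AddMonoidHom.pi fun i =>
    (pullback (inclusion (preimage π (U i))) k).comp (AddMonoidHom.fst _ _) -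
      (pullback (restrict π (U i)) k).comp
        ((Pi.evalAddMonoidHom _ i).comp (AddMonoidHom.snd _ _))

/-- The group `Ω̃^k({U_λ}, A → B)` of the families of `k`-forms on the sets `π⁻¹(U_λ)` of the type
`η|_{π⁻¹(U_λ)} - π^* β_λ`. -/
abbrev TildeForm (k : ℕ) : AddSubgroup (∀ i, Form V (preimage π (U i)) k) :=
  (tildeFamily π U k).range

/-- The element `{η|_{π⁻¹(U_λ)} - π^* β_λ}` of `Ω̃^k({U_λ}, A → B)`. -/
def tildeForm (k : ℕ) (η : Form V A k) (β : ∀ i, Form E (U i) k) : TildeForm π U k :=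
  (tildeFamily π U k).rangeRestrict (η, β)

theorem dForm_tildeFamily (k : ℕ) (p : Form V A k × (∀ i, Form E (U i) k)) (i : ι) :
    dForm k (tildeFamily π U k p i) =
      tildeFamily π U (k + 1) (dForm k p.1, fun j => dForm k (p.2 j)) i := by
  change dForm k (pullback _ k p.1 - pullback _ k (p.2 i)) =
    pullback _ (k + 1) (dForm k p.1) - pullback _ (k + 1) (dForm k (p.2 i))
  rw [map_sub, dForm_pullback, dForm_pullback]

/-- The coboundary operator of `Ω̃^•({U_λ}, A → B)`: the exterior derivative of each member of the
family. -/
def tildeD (k : ℕ) : TildeForm π U k →+ TildeForm π U (k + 1) :=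
  ((AddMonoidHom.pi fun i => (dForm k).comp (Pi.evalAddMonoidHom _ i)).comp
    (TildeForm π U k).subtype).codRestrict (TildeForm π U (k + 1)) (by
      rintro ⟨_, p, rfl⟩
      exact ⟨(dForm k p.1, fun j => dForm k (p.2 j)),
        (funext fun i => dForm_tildeFamily π U k p i).symm⟩)

/-- `H̃^k(A → B)`, computed from the covering `U`. -/
abbrev HTilde (k : ℕ) : Type _ := Cohomology (tildeD π U) k

/-- The families `{η_λ}` in `Ω̃^k({U_λ}, A → B)` such that `∫_S η_λ ∈ 2πiℤ` for every `λ` and every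
closed oriented `k`-manifold `S` in `π⁻¹(U_λ)`, i.e. for every smooth map `f : S → π⁻¹(U_λ)`. -/
def tildeIntegralForms (k : ℕ) : AddSubgroup (TildeForm π U k) where
  carrier := {η | ∀ (i : ι) (S : ClosedOrientedManifold k)
    (f : C^∞⟮𝓘(ℝ, EuclideanSpace ℝ (Fin k)), S.carrier; 𝓘(ℝ, V), preimage π (U i)⟯),
      S.integral (pullback f k (η.1 i)) ∈ AddSubgroup.zmultiples (2 * Real.pi * Complex.I)}
  add_mem' := fun ha hb i S f => by
    rw [AddSubgroup.coe_add, Pi.add_apply, map_add, map_add]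
    exact add_mem (ha i S f) (hb i S f)
  zero_mem' := fun i S f => by
    rw [AddSubgroup.coe_zero, Pi.zero_apply, map_zero, map_zero]
    exact zero_mem _
  neg_mem' := fun ha i S f => by
    rw [AddSubgroup.coe_neg, Pi.neg_apply, map_neg, map_neg]
    exact neg_mem (ha i S f)

/-- `H̃^k_0(A → B)`: the subgroup of `H̃^k(A → B)` of the classes represented by a family with
integrals in `2πiℤ` over the closed `k`-manifolds in the sets `π⁻¹(U_λ)`. -/
def HTildeInt (k : ℕ) : AddSubgroup (HTilde π U k) :=
  ((tildeIntegralForms π U k).addSubgroupOf (tildeD π U k).ker).map (cohClass (tildeD π U) k)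

end Bundle
end FibredDeRham
end

open FibredDeRham (AdmitsSmoothPartitionsOfUnity IsSmoothFibreBundle IsGoodCovering Form
  relClass relD HRel HRelInt tildeForm tildeD HTilde HTildeInt cohClass)

/-! If a family `{η - π^* β_λ}` vanishes, then `η` comes from the base over every `U_λ`; as `π` is a
surjective submersion, the forms on the base are unique and glue, so `η` lies in `π^* Ω^k(B)`. Hence
`{η - π^* β_λ} ↦ [η]` is a well-defined cochain map `tildeToRel`, and the isomorphism is the map it
induces on cohomology, restricted to the integral subgroups.

Bijectivity rests on the Poincaré lemma for the `U_λ`. If `dη = π^* b`, then `db = 0` because `π^*`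
is injective, and primitives `β_λ` of `b` on `U_λ` make `{η - π^* β_λ}` a closed lift of `[η]`
(`exists_closed_tildeForm`). If a closed family has `η = dξ + π^* b`, then `b - β_λ` is closed on
`U_λ`, so it equals `dδ_λ`, and the family is the coboundary of `{ξ + π^* δ_λ}`
(`exists_tildeD_eq`).

The integrality conditions correspond (`map_HTildeInt`). On a manifold in a fibre `π^* β_λ`
vanishes, since `k ≥ 1`, so there the integrals of `η` and of the family agree. A closed manifold in
`π⁻¹(U_λ)` can be carried along a contraction of `U_λ` into one fibre, and by Stokes the integral of
a closed form does not change (`exists_in_fibre_integral_eq`). The homotopy is lifted to the total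
space by local trivializations, switched on one after another by a partition of unity on the compact
manifold; no connection is used.

Both arguments need a smooth contraction of `U_λ`, whereas a good covering provides a continuous
one. A Whitney approximation theorem bridges this for arbitrary normed model spaces. Its only
resource is the existence of bump functions (`HasBumps`), which passes from `B` to open subsets and
to products with compact manifolds. Smoothing is done chart by chart, with the values kept in
prescribed convex balls, and Zorn's lemma assembles the infinitely many modifications. -/

noncomputable section

open Set Function Filter

namespace FibredDeRham

/-! ### Assembling infinitely many local modifications -/

section Patching

/-- Successive modification of a function along a locally finite family of sets `Q i`, where the
modification along `Q i` achieves the property `R i` (local in the source) and preserves the local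
property `R₀` and all the properties `R j`. -/
theorem exists_forall_of_locallyFinite_modification {X Y I : Type*} [TopologicalSpace X]
    {Q : I → Set X} (hQ : LocallyFinite Q)
    (R₀ : (X → Y) → X → Prop) (R : I → (X → Y) → X → Prop)
    (loc₀ : ∀ f g z, f =ᶠ[𝓝 z] g → R₀ f z → R₀ g z)
    (loc : ∀ i f g z, f =ᶠ[𝓝 z] g → R i f z → R i g z)
    (step : ∀ i f, (∀ z, R₀ f z) → ∃ f', (∀ z, R₀ f' z) ∧ (∀ z, R i f' z) ∧
      (∀ z, z ∉ Q i → f' z = f z) ∧ ∀ j, (∀ z, R j f z) → ∀ z, R j f' z)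
    (f₀ : X → Y) (h₀ : ∀ z, R₀ f₀ z) :
    ∃ f, (∀ z, R₀ f z) ∧ (∀ i z, R i f z) ∧ ∀ z, (∀ i, z ∉ Q i) → f z = f₀ z := by
  classical
  -- Zorn's lemma for pairs of a set of treated indices and a function. In the preorder `r` a larger
  -- pair differs from a smaller one only on the sets `Q j` of the newly treated indices.
  let good : Set I × (X → Y) → Prop := fun p =>
    (∀ z, R₀ p.2 z) ∧ (∀ i ∈ p.1, ∀ z, R i p.2 z) ∧ ∀ z, (∀ i, z ∉ Q i) → p.2 z = f₀ z
  let r : {p // good p} → {p // good p} → Prop := fun a b =>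
    a.1.1 ⊆ b.1.1 ∧ ∀ z, (∀ j ∈ b.1.1, j ∉ a.1.1 → z ∉ Q j) → b.1.2 z = a.1.2 z
  have hrefl : ∀ a, r a a := fun a => ⟨subset_rfl, fun _ _ => rfl⟩
  have htrans : ∀ {a b c}, r a b → r b c → r a c := by
    intro a b c hab hbc
    refine ⟨hab.1.trans hbc.1, fun z hz => ?_⟩
    rw [hbc.2 z fun j hj hj' => hz j hj fun h => hj' (hab.1 h),
      hab.2 z fun j hj hj' => hz j (hbc.1 hj) hj']
  have hchain : ∀ c : Set {p // good p}, IsChain r c → ∃ ub, ∀ a ∈ c, r a ub := by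
    intro c hc
    rcases c.eq_empty_or_nonempty with rfl | ⟨a₀, ha₀⟩
    · exact ⟨⟨(∅, f₀), h₀, by simp, fun _ _ => rfl⟩, by simp⟩
    have hdir : ∀ a ∈ c, ∀ b ∈ c, ∃ d ∈ c, r a d ∧ r b d := by
      intro a ha b hb
      by_cases hab : a = b
      · subst hab
        exact ⟨a, ha, hrefl a, hrefl a⟩
      · rcases hc ha hb hab with h | h
        · exact ⟨b, hb, h, hrefl b⟩
        · exact ⟨a, ha, hrefl a, h⟩
    let J : Set I := {j | ∃ a ∈ c, j ∈ a.1.1}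
    have hfin : ∀ K : Finset I, ↑K ⊆ J → ∃ a ∈ c, ↑K ⊆ a.1.1 := by
      intro K
      induction K using Finset.induction_on with
      | empty => exact fun _ => ⟨a₀, ha₀, by simp⟩
      | insert j K _ ih =>
        intro hK
        rw [Finset.coe_insert, insert_subset_iff] at hK
        obtain ⟨a, ha, haK⟩ := ih hK.2
        obtain ⟨b, hb, hbj⟩ := hK.1
        obtain ⟨d, hd, had, hbd⟩ := hdir a ha b hb
        refine ⟨d, hd, ?_⟩
        rw [Finset.coe_insert, insert_subset_iff]
        exact ⟨hbd.1 hbj, haK.trans had.1⟩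
    -- Near `z` only finitely many `Q j` matter, so some member of the chain has treated them all.
    -- From this member on, the functions of the chain no longer change near `z`, and `f` is their
    -- eventual value.
    have hloc : ∀ z, ∃ a ∈ c, ∃ N ∈ 𝓝 z, ∀ j ∈ J, j ∉ a.1.1 → ∀ w ∈ N, w ∉ Q j := by
      intro z
      obtain ⟨N, hN, hNf⟩ := hQ z
      have hKf : {j ∈ J | (Q j ∩ N).Nonempty}.Finite := hNf.subset fun j hj => hj.2
      obtain ⟨a, ha, haK⟩ := hfin hKf.toFinset (by intro j hj; simp at hj; exact hj.1)
      refine ⟨a, ha, N, hN, fun j hj hja w hw hwj => hja (haK ?_)⟩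
      simpa using ⟨hj, w, hwj, hw⟩
    choose a hac N hN haN using hloc
    let f : X → Y := fun z => (a z).1.2 z
    have hf : ∀ z, ∀ b ∈ c, r (a z) b → ∀ w ∈ N z, f w = b.1.2 w := by
      intro z b hb hzb w hw
      obtain ⟨d, hd, hbd, hwd⟩ := hdir b hb (a w) (hac w)
      have h1 : d.1.2 w = b.1.2 w := hbd.2 w fun j hj hjb =>
        haN z j ⟨d, hd, hj⟩ (fun h => hjb (hzb.1 h)) w hw
      have h2 : d.1.2 w = (a w).1.2 w := hwd.2 w fun j hj hjb =>
        haN w j ⟨d, hd, hj⟩ hjb w (mem_of_mem_nhds (hN w))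
      exact h2.symm.trans h1
    have hfz : ∀ z, ∀ b ∈ c, r (a z) b → b.1.2 =ᶠ[𝓝 z] f := fun z b hb hzb => by
      filter_upwards [hN z] with w hw using (hf z b hb hzb w hw).symm
    refine ⟨⟨(J, f), ?_, ?_, ?_⟩, ?_⟩
    · exact fun z => loc₀ _ _ z (hfz z _ (hac z) (hrefl _)) ((a z).2.1 z)
    · rintro j ⟨b, hb, hj⟩ z
      obtain ⟨d, hd, hbd, hzd⟩ := hdir b hb (a z) (hac z)
      exact loc j _ _ z (hfz z d hd hzd) (d.2.2.1 j (hbd.1 hj) z)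
    · exact fun z hz => (a z).2.2.2 z hz
    · intro b hb
      refine ⟨fun j hj => ⟨b, hb, hj⟩, fun z hz => ?_⟩
      obtain ⟨d, hd, hbd, hzd⟩ := hdir b hb (a z) (hac z)
      have h1 := hf z d hd hzd z (mem_of_mem_nhds (hN z))
      exact h1.trans (hbd.2 z fun j hj hjb => hz j ⟨d, hd, hj⟩ hjb)
  obtain ⟨m, hm⟩ := exists_maximal_of_chains_bounded hchain htrans
  refine ⟨m.1.2, m.2.1, fun i => ?_, m.2.2.2⟩
  by_contra hi'
  have hi : i ∉ m.1.1 := fun h => hi' (m.2.2.1 i h)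
  obtain ⟨f', h1, h2, h3, h4⟩ := step i m.1.2 m.2.1
  have hgood : good (insert i m.1.1, f') := by
    refine ⟨h1, ?_, fun z hz => (h3 z (hz i)).trans (m.2.2.2 z hz)⟩
    rintro j (rfl | hj)
    · exact h2
    · exact h4 j (m.2.2.1 j hj)
  have hle : r m ⟨_, hgood⟩ :=
    ⟨subset_insert _ _, fun z hz => h3 z (hz i (mem_insert _ _) hi)⟩
  exact hi ((hm _ hle).1 (mem_insert _ _))

end Patching

end FibredDeRham
end

noncomputable section

open Set Function Filter

namespace FibredDeRham

/-! ### Bump functions, smooth selections and plateaus -/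

section Bumps

variable {E H X : Type*} [NormedAddCommGroup E] [NormedSpace ℝ E] [TopologicalSpace H]
  [TopologicalSpace X] [ChartedSpace H X]

/-- Every assignment of neighbourhoods `W x` of the points `x` of `X` has a subordinate locally
finite family of nonnegative smooth functions without common zeros. -/
def HasBumps (I : ModelWithCorners ℝ E H) (X : Type*) [TopologicalSpace X] [ChartedSpace H X] :
    Prop :=
  ∀ W : X → Set X, (∀ x, W x ∈ 𝓝 x) → ∃ g : X → X → ℝ, (∀ x, ContMDiff I 𝓘(ℝ, ℝ) ∞ (g x)) ∧
    (∀ x y, 0 ≤ g x y) ∧ (LocallyFinite fun x => support (g x)) ∧ (∀ x, tsupport (g x) ⊆ W x) ∧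
    ∀ y, ∃ x, 0 < g x y

/-- Asking for positivity instead of sum one makes `HasBumps` easy to hand on to products and open
subsets; `HasBumps.exists_sum_eq_one` restores the normalization. -/
theorem AdmitsSmoothPartitionsOfUnity.hasBumps [ChartedSpace E X]
    (h : AdmitsSmoothPartitionsOfUnity E X) : HasBumps 𝓘(ℝ, E) X := by
  intro W hW
  obtain ⟨ρ, hρ⟩ := h X (fun x => interior (W x)) (fun x => isOpen_interior)
    (eq_univ_of_forall fun x => mem_iUnion.2 ⟨x, mem_interior_iff_mem_nhds.2 (hW x)⟩)
  exact ⟨fun x => ρ x, fun x => (ρ x).contMDiff, ρ.nonneg, ρ.locallyFinite,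
    fun x => (hρ x).trans interior_subset, fun y => ρ.exists_pos_of_mem (mem_univ y)⟩

variable {I : ModelWithCorners ℝ E H}

theorem finsum_pos_of_exists {Y : Type*} {f : Y → ℝ} (hf : (support f).Finite)
    (h0 : ∀ y, 0 ≤ f y) (h : ∃ y, 0 < f y) : 0 < ∑ᶠ y, f y := by
  obtain ⟨y, hy⟩ := h
  exact hy.trans_le (single_le_finsum y hf h0)

theorem HasBumps.exists_sum_eq_one (h : HasBumps I X) (W : X → Set X) (hW : ∀ x, W x ∈ 𝓝 x) :
    ∃ g : X → X → ℝ, (∀ x, ContMDiff I 𝓘(ℝ, ℝ) ∞ (g x)) ∧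
    (∀ x y, 0 ≤ g x y) ∧ (LocallyFinite fun x => support (g x)) ∧ (∀ x, tsupport (g x) ⊆ W x) ∧
    ∀ y, ∑ᶠ x, g x y = 1 := by
  obtain ⟨g, h1, h2, h3, h4, h5⟩ := h W hW
  have hfin : ∀ y, (support fun x => g x y).Finite := fun y => h3.point_finite y
  have hpos : ∀ y, 0 < ∑ᶠ x, g x y := fun y =>
    finsum_pos_of_exists (hfin y) (fun x => h2 x y) (h5 y)
  have hsup : ∀ x, support (fun y => g x y / ∑ᶠ x, g x y) ⊆ support (g x) := fun x y hy hy' => by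
    apply hy
    change g x y / _ = 0
    rw [hy', zero_div]
  refine ⟨fun x y => g x y / ∑ᶠ x, g x y, fun x => ?_, fun x y => ?_, ?_, fun x => ?_, fun y => ?_⟩
  · exact (h1 x).div₀ (contMDiff_finsum h1 h3) fun y => (hpos y).ne'
  · exact div_nonneg (h2 x y) (hpos y).le
  · exact h3.subset hsup
  · exact (closure_mono (hsup x)).trans (h4 x)
  · simp_rw [div_eq_mul_inv]
    rw [← finsum_mul, mul_inv_cancel₀ (hpos y).ne']

/-- Smooth selections of convex-valued multimaps which locally have constant selections. -/
theorem HasBumps.exists_contMDiff_mem_convex {F : Type*} [NormedAddCommGroup F] [NormedSpace ℝ F]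
    (h : HasBumps I X) (t : X → Set F) (ht : ∀ x, Convex ℝ (t x))
    (hloc : ∀ x, ∃ c, ∀ᶠ y in 𝓝 x, c ∈ t y) :
    ∃ g : X → F, ContMDiff I 𝓘(ℝ, F) ∞ g ∧ ∀ x, g x ∈ t x := by
  choose c hc using hloc
  obtain ⟨g, h1, h2, h3, h4, h5⟩ := h.exists_sum_eq_one (fun x => {y | c x ∈ t y}) hc
  refine ⟨fun y => ∑ᶠ x, g x y • c x, ?_, fun y => ?_⟩
  · exact contMDiff_finsum (fun x => (h1 x).smul contMDiff_const)
      (h3.subset fun x => support_smul_subset_left _ _)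
  · exact (ht y).finsum_mem (fun x => h2 x y) (h5 y)
      fun x hx => h4 x (subset_tsupport _ hx)

/-- With `∑ g_x = 1`, the largest of the finitely many non-zero values `g_x(y)` is at least `q(y) =
∑ g_x(y)²`. So at every point some smooth quotient `g_x / q` is at least `1`, and a cut-off function
of this quotient is a plateau there. -/
theorem HasBumps.exists_plateaus (h : HasBumps I X) (W : X → Set X) (hW : ∀ x, W x ∈ 𝓝 x) :
    ∃ χ : X → X → ℝ, (∀ x, ContMDiff I 𝓘(ℝ, ℝ) ∞ (χ x)) ∧ (∀ x y, χ x y ∈ Icc (0 : ℝ) 1) ∧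
    (LocallyFinite fun x => tsupport (χ x)) ∧ (∀ x, tsupport (χ x) ⊆ W x) ∧
    ∀ y, ∃ x, χ x =ᶠ[𝓝 y] 1 := by
  obtain ⟨g, h1, h2, h3, h4, h5⟩ := h.exists_sum_eq_one W hW
  have hfin : ∀ y, (support fun x => g x y).Finite := fun y => h3.point_finite y
  let q : X → ℝ := fun y => ∑ᶠ x, g x y * g x y
  have hq3 : LocallyFinite fun x => support fun y => g x y * g x y :=
    h3.subset fun x y hy hy' => hy (by simp [hy'])
  have hq : ContMDiff I 𝓘(ℝ, ℝ) ∞ q := contMDiff_finsum (fun x => (h1 x).mul (h1 x)) hq3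
  have hex : ∀ y, ∃ x, 0 < g x y := fun y => by
    by_contra! hcon
    have : ∀ x, g x y = 0 := fun x => le_antisymm (hcon x) (h2 x y)
    have h6 := h5 y
    simp [this] at h6
  have hqpos : ∀ y, 0 < q y := fun y =>
    finsum_pos_of_exists (hq3.point_finite y) (fun x => mul_self_nonneg _)
      ((hex y).imp fun x hx => mul_pos hx hx)
  have hmax : ∀ y, ∃ x, q y ≤ g x y := fun y => by
    obtain ⟨x, hx, hmax⟩ := (hfin y).exists_maximalFor (fun x => g x y) _
      ((hex y).imp fun x hx => hx.ne')
    have hle : ∀ x', g x' y ≤ g x y := fun x' => by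
      by_cases h' : x' ∈ support fun x => g x y
      · by_contra! hlt
        exact absurd (hmax h' hlt.le) (not_le.2 hlt)
      · rw [notMem_support.1 h']
        exact h2 x y
    refine ⟨x, ?_⟩
    calc q y ≤ ∑ᶠ x', g x' y * g x y := by
          refine finsum_le_finsum' (hq3.point_finite y)
            ((hfin y).subset fun x' hx' hx'' => hx' (by simp [hx'']))
            (fun x' => mul_le_mul_of_nonneg_left (hle x') (h2 x' y))
      _ = g x y := by rw [← finsum_mul, h5 y, one_mul]
  -- The affine function `3t - 1` is negative at `t = 0` and exceeds `1` strictly for `t ≥ 1`;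
  -- strictness gives the value `1` in a whole neighbourhood.
  have hsm : ∀ x, ContMDiff I 𝓘(ℝ, ℝ) ∞ fun y => 3 * (g x y / q y) - 1 := fun x =>
    (contMDiff_const.mul ((h1 x).div₀ hq fun y => (hqpos y).ne')).sub contMDiff_const
  have hsup : ∀ x, support (fun y => Real.smoothTransition (3 * (g x y / q y) - 1)) ⊆
      support (g x) := fun x y hy hy' => by
    apply hy
    apply Real.smoothTransition.zero_of_nonpos
    simp [hy']
  refine ⟨fun x y => Real.smoothTransition (3 * (g x y / q y) - 1), fun x => ?_, fun x y => ?_,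
    ?_, fun x => ?_, fun y => ?_⟩
  · exact Real.smoothTransition.contDiff.contMDiff.comp (hsm x)
  · exact ⟨Real.smoothTransition.nonneg _, Real.smoothTransition.le_one _⟩
  · exact (h3.subset hsup).closure
  · exact (closure_mono (hsup x)).trans (h4 x)
  · obtain ⟨x, hx⟩ := hmax y
    refine ⟨x, ?_⟩
    have h6 : 1 < 3 * (g x y / q y) - 1 := by
      have : 1 ≤ g x y / q y := (one_le_div (hqpos y)).2 hx
      linarith
    filter_upwards [(hsm x).continuous.continuousAt.eventually_const_lt h6] with z hz
    exact Real.smoothTransition.one_of_one_le hz.le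

/-- For each `x`, compactness of `K` selects finitely many bumps `θ x t` that have no common zero.
Multiplying them by a bump near `x`, subordinate to the finite intersection of the corresponding
neighbourhoods, keeps the family locally finite; unselected indices get the function `0`. -/
theorem HasBumps.prod_compact {E' H' K : Type*} [NormedAddCommGroup E'] [NormedSpace ℝ E']
    [FiniteDimensional ℝ E'] [TopologicalSpace H'] {J : ModelWithCorners ℝ E' H'}
    [TopologicalSpace K] [ChartedSpace H' K] [IsManifold J ∞ K] [T2Space K] [CompactSpace K]
    (h : HasBumps I X) : HasBumps (I.prod J) (X × K) := by
  classical
  intro W hW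
  have h1 : ∀ (x : X) (t : K), ∃ A ∈ 𝓝 x, ∃ θ : K → ℝ, ContMDiff J 𝓘(ℝ, ℝ) ∞ θ ∧ (∀ s, 0 ≤ θ s) ∧
      0 < θ t ∧ A ×ˢ tsupport θ ⊆ W (x, t) := by
    intro x t
    obtain ⟨A, hA, T, hT, hAT⟩ := mem_nhds_prod_iff.1 (hW (x, t))
    obtain ⟨θ, -, hθ⟩ := (SmoothBumpFunction.nhds_basis_tsupport (I := J) t).mem_iff.1 hT
    exact ⟨A, hA, θ, θ.contMDiff, fun s => θ.nonneg, by rw [θ.eq_one]; exact one_pos,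
      (prod_mono subset_rfl hθ).trans hAT⟩
  choose A hA θ hθ hθ0 hθpos hAθ using h1
  have h2 : ∀ x, ∃ T : Finset K, ∀ s, ∃ t ∈ T, 0 < θ x t s := by
    intro x
    obtain ⟨T, hT⟩ := isCompact_univ.elim_finite_subcover (fun t => {s | 0 < θ x t s})
      (fun t => isOpen_lt continuous_const (hθ x t).continuous)
      (fun s _ => mem_iUnion.2 ⟨s, hθpos x s⟩)
    exact ⟨T, fun s => by simpa using hT (mem_univ s)⟩
  choose T hT using h2
  obtain ⟨ρ, r1, r2, r3, r4, r5⟩ := h (fun x => ⋂ t ∈ T x, A x t)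
    fun x => (biInter_finset_mem (T x)).2 fun t _ => hA x t
  have hsub : ∀ (x : X) (t : K), support (fun z : X × K => ρ x z.1 * θ x t z.2) ⊆
      support (ρ x) ×ˢ support (θ x t) := fun x t z hz =>
    ⟨left_ne_zero_of_mul hz, right_ne_zero_of_mul hz⟩
  refine ⟨fun p z => if p.2 ∈ T p.1 then ρ p.1 z.1 * θ p.1 p.2 z.2 else 0, ?_, ?_, ?_, ?_, ?_⟩
  · rintro ⟨x, t⟩
    by_cases ht : t ∈ T x
    · simp only [ht, if_true]
      exact ((r1 x).comp contMDiff_fst).mul ((hθ x t).comp contMDiff_snd)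
    · simp only [ht, if_false]
      exact contMDiff_const
  · rintro ⟨x, t⟩ z
    dsimp only
    split_ifs
    · exact mul_nonneg (r2 _ _) (hθ0 _ _ _)
    · exact le_rfl
  · rintro ⟨y, s⟩
    obtain ⟨N, hN, hNf⟩ := r3 y
    refine ⟨N ×ˢ univ, prod_mem_nhds hN univ_mem, ?_⟩
    refine (hNf.biUnion fun x _ => ((T x).finite_toSet.image fun t => (x, t))).subset ?_
    rintro ⟨x, t⟩ ⟨⟨y', s'⟩, h3, h4⟩
    by_cases ht : t ∈ T x
    · simp only [mem_support, ht, if_true] at h3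
      refine mem_biUnion (x := x) ?_ ⟨t, ht, rfl⟩
      exact ⟨y', left_ne_zero_of_mul h3, h4.1⟩
    · simp [ht] at h3
  · rintro ⟨x, t⟩
    by_cases ht : t ∈ T x
    · simp only [ht, if_true]
      refine (closure_mono (hsub x t)).trans ?_
      rw [closure_prod_eq]
      refine Subset.trans (prod_mono ?_ subset_rfl) (hAθ x t)
      exact (r4 x).trans (biInter_subset_of_mem ht)
    · simp only [ht, if_false]
      simp [tsupport]
  · rintro ⟨y, s⟩
    obtain ⟨x, hx⟩ := r5 y
    obtain ⟨t, ht, hts⟩ := hT x s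
    exact ⟨(x, t), by simpa [ht] using mul_pos hx hts⟩

end Bumps

end FibredDeRham
end

noncomputable section

open Set Function Filter

namespace FibredDeRham

/-! ### Bump functions on open subsets -/

section OpenSubset

variable {E B : Type*} [NormedAddCommGroup E] [NormedSpace ℝ E]
  [TopologicalSpace B] [ChartedSpace E B]

/-- A continuous function which is positive exactly on a given open set. -/
theorem HasBumps.exists_continuous_pos_iff (h : HasBumps 𝓘(ℝ, E) B) (U : Opens B) :
    ∃ d : B → ℝ, Continuous d ∧ (∀ y, d y ≤ 1) ∧ ∀ y, 0 < d y ↔ y ∈ U := by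
  obtain ⟨g, h1, h2, h3, h4, h5⟩ := h.exists_sum_eq_one (fun x => (chartAt E x).source)
    fun x => (chartAt E x).open_source.mem_nhds (mem_chart_source E x)
  let S : B → Set E := fun x => (chartAt E x).target ∩ (chartAt E x).symm ⁻¹' U
  have hS : ∀ x, IsOpen (S x) := fun x => (chartAt E x).isOpen_inter_preimage_symm U.isOpen
  -- The distance to the complement, measured in the chart. It is infinite when the complement is
  -- empty, hence the truncation at `1`.
  let m : B → E → ℝ := fun x e => (min 1 (Metric.infEDist e (S x)ᶜ)).toReal
  have hm : ∀ x, Continuous (m x) := fun x => by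
    refine continuous_iff_continuousAt.2 fun e => ?_
    refine (ENNReal.tendsto_toReal (ne_top_of_le_ne_top ENNReal.one_ne_top (min_le_left _ _))).comp ?_
    exact (continuous_const.min Metric.continuous_infEDist).continuousAt
  have hm0 : ∀ x e, 0 ≤ m x e := fun x e => ENNReal.toReal_nonneg
  have hm1 : ∀ x e, m x e ≤ 1 := fun x e =>
    ENNReal.toReal_mono ENNReal.one_ne_top (min_le_left _ _)
  have hmS : ∀ x e, 0 < m x e ↔ e ∈ S x := fun x e => by
    rw [ENNReal.toReal_pos_iff]
    constructor
    · rintro ⟨h, -⟩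
      by_contra he
      have : Metric.infEDist e (S x)ᶜ = 0 := Metric.infEDist_zero_of_mem he
      simp [this] at h
    · intro he
      refine ⟨lt_min one_pos ?_, (min_le_left _ _).trans_lt ENNReal.one_lt_top⟩
      rw [pos_iff_ne_zero]
      intro h0
      have := Metric.mem_closure_iff_infEDist_zero.2 h0
      rw [(hS x).isClosed_compl.closure_eq] at this
      exact this he
  have hsup : ∀ x, support (fun y => g x y * m x (chartAt E x y)) ⊆ support (g x) :=
    fun x y hy => left_ne_zero_of_mul hy
  have hfin : ∀ y, (support fun x => g x y).Finite := fun y => h3.point_finite y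
  have hfin' : ∀ y, (support fun x => g x y * m x (chartAt E x y)).Finite := fun y =>
    (hfin y).subset fun x hx => left_ne_zero_of_mul hx
  refine ⟨fun y => ∑ᶠ x, g x y * m x (chartAt E x y), ?_, fun y => ?_, fun y => ?_⟩
  · refine continuous_finsum (fun x => ?_) (h3.subset hsup)
    refine continuous_iff_continuousAt.2 fun y => ?_
    by_cases hy : y ∈ tsupport (g x)
    · exact (h1 x).continuous.continuousAt.mul ((hm x).continuousAt.comp
        ((chartAt E x).continuousAt (h4 x hy)))
    · have : (fun y => g x y * m x (chartAt E x y)) =ᶠ[𝓝 y] fun _ => 0 := by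
        filter_upwards [(isClosed_tsupport (g x)).isOpen_compl.mem_nhds hy] with z hz
        rw [image_eq_zero_of_notMem_tsupport hz, zero_mul]
      exact continuousAt_const.congr this.symm
  · rw [← h5 y]
    exact finsum_le_finsum' (hfin' y) (hfin y)
      fun x => mul_le_of_le_one_right (h2 x y) (hm1 _ _)
  · constructor
    · intro hpos
      by_contra hy
      refine hpos.ne' ?_
      rw [← finsum_zero (α := B)]
      refine finsum_congr fun x => ?_
      by_cases hxy : g x y = 0
      · rw [hxy, zero_mul]
      have hys : y ∈ (chartAt E x).source := h4 x (subset_tsupport _ hxy)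
      have : ¬ 0 < m x (chartAt E x y) := by
        rw [hmS]
        rintro ⟨-, h⟩
        rw [mem_preimage, (chartAt E x).left_inv hys] at h
        exact hy h
      rw [le_antisymm (not_lt.1 this) (hm0 _ _), mul_zero]
    · intro hy
      refine finsum_pos_of_exists (hfin' y) (fun x => mul_nonneg (h2 _ _) (hm0 _ _)) ?_
      obtain ⟨x, hx⟩ : ∃ x, g x y ≠ 0 := by
        by_contra! hcon
        have h6 := h5 y
        simp [hcon] at h6
      refine ⟨x, mul_pos (lt_of_le_of_ne (h2 _ _) hx.symm) ?_⟩
      have hys : y ∈ (chartAt E x).source := h4 x (subset_tsupport _ hx)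
      rw [hmS]
      refine ⟨(chartAt E x).map_source hys, ?_⟩
      rw [mem_preimage, (chartAt E x).left_inv hys]
      exact hy

/-- Neighbourhoods given on `U` have no useful continuation to the boundary of `U`. Therefore `U` is
exhausted by shells closed in `B`, the property of `B` is applied to each shell, and the resulting
functions are summed over the shells. -/
theorem HasBumps.opens (h : HasBumps 𝓘(ℝ, E) B) (U : Opens B) : HasBumps 𝓘(ℝ, E) U := by
  classical
  intro W hW
  obtain ⟨d, hd, hd1, hdU⟩ := h.exists_continuous_pos_iff U
  -- `L n` is the closed shell `1/(n+2) ≤ d ≤ 1/(n+1)`, and `T n` is the open shell `1/(n+3) < d <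
  -- 1/n` around it. Written without division, `T 0` has no upper bound; the shells `L n` fill `U`
  -- because `d ≤ 1`.
  let T : ℕ → Set B := fun n => {y | 1 < d y * (n + 3) ∧ d y * n < 1}
  let L : ℕ → Set B := fun n => {y | 1 ≤ d y * (n + 2) ∧ d y * (n + 1) ≤ 1}
  have hT : ∀ n, IsOpen (T n) := fun n =>
    (isOpen_lt continuous_const (hd.mul continuous_const)).inter
      (isOpen_lt (hd.mul continuous_const) continuous_const)
  have hL : ∀ n, IsClosed (L n) := fun n =>
    (isClosed_le continuous_const (hd.mul continuous_const)).inter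
      (isClosed_le (hd.mul continuous_const) continuous_const)
  have hpos : ∀ {a b : ℝ}, 0 ≤ b → 0 < a * b → 0 < a := fun hb hab =>
    by
    by_contra! ha
    exact absurd hab (not_lt.2 (mul_nonpos_of_nonpos_of_nonneg ha hb))
  have hTU : ∀ n y, y ∈ T n → y ∈ U := fun n y hy =>
    (hdU y).1 (hpos (b := (n : ℝ) + 3) (by positivity) (one_pos.trans hy.1))
  have hLT : ∀ n, L n ⊆ T n := fun n y hy => by
    have h0 : 0 < d y := hpos (b := (n : ℝ) + 2) (by positivity) (one_pos.trans_le hy.1)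
    have h1 := hy.1
    have h2 := hy.2
    exact ⟨by linarith, by linarith⟩
  have hLU : ∀ y ∈ U, ∃ n, y ∈ L n := fun y hy => by
    have h0 := (hdU y).2 hy
    have h1 : 1 ≤ ⌊(d y)⁻¹⌋₊ := Nat.le_floor (by simpa using (one_le_inv₀ h0).2 (hd1 y))
    obtain ⟨n, hn⟩ := Nat.exists_eq_add_of_le h1
    have h2 : ((1 + n : ℕ) : ℝ) ≤ (d y)⁻¹ := hn ▸ Nat.floor_le (inv_nonneg.2 h0.le)
    have h3 : (d y)⁻¹ < ((1 + n : ℕ) : ℝ) + 1 := hn ▸ Nat.lt_floor_add_one _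
    push_cast at h2 h3
    have h4 : d y * (d y)⁻¹ = 1 := mul_inv_cancel₀ h0.ne'
    refine ⟨n, ?_, ?_⟩
    · nlinarith
    · nlinarith
  -- Functions with index outside `T n` have support off `L n`, so they can be dropped and the
  -- remaining ones still have no common zero on `L n`.
  let W' : ℕ → B → Set B := fun n x =>
    if hx : x ∈ T n then Subtype.val '' (W ⟨x, hTU n x hx⟩) ∩ T n else (L n)ᶜ
  have hW' : ∀ n x, W' n x ∈ 𝓝 x := fun n x => by
    by_cases hx : x ∈ T n
    · simp only [W', hx, dif_pos]
      exact inter_mem (U.isOpen.isOpenEmbedding_subtypeVal.image_mem_nhds.2 (hW ⟨x, hTU n x hx⟩))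
        ((hT n).mem_nhds hx)
    · simp only [W', hx, dif_neg, not_false_eq_true]
      exact (hL n).isOpen_compl.mem_nhds fun h => hx (hLT n h)
  choose g h1 h2 h3 h4 h5 using fun n => h (W' n) (hW' n)
  let k : ℕ → U → U → ℝ := fun n x y => if x.1 ∈ T n then g n x.1 y.1 else 0
  have hk1 : ∀ n x, ContMDiff 𝓘(ℝ, E) 𝓘(ℝ, ℝ) ∞ (k n x) := fun n x => by
    by_cases hx : x.1 ∈ T n
    · simp only [k, hx, if_true]
      exact (h1 n x.1).comp contMDiff_subtype_val
    · simp only [k, hx, if_false]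
      exact contMDiff_const
  have hk2 : ∀ n x y, 0 ≤ k n x y := fun n x y => by
    dsimp only [k]
    split_ifs
    exacts [h2 _ _ _, le_rfl]
  have hksub : ∀ n x, support (k n x) ⊆ Subtype.val ⁻¹' support (g n x.1) := fun n x y hy => by
    by_cases hx : x.1 ∈ T n
    · simpa [k, hx] using hy
    · simp [k, hx] at hy
  have hktW : ∀ n x, tsupport (k n x) ⊆ W x ∩ Subtype.val ⁻¹' T n := fun n x => by
    by_cases hx : x.1 ∈ T n
    · intro y hy
      have h6 : y.1 ∈ tsupport (g n x.1) := by
        have := closure_mono (hksub n x) hy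
        exact continuous_subtype_val.closure_preimage_subset _ this
      have h7 := h4 n x.1 h6
      simp only [W', hx, dif_pos] at h7
      obtain ⟨⟨z, hz, hzy⟩, h8⟩ := h7
      rw [Subtype.ext hzy] at hz
      exact ⟨hz, h8⟩
    · have : k n x = 0 := by
        funext y
        simp [k, hx]
      simp [this, tsupport]
  -- Where `d > d y / 2`, only shells with `n < 2 / d y` are met, since `d * n < 1` on `T n`; so
  -- finitely many locally finite families remain.
  have hk3 : LocallyFinite fun p : ℕ × U => support (k p.1 p.2) := by
    intro y
    have hy := (hdU y.1).2 y.2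
    obtain ⟨N, hN⟩ := exists_nat_gt (2 / d y.1)
    have hO : {z : U | d y.1 / 2 < d z.1} ∈ 𝓝 y :=
      (isOpen_lt continuous_const (hd.comp continuous_subtype_val)).mem_nhds
        (show d y.1 / 2 < d y.1 by linarith)
    have h6 : ∀ n, ∃ A ∈ 𝓝 y, {x : U | (support (k n x) ∩ A).Nonempty}.Finite := fun n => by
      obtain ⟨A, hA, hAf⟩ := h3 n y.1
      refine ⟨Subtype.val ⁻¹' A, continuous_subtype_val.continuousAt.preimage_mem_nhds hA, ?_⟩
      refine (hAf.preimage Subtype.val_injective.injOn).subset ?_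
      rintro x ⟨z, hz, hzA⟩
      exact ⟨z.1, hksub n x hz, hzA⟩
    choose A hA hAf using h6
    refine ⟨{z : U | d y.1 / 2 < d z.1} ∩ ⋂ n ∈ Finset.range N, A n,
      inter_mem hO ((biInter_finset_mem _).2 fun n _ => hA n), ?_⟩
    refine ((Finset.range N).finite_toSet.biUnion
      fun n _ => (hAf n).image fun x => (n, x)).subset ?_
    rintro ⟨n, x⟩ ⟨z, hz, hzd, hzA⟩
    have hzT : z.1 ∈ T n := (hktW n x (subset_tsupport _ hz)).2
    have hn : n ∈ Finset.range N := by
      rw [Finset.mem_range]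
      by_contra! hle
      have h7 : (N : ℝ) ≤ n := by exact_mod_cast hle
      have h8 := hzT.2
      have h9 : d y.1 / 2 < d z.1 := hzd
      rw [div_lt_iff₀ hy] at hN
      have h10 : 0 < (N : ℝ) := by
        by_contra! h0
        nlinarith
      nlinarith
    exact mem_biUnion (Finset.mem_coe.2 hn) ⟨x, ⟨z, hz, mem_iInter₂.1 hzA n hn⟩, rfl⟩
  have hk3' : ∀ x, LocallyFinite fun n => support (k n x) := fun x =>
    hk3.comp_injective (g := fun n => (n, x)) fun a b hab => (Prod.ext_iff.1 hab).1
  have hsub : ∀ x, support (fun y => ∑ᶠ n, k n x y) ⊆ ⋃ n, support (k n x) := fun x y hy => by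
    by_contra hcon
    apply hy
    have : ∀ n, k n x y = 0 := fun n => by
      by_contra h0
      exact hcon (mem_iUnion.2 ⟨n, h0⟩)
    simp [this]
  refine ⟨fun x y => ∑ᶠ n, k n x y, fun x => contMDiff_finsum (fun n => hk1 n x) (hk3' x),
    fun x y => finsum_nonneg fun n => hk2 n x y, fun y => ?_, fun x => ?_, fun y => ?_⟩
  · obtain ⟨A, hA, hAf⟩ := hk3 y
    refine ⟨A, hA, (hAf.image Prod.snd).subset ?_⟩
    rintro x ⟨z, hz, hzA⟩
    obtain ⟨n, hn⟩ := mem_iUnion.1 (hsub x hz)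
    exact ⟨(n, x), ⟨z, hn, hzA⟩, rfl⟩
  · refine (closure_mono (hsub x)).trans ?_
    rw [(hk3' x).closure_iUnion]
    exact iUnion_subset fun n => (hktW n x).trans inter_subset_left
  · obtain ⟨n, hn⟩ := hLU y.1 y.2
    obtain ⟨x, hx⟩ := h5 n y.1
    have hxT : x ∈ T n := by
      by_contra hxT
      have h6 := h4 n x (subset_tsupport _ hx.ne')
      simp only [W', hxT, dif_neg, not_false_eq_true] at h6
      exact h6 hn
    refine ⟨⟨x, hTU n x hxT⟩, finsum_pos_of_exists ((hk3' _).point_finite y)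
      (fun n => hk2 _ _ _) ⟨n, ?_⟩⟩
    simpa [k, hxT] using hx

end OpenSubset

end FibredDeRham
end

noncomputable section

open Set Function Filter

namespace FibredDeRham

/-! ### Whitney approximation -/

section Approximation

variable {E₀ H X : Type*} [NormedAddCommGroup E₀] [NormedSpace ℝ E₀] [TopologicalSpace H]
  [TopologicalSpace X] [ChartedSpace H X] {I : ModelWithCorners ℝ E₀ H}
  {E Y : Type*} [NormedAddCommGroup E] [NormedSpace ℝ E] [TopologicalSpace Y] [ChartedSpace E Y]
  [IsManifold 𝓘(ℝ, E) ∞ Y]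

/-- Smoothing of a continuous map in the region `χ = 1`, by a modification in a chart on the support
of `χ`, such that the values stay in prescribed neighbourhoods. -/
theorem HasBumps.exists_smoothing_in_chart (h : HasBumps I X) {f : X → Y} (hf : Continuous f)
    {N : X → Set Y} (hN : ∀ z, IsOpen (N z)) (hfN : ∀ z, f z ∈ N z)
    (hNloc : ∀ z, ∀ᶠ w in 𝓝 z, N z ⊆ N w) {χ : X → ℝ} (hχ : ContMDiff I 𝓘(ℝ, ℝ) ∞ χ)
    (hχ1 : ∀ z, χ z ∈ Icc (0 : ℝ) 1) (y₀ : Y)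
    (hNχ : ∀ z ∈ tsupport χ, N z ⊆ (chartAt E y₀).source) :
    ∃ f' : X → Y, Continuous f' ∧ (∀ z, f' z ∈ N z) ∧ (∀ z, z ∉ tsupport χ → f' z = f z) ∧
      (∀ z, ContMDiffAt I 𝓘(ℝ, E) ∞ f z → ContMDiffAt I 𝓘(ℝ, E) ∞ f' z) ∧
      ∀ z, χ =ᶠ[𝓝 z] 1 → ContMDiffAt I 𝓘(ℝ, E) ∞ f' z := by
  classical
  set φ := chartAt E y₀ with hφ
  set Q := tsupport χ
  have hQ : IsClosed Q := isClosed_tsupport χ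
  let W : X → Set E := fun z => φ.target ∩ φ.symm ⁻¹' N z
  have hW : ∀ z, IsOpen (W z) := fun z => φ.isOpen_inter_preimage_symm (hN z)
  let D : Set X := f ⁻¹' φ.source
  have hD : IsOpen D := φ.open_source.preimage hf
  have hQD : Q ⊆ D := fun z hz => hNχ z hz (hfN z)
  have hfW : ∀ z ∈ Q, φ (f z) ∈ W z := fun z hz => by
    refine ⟨φ.map_source (hQD hz), ?_⟩
    rw [mem_preimage, φ.left_inv (hQD hz)]
    exact hfN z
  have hcont : ContinuousOn (fun z => φ (f z)) D :=
    φ.continuousOn.comp hf.continuousOn fun z hz => hz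
  -- Balls with the same centre are nested, so `t z` is convex although `W z` need not be. The ball
  -- contains the whole segment from `φ (f z)` to `e`, so blending with `χ` stays in `W z`. Outside
  -- `Q` there is no condition.
  let t : X → Set E := fun z =>
    {e | z ∈ Q → ∃ R, dist e (φ (f z)) < R ∧ Metric.ball (φ (f z)) R ⊆ W z}
  have ht : ∀ z, Convex ℝ (t z) := by
    intro z e₁ h₁ e₂ h₂ a b ha hb hab hz
    obtain ⟨R₁, hR₁, hW₁⟩ := h₁ hz
    obtain ⟨R₂, hR₂, hW₂⟩ := h₂ hz
    rcases le_total R₁ R₂ with hle | hle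
    · exact ⟨R₂, convex_ball _ _ (hR₁.trans_le hle) hR₂ ha hb hab, hW₂⟩
    · exact ⟨R₁, convex_ball _ _ hR₁ (hR₂.trans_le hle) ha hb hab, hW₁⟩
  have htloc : ∀ z, ∃ c, ∀ᶠ w in 𝓝 z, c ∈ t w := by
    intro z
    by_cases hz : z ∈ Q
    · obtain ⟨R, hR, hRW⟩ := Metric.isOpen_iff.1 (hW z) _ (hfW z hz)
      -- For `w` near `z` the ball of radius `R / 2` around `φ (f w)` contains `φ (f z)` and lies in
      -- the ball of radius `R` around it, hence in `W z`; `hNloc` then moves it into `W w`.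
      refine ⟨φ (f z), ?_⟩
      have h1 := (hcont.continuousAt (hD.mem_nhds (hQD hz))).eventually
        (Metric.ball_mem_nhds (φ (f z)) (half_pos hR))
      filter_upwards [h1, hNloc z] with w hw hNw _
      have hw' : dist (φ (f w)) (φ (f z)) < R / 2 := hw
      refine ⟨R / 2, by rwa [dist_comm], fun e he => ?_⟩
      have h2 : e ∈ W z := hRW (by
        have he' : dist e (φ (f w)) < R / 2 := he
        have := dist_triangle e (φ (f w)) (φ (f z))
        rw [Metric.mem_ball]
        linarith)
      exact ⟨h2.1, hNw h2.2⟩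
    · exact ⟨0, by
        filter_upwards [hQ.isOpen_compl.mem_nhds hz] with w hw hw' using absurd hw' hw⟩
  obtain ⟨g, hg, hgt⟩ := h.exists_contMDiff_mem_convex t ht htloc
  let u : X → E := fun z => (1 - χ z) • φ (f z) + χ z • g z
  have hu : ∀ z ∈ Q, u z ∈ W z := fun z hz => by
    obtain ⟨R, hR, hRW⟩ := hgt z hz
    refine hRW (convex_ball _ _ (Metric.mem_ball_self (dist_nonneg.trans_lt hR)) hR
      (by linarith [(hχ1 z).2]) (hχ1 z).1 (by ring))
  have hu0 : ∀ z, z ∉ Q → u z = φ (f z) := fun z hz => by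
    have : χ z = 0 := image_eq_zero_of_notMem_tsupport hz
    simp [u, this]
  have huT : ∀ z ∈ D, u z ∈ φ.target := fun z hz => by
    by_cases hzQ : z ∈ Q
    · exact (hu z hzQ).1
    · rw [hu0 z hzQ]
      exact φ.map_source hz
  let f' : X → Y := fun z => if z ∈ D then φ.symm (u z) else f z
  have hf'Q : ∀ z, z ∉ Q → f' z = f z := fun z hz => by
    by_cases hzD : z ∈ D
    · simp only [f', hzD, if_true]
      rw [hu0 z hz]
      exact φ.left_inv hzD
    · simp only [f', hzD, if_false]
  have hf'D : ∀ z ∈ D, f' =ᶠ[𝓝 z] fun w => φ.symm (u w) := fun z hz => by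
    filter_upwards [hD.mem_nhds hz] with w hw
    simp only [f', hw, if_true]
  have hf'off : ∀ z, z ∉ Q → f' =ᶠ[𝓝 z] f := fun z hz => by
    filter_upwards [hQ.isOpen_compl.mem_nhds hz] with w hw using hf'Q w hw
  have hsm : ∀ z ∈ D, ContMDiffAt I 𝓘(ℝ, E) ∞ u z → ContMDiffAt I 𝓘(ℝ, E) ∞ f' z :=
    fun z hz hz' => ((contMDiffAt_chart_symm y₀ (huT z hz)).comp z hz').congr_of_eventuallyEq
      (hf'D z hz)
  refine ⟨f', ?_, fun z => ?_, hf'Q, fun z hz => ?_, fun z hz => ?_⟩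
  · refine continuous_iff_continuousAt.2 fun z => ?_
    by_cases hz : z ∈ Q
    · refine ContinuousAt.congr ?_ (hf'D z (hQD hz)).symm
      refine ContinuousAt.comp (f := u) (φ.continuousAt_symm (huT z (hQD hz))) ?_
      have h1 := hcont.continuousAt (hD.mem_nhds (hQD hz))
      have h2 := hχ.continuous.continuousAt (x := z)
      exact ((continuousAt_const.sub h2).smul h1).add (h2.smul hg.continuous.continuousAt)
    · exact hf.continuousAt.congr (hf'off z hz).symm
  · by_cases hz : z ∈ Q
    · rw [(hf'D z (hQD hz)).eq_of_nhds]
      exact (hu z hz).2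
    · rw [hf'Q z hz]
      exact hfN z
  · by_cases hzQ : z ∈ Q
    · refine hsm z (hQD hzQ) ?_
      have h1 : ContMDiffAt I 𝓘(ℝ, E) ∞ (fun z => φ (f z)) z :=
        (contMDiffAt_chart y₀ (hQD hzQ)).comp z hz
      exact (((contMDiffAt_const (c := (1 : ℝ))).sub hχ.contMDiffAt).smul h1).add
        (hχ.contMDiffAt.smul hg.contMDiffAt)
    · exact hz.congr_of_eventuallyEq (hf'off z hzQ)
  · have hzQ : z ∈ Q := subset_tsupport _ (by
      rw [mem_support, hz.eq_of_nhds]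
      exact one_ne_zero)
    refine hsm z (hQD hzQ) (hg.contMDiffAt.congr_of_eventuallyEq ?_)
    filter_upwards [hz] with w hw
    simp [u, hw]

/-- Whitney approximation: a continuous map which is smooth in a neighbourhood `O` of the closed
set `A` can be replaced by a smooth map with the same values on `A`. -/
theorem HasBumps.exists_contMDiff_eqOn (h : HasBumps I X) {f₀ : X → Y} (hf₀ : Continuous f₀)
    {A O : Set X} (hA : IsClosed A) (hO : IsOpen O) (hAO : A ⊆ O)
    (hsm : ∀ z ∈ O, ContMDiffAt I 𝓘(ℝ, E) ∞ f₀ z) :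
    ∃ f : X → Y, ContMDiff I 𝓘(ℝ, E) ∞ f ∧ EqOn f f₀ A := by
  classical
  -- Plateaus with index in `A` cover only points where `f₀` is already smooth. Modifications are
  -- made only for indices outside `A`, whose supports avoid `A`.
  let W : X → Set X := fun x => if x ∈ A then O else Aᶜ ∩ f₀ ⁻¹' (chartAt E (f₀ x)).source
  have hW : ∀ x, W x ∈ 𝓝 x := fun x => by
    by_cases hx : x ∈ A
    · simp only [W, hx, if_true]
      exact hO.mem_nhds (hAO hx)
    · simp only [W, hx, if_false]
      exact inter_mem (hA.isOpen_compl.mem_nhds hx)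
        (hf₀.continuousAt.preimage_mem_nhds ((chartAt E (f₀ x)).open_source.mem_nhds
          (mem_chart_source E _)))
  obtain ⟨χ, c1, c2, c3, c4, c5⟩ := h.exists_plateaus W hW
  let Q : (Aᶜ : Set X) → Set X := fun i => tsupport (χ i)
  have hQ : LocallyFinite Q := c3.comp_injective Subtype.val_injective
  have hQW : ∀ i, Q i ⊆ Aᶜ ∩ f₀ ⁻¹' (chartAt E (f₀ i)).source := fun i => by
    have h1 := c4 i
    simp only [W, show i.1 ∉ A from i.2, if_false] at h1
    exact h1
  let C : (Aᶜ : Set X) → Set Y := fun i => (chartAt E (f₀ i)).source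
  -- The middle condition keeps the values over `Q i` in the domain of the chart assigned to `i`, so
  -- that the modification along `Q i` remains possible after any earlier ones.
  let R₀ : (X → Y) → X → Prop := fun f z => ContinuousAt f z ∧ (∀ i, z ∈ Q i → f z ∈ C i) ∧
    (ContMDiffAt I 𝓘(ℝ, E) ∞ f₀ z → ContMDiffAt I 𝓘(ℝ, E) ∞ f z)
  let R : (Aᶜ : Set X) → (X → Y) → X → Prop := fun i f z =>
    χ i =ᶠ[𝓝 z] 1 → ContMDiffAt I 𝓘(ℝ, E) ∞ f z
  suffices key : ∃ f, (∀ z, R₀ f z) ∧ (∀ i z, R i f z) ∧ ∀ z, (∀ i, z ∉ Q i) → f z = f₀ z by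
    obtain ⟨f, hf1, hf2, hf3⟩ := key
    refine ⟨f, fun z => ?_, fun z hz => hf3 z fun i hi => (hQW i hi).1 hz⟩
    obtain ⟨x, hx⟩ := c5 z
    by_cases hxA : x ∈ A
    · refine (hf1 z).2.2 (hsm z ?_)
      have h1 : z ∈ W x := c4 x (subset_tsupport _ (by
        rw [mem_support, hx.eq_of_nhds]
        exact one_ne_zero))
      simpa only [W, hxA, if_true] using h1
    · exact hf2 ⟨x, hxA⟩ z hx
  refine exists_forall_of_locallyFinite_modification hQ R₀ R ?_ ?_ ?_ f₀ ?_
  · rintro f g z hfg ⟨h1, h2, h3⟩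
    refine ⟨h1.congr hfg, fun i hi => ?_, fun hz => (h3 hz).congr_of_eventuallyEq hfg.symm⟩
    rw [← hfg.eq_of_nhds]
    exact h2 i hi
  · exact fun i f g z hfg h1 hz => (h1 hz).congr_of_eventuallyEq hfg.symm
  · intro i f hf
    have hfin : ∀ z, {j | z ∈ Q j}.Finite := fun z => hQ.point_finite z
    obtain ⟨f', g1, g2, g3, g4, g5⟩ := h.exists_smoothing_in_chart (f := f)
      (continuous_iff_continuousAt.2 fun z => (hf z).1)
      -- All chart constraints at `z` are imposed together. As the `Q j` are closed and locally
      -- finite, no new constraint appears near `z`, which yields `N z ⊆ N w`.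
      (N := fun z => ⋂ j ∈ {j | z ∈ Q j}, C j)
      (fun z => (hfin z).isOpen_biInter fun j _ => (chartAt E (f₀ j)).open_source)
      (fun z => mem_iInter₂.2 fun j hj => (hf z).2.1 j hj)
      (fun z => by
        have h1 : ∀ᶠ w in 𝓝 z, ∀ j, w ∈ Q j → z ∈ Q j := by
          have h2 := (hQ.iInter_compl_mem_nhds (fun j => isClosed_tsupport _) z)
          filter_upwards [h2] with w hw j hj
          by_contra hzj
          exact (mem_iInter₂.1 hw j hzj) hj
        filter_upwards [h1] with w hw
        exact biInter_subset_biInter_left fun j hj => hw j hj)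
      (c1 i) (c2 i) (f₀ i) (fun z hz => biInter_subset_of_mem (t := C) hz)
    refine ⟨f', fun z => ⟨g1.continuousAt, fun j hj => mem_iInter₂.1 (g2 z) j hj,
      fun hz => g4 z ((hf z).2.2 hz)⟩, g5, g3, fun j hj z hz => g4 z (hj z hz)⟩
  · exact fun z => ⟨hf₀.continuousAt, fun i hi => (hQW i hi).2, id⟩

end Approximation

/-! ### Smooth contractions -/

section Contraction

variable {E B : Type*} [NormedAddCommGroup E] [NormedSpace ℝ E]
  [TopologicalSpace B] [ChartedSpace E B] [IsManifold 𝓘(ℝ, E) ∞ B]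

/-- A contractible manifold with sufficiently many bump functions is smoothly contractible. -/
theorem HasBumps.exists_smooth_contraction (h : HasBumps 𝓘(ℝ, E) B) [ContractibleSpace B] :
    ∃ (b₀ : B) (G : B × ℝ → B), ContMDiff (𝓘(ℝ, E).prod 𝓘(ℝ, ℝ)) 𝓘(ℝ, E) ∞ G ∧
      (∀ b, G (b, 0) = b) ∧ ∀ b, G (b, 1) = b₀ := by
  obtain ⟨b₀, ⟨K⟩⟩ := (contractible_iff_id_nullhomotopic B).1 inferInstance
  have : Fact (Module.finrank ℝ ℂ = 1 + 1) := ⟨Complex.finrank_real_complex⟩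
  -- The time interval is replaced by a circle, which is compact without boundary; composing with `t
  -- ↦ exp(πit)` gives a contraction for all real times. `κ` is constant on the caps `re ≥ 1/2` and
  -- `re ≤ -1/2`, so `f₀` is smooth near the smaller caps `re ≥ 3/4` and `re ≤ -3/4`, where its
  -- values are kept.
  let re : Circle → ℝ := fun w => (w : ℂ).re
  have hre : Continuous re := Complex.continuous_re.comp continuous_subtype_val
  let κ : Circle → unitInterval := fun w => projIcc 0 1 zero_le_one (1 / 2 - re w)
  have hκ : Continuous κ := continuous_projIcc.comp (continuous_const.sub hre)
  let f₀ : B × Circle → B := fun z => K (κ z.2, z.1)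
  have hf₀ : Continuous f₀ := K.continuous.comp ((hκ.comp continuous_snd).prodMk continuous_fst)
  have hκ0 : ∀ w, 1 / 2 ≤ re w → κ w = 0 := fun w hw =>
    projIcc_of_le_left _ (by linarith)
  have hκ1 : ∀ w, re w ≤ -(1 / 2) → κ w = 1 := fun w hw =>
    projIcc_of_right_le _ (by linarith)
  have e0 : ∀ z : B × Circle, 1 / 2 ≤ re z.2 → f₀ z = z.1 := fun z hz => by
    simp only [f₀, hκ0 z.2 hz]
    exact K.apply_zero z.1
  have e1 : ∀ z : B × Circle, re z.2 ≤ -(1 / 2) → f₀ z = b₀ := fun z hz => by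
    simp only [f₀, hκ1 z.2 hz]
    exact K.apply_one z.1
  have hre2 : Continuous fun z : B × Circle => re z.2 := hre.comp continuous_snd
  obtain ⟨f, hf, hfe⟩ := (h.prod_compact (J := 𝓡 1) (K := Circle)).exists_contMDiff_eqOn hf₀
    (A := {z | 3 / 4 ≤ re z.2} ∪ {z | re z.2 ≤ -(3 / 4)})
    (O := {z | 1 / 2 < re z.2} ∪ {z | re z.2 < -(1 / 2)})
    ((isClosed_le continuous_const hre2).union (isClosed_le hre2 continuous_const))
    ((isOpen_lt continuous_const hre2).union (isOpen_lt hre2 continuous_const))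
    (by
      rintro z (hz | hz)
      · exact Or.inl (lt_of_lt_of_le (by norm_num : (1 / 2 : ℝ) < 3 / 4) hz)
      · exact Or.inr (lt_of_le_of_lt hz (by norm_num : -(3 / 4 : ℝ) < -(1 / 2))))
    (by
      rintro z (hz | hz)
      · refine contMDiffAt_fst.congr_of_eventuallyEq ?_
        filter_upwards [(isOpen_lt continuous_const hre2).mem_nhds hz] with w hw
        exact e0 w (le_of_lt hw)
      · refine (contMDiffAt_const (c := b₀)).congr_of_eventuallyEq ?_
        filter_upwards [(isOpen_lt hre2 continuous_const).mem_nhds hz] with w hw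
        exact e1 w (le_of_lt hw))
  have hexp : ContMDiff 𝓘(ℝ, ℝ) (𝓡 1) ∞ Circle.exp := contMDiff_circleExp.of_le le_top
  refine ⟨b₀, fun z => f (z.1, Circle.exp (Real.pi * z.2)), ?_, fun b => ?_, fun b => ?_⟩
  · refine hf.comp (contMDiff_fst.prodMk (hexp.comp ?_))
    exact contMDiff_const.mul contMDiff_snd
  · have hr : re (Circle.exp (Real.pi * 0)) = 1 := by simp [re]
    have := hfe (x := (b, Circle.exp (Real.pi * 0))) (Or.inl (by
      change 3 / 4 ≤ re _
      rw [hr]; norm_num))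
    refine this.trans ?_
    exact e0 _ (by rw [hr]; norm_num)
  · have hr : re (Circle.exp (Real.pi * 1)) = -1 := by simp [re, Circle.coe_exp]
    have := hfe (x := (b, Circle.exp (Real.pi * 1))) (Or.inr (by
      change re _ ≤ -(3 / 4)
      rw [hr]; norm_num))
    refine this.trans ?_
    exact e1 _ (by rw [hr]; norm_num)

end Contraction

end FibredDeRham
end

noncomputable section

open Set Function Filter

namespace FibredDeRham

/-! ### Smooth dependence of integrals on a parameter -/

section ParametricIntegral

universe u

variable {E G : Type u} [NormedAddCommGroup E] [NormedSpace ℝ E]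
  [NormedAddCommGroup G] [NormedSpace ℝ G]

/-- Dominated differentiation under the integral. `E` need not be locally compact, so the bound on
the derivative near `{y₀} × [0, 1]` comes from compactness of the interval through the tube lemma.
-/
theorem hasFDerivAt_integral_unitInterval {D : Set E} (hD : IsOpen D) {w : E × ℝ → G}
    (hw : ContDiffOn ℝ 1 w (D ×ˢ univ)) {y₀ : E} (hy₀ : y₀ ∈ D) :
    HasFDerivAt (fun y => ∫ s in (0 : ℝ)..1, w (y, s))
      (∫ s in (0 : ℝ)..1, (fderiv ℝ w (y₀, s)).comp (ContinuousLinearMap.inl ℝ E ℝ)) y₀ := by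
  have hO : IsOpen (D ×ˢ (univ : Set ℝ)) := hD.prod isOpen_univ
  let F' : E × ℝ → E →L[ℝ] G := fun z => (fderiv ℝ w z).comp (ContinuousLinearMap.inl ℝ E ℝ)
  have hF' : ContinuousOn F' (D ×ˢ univ) :=
    (hw.continuousOn_fderiv_of_isOpen hO le_rfl).clm_comp continuousOn_const
  have hcw : ∀ y ∈ D, Continuous fun s : ℝ => w (y, s) := fun y hy =>
    hw.continuousOn.comp_continuous (by fun_prop) fun s => ⟨hy, mem_univ _⟩
  have hcF : ∀ y ∈ D, Continuous fun s : ℝ => F' (y, s) := fun y hy =>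
    hF'.comp_continuous (by fun_prop) fun s => ⟨hy, mem_univ _⟩
  obtain ⟨C, hC⟩ := (isCompact_Icc (a := (0 : ℝ)) (b := 1)).exists_bound_of_continuousOn
    (hcF y₀ hy₀).continuousOn
  have hN : IsOpen ((D ×ˢ univ) ∩ (fun z => ‖F' z‖) ⁻¹' Iio (C + 1)) :=
    hF'.norm.isOpen_inter_preimage hO isOpen_Iio
  obtain ⟨u, v, hu, -, hyu, hv, huv⟩ := generalized_tube_lemma (s := {y₀}) isCompact_singleton
    (isCompact_Icc (a := (0 : ℝ)) (b := 1)) hN (by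
      rintro ⟨y, s⟩ ⟨hy, hs⟩
      obtain rfl : y = y₀ := hy
      exact ⟨⟨hy₀, mem_univ _⟩, lt_of_le_of_lt (hC s hs) (lt_add_one C)⟩)
  have hu' : u ∈ 𝓝 y₀ := hu.mem_nhds (hyu rfl)
  have hsub : ∀ s ∈ uIoc (0 : ℝ) 1, s ∈ v := fun s hs => by
    rw [uIoc_of_le zero_le_one] at hs
    exact hv ⟨hs.1.le, hs.2⟩
  refine intervalIntegral.hasFDerivAt_integral_of_dominated_of_fderiv_le
    (F := fun y s => w (y, s)) (F' := fun y s => F' (y, s)) (bound := fun _ => C + 1) hu' ?_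
    ((hcw y₀ hy₀).intervalIntegrable _ _) (hcF y₀ hy₀).aestronglyMeasurable ?_
    intervalIntegrable_const ?_
  · filter_upwards [hD.mem_nhds hy₀] with y hy using (hcw y hy).aestronglyMeasurable
  · exact Eventually.of_forall fun s hs y hy => (huv (mk_mem_prod hy (hsub s hs))).2.le
  · refine Eventually.of_forall fun s hs y hy => ?_
    have hz := (huv (mk_mem_prod hy (hsub s hs))).1
    have h1 : HasFDerivAt w (fderiv ℝ w (y, s)) (y, s) :=
      ((hw.differentiableOn one_ne_zero).differentiableAt (hO.mem_nhds hz)).hasFDerivAt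
    have h2 : HasFDerivAt (fun y : E => (y, s)) (ContinuousLinearMap.inl ℝ E ℝ) y :=
      hasFDerivAt_prodMk_left y s
    exact h1.comp y h2

/-- The derivative is again an integral of this kind, with values in `E →L[ℝ] G`. The induction
therefore varies `G`, and this is why `E` and `G` share a universe. -/
theorem contDiffOn_integral_unitInterval {D : Set E} (hD : IsOpen D) {w : E × ℝ → G}
    (hw : ContDiffOn ℝ ∞ w (D ×ˢ univ)) :
    ContDiffOn ℝ ∞ (fun y => ∫ s in (0 : ℝ)..1, w (y, s)) D := by
  rw [contDiffOn_infty]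
  intro n
  induction n generalizing G with
  | zero =>
    refine contDiffOn_zero.2 fun y hy => ?_
    exact (hasFDerivAt_integral_unitInterval hD
      (hw.of_le (by exact_mod_cast le_top)) hy).continuousAt.continuousWithinAt
  | succ n ih =>
    have hder : ∀ y ∈ D, HasFDerivAt (fun y => ∫ s in (0 : ℝ)..1, w (y, s)) _ y := fun y hy =>
      hasFDerivAt_integral_unitInterval hD (hw.of_le (by exact_mod_cast le_top)) hy
    refine (contDiffOn_succ_iff_fderiv_of_isOpen hD).2
      ⟨fun y hy => (hder y hy).differentiableAt.differentiableWithinAt,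
        fun h => absurd h (WithTop.coe_ne_top (a := (n : ℕ∞))), ?_⟩
    have hw' : ContDiffOn ℝ ∞ (fun z => (fderiv ℝ w z).comp (ContinuousLinearMap.inl ℝ E ℝ))
        (D ×ˢ univ) :=
      (hw.fderiv_of_isOpen (hD.prod isOpen_univ) (by simp)).clm_comp contDiffOn_const
    exact (ih hw').congr fun y hy => (hder y hy).fderiv

theorem integral_unitInterval_comp_clm {G G' : Type*} [NormedAddCommGroup G] [NormedSpace ℝ G]
    [CompleteSpace G] [NormedAddCommGroup G'] [NormedSpace ℝ G'] [CompleteSpace G']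
    (L : G →L[ℝ] G') {f : ℝ → G} (hf : Continuous f) :
    ∫ s in (0 : ℝ)..1, L (f s) = L (∫ s in (0 : ℝ)..1, f s) :=
  L.intervalIntegral_comp_comm (hf.intervalIntegrable _ _)

end ParametricIntegral

/-! ### Contraction with the time direction -/

section Contract

variable {E : Type*} [NormedAddCommGroup E] [NormedSpace ℝ E]

theorem norm_apply_cons_le {k : ℕ} (α : (E × ℝ) [⋀^Fin (k + 1)]→L[ℝ] ℂ) (v : Fin k → E) :
    ‖α (Fin.cons (0, 1) fun i => (v i, 0))‖ ≤ ‖α‖ * ∏ i, ‖v i‖ := by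
  refine (α.le_opNorm _).trans (le_of_eq ?_)
  rw [Fin.prod_univ_succ]
  simp [Prod.norm_def]

/-- Contraction of an alternating form on `E × ℝ` with the vector `(0, 1)`, restricted to `E`. -/
def contractTimeAux {k : ℕ} (α : (E × ℝ) [⋀^Fin (k + 1)]→L[ℝ] ℂ) : E [⋀^Fin k]→L[ℝ] ℂ :=
  AlternatingMap.mkContinuous
    ((α.toAlternatingMap.curryLeft (0, 1)).compLinearMap (LinearMap.inl ℝ E ℝ)) ‖α‖
    (norm_apply_cons_le α)

/-- `contractTimeAux` as a continuous linear map. -/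
def contractTime (E : Type*) [NormedAddCommGroup E] [NormedSpace ℝ E] (k : ℕ) :
    (E × ℝ) [⋀^Fin (k + 1)]→L[ℝ] ℂ →L[ℝ] E [⋀^Fin k]→L[ℝ] ℂ :=
  LinearMap.mkContinuous
    { toFun := contractTimeAux
      map_add' := fun α β => by
        ext v
        rfl
      map_smul' := fun c α => by
        ext v
        rfl }
    1 (fun α => by
      rw [one_mul]
      exact ContinuousAlternatingMap.opNorm_le_bound _ (norm_nonneg α) (norm_apply_cons_le α))

theorem contractTime_apply {k : ℕ} (α : (E × ℝ) [⋀^Fin (k + 1)]→L[ℝ] ℂ) (v : Fin k → E) :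
    contractTime E k α v = α (Fin.cons (0, 1) fun i => (v i, 0)) := by
  change α (Matrix.vecCons (0, 1) fun i => (v i, 0)) = _
  rfl

/-- Charts of the cylinder have differentials of the form `A × id`, so this is compatibility of the
contraction with local expressions. -/
theorem contractTime_comp {k : ℕ} (α : (E × ℝ) [⋀^Fin (k + 1)]→L[ℝ] ℂ) (A : E →L[ℝ] E) :
    contractTime E k (α.compContinuousLinearMap (A.prodMap (ContinuousLinearMap.id ℝ ℝ))) =
      (contractTime E k α).compContinuousLinearMap A := by
  ext v
  rw [contractTime_apply, ContinuousAlternatingMap.compContinuousLinearMap_apply,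
    ContinuousAlternatingMap.compContinuousLinearMap_apply, contractTime_apply]
  congr 1
  funext i
  refine Fin.cases ?_ (fun j => ?_) i <;> simp

end Contract

/-! ### The homotopy formula in a normed space -/

section LocalHomotopy

universe u
variable {E : Type u} [NormedAddCommGroup E] [NormedSpace ℝ E]

/-- The homotopy formula for closed forms on `D × ℝ`, where `D` is open in a normed space. -/
theorem extDeriv_integral_contractTime {k : ℕ} {D : Set E} (hD : IsOpen D)
    {w : E × ℝ → (E × ℝ) [⋀^Fin (k + 1)]→L[ℝ] ℂ} (hw : ContDiffOn ℝ ∞ w (D ×ˢ univ))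
    {y : E} (hy : y ∈ D) (hclosed : ∀ s, extDeriv w (y, s) = 0) :
    extDeriv (fun y => ∫ s in (0 : ℝ)..1, contractTime E k (w (y, s))) y =
      (w (y, 1)).compContinuousLinearMap (ContinuousLinearMap.inl ℝ E ℝ) -
      (w (y, 0)).compContinuousLinearMap (ContinuousLinearMap.inl ℝ E ℝ) := by
  have hO : IsOpen (D ×ˢ (univ : Set ℝ)) := hD.prod isOpen_univ
  have hdiff : ∀ s, HasFDerivAt w (fderiv ℝ w (y, s)) (y, s) := fun s =>
    ((hw.differentiableOn (by simp)).differentiableAt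
      (hO.mem_nhds ⟨hy, mem_univ _⟩)).hasFDerivAt
  have hcF : Continuous fun s : ℝ => fderiv ℝ w (y, s) :=
    ((hw.continuousOn_fderiv_of_isOpen hO (by simp))).comp_continuous (by fun_prop)
      fun s => ⟨hy, mem_univ _⟩
  have hΛ : ContDiffOn ℝ ∞ (fun z => contractTime E k (w z)) (D ×ˢ univ) :=
    (contractTime E k).contDiff.comp_contDiffOn hw
  have hder := hasFDerivAt_integral_unitInterval hD (hΛ.of_le (by exact_mod_cast le_top)) hy
  have hfd : ∀ s, fderiv ℝ (fun z => contractTime E k (w z)) (y, s) =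
      (contractTime E k).comp (fderiv ℝ w (y, s)) := fun s =>
    ((contractTime E k).hasFDerivAt.comp (y, s) (hdiff s)).fderiv
  simp only [hfd] at hder
  ext v
  rw [extDeriv, hder.fderiv, ContinuousAlternatingMap.alternatizeUncurryFin_apply]
  let inl := ContinuousLinearMap.inl ℝ E ℝ
  let e : Fin (k + 2) → E × ℝ := Fin.cons (0, 1) fun i => (v i, 0)
  have hterm : ∀ i : Fin (k + 1), (∫ s in (0 : ℝ)..1,
      ((contractTime E k).comp (fderiv ℝ w (y, s))).comp inl) (v i) (i.removeNth v) =
      ∫ s in (0 : ℝ)..1, fderiv ℝ w (y, s) (v i, 0) (i.succ.removeNth e) := fun i => by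
    let L : (E →L[ℝ] E [⋀^Fin k]→L[ℝ] ℂ) →L[ℝ] ℂ :=
      (ContinuousAlternatingMap.apply ℝ E ℂ (i.removeNth v)).comp
        (ContinuousLinearMap.apply ℝ _ (v i))
    have h1 := integral_unitInterval_comp_clm L
      (f := fun s => ((contractTime E k).comp (fderiv ℝ w (y, s))).comp inl)
      ((continuous_const.clm_comp hcF).clm_comp continuous_const)
    refine Eq.trans h1.symm ?_
    refine intervalIntegral.integral_congr fun s _ => ?_
    change contractTime E k (fderiv ℝ w (y, s) (inl (v i))) (i.removeNth v) = _
    rw [contractTime_apply]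
    congr 1
    funext j
    refine Fin.cases ?_ (fun j => ?_) j
    · simp [e, Fin.removeNth]
    · simp [e, Fin.removeNth]
  -- The equation `dw(∂/∂t, v₀, …, v_k) = 0` solved for its first term: the time derivative of
  -- `w(v₀, …, v_k)` is the alternating sum that defines `d` of the contraction. The index shift
  -- absorbs the minus sign.
  have hcl : ∀ s, fderiv ℝ w (y, s) (0, 1) (fun i => (v i, 0)) =
      ∑ i : Fin (k + 1), (-1 : ℤ) ^ (i : ℕ) •
        fderiv ℝ w (y, s) (v i, 0) (i.succ.removeNth e) := fun s => by
    have h1 : extDeriv w (y, s) e = 0 := by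
      rw [hclosed s]
      rfl
    rw [extDeriv, ContinuousAlternatingMap.alternatizeUncurryFin_apply, Fin.sum_univ_succ] at h1
    have h2 : (0 : Fin (k + 2)).removeNth e = fun i => (v i, 0) := by
      funext j
      simp [e, Fin.removeNth]
    rw [h2] at h1
    simp only [Fin.val_zero, pow_zero, one_smul, Fin.val_succ, pow_succ, e, Fin.cons_zero,
      Fin.cons_succ] at h1
    rw [eq_neg_of_add_eq_zero_left h1, ← Finset.sum_neg_distrib]
    refine Finset.sum_congr rfl fun i _ => ?_
    simp [e]
  have hFTC : ∫ s in (0 : ℝ)..1, fderiv ℝ w (y, s) (0, 1) (fun i => (v i, 0)) =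
      w (y, 1) (fun i => (v i, 0)) - w (y, 0) (fun i => (v i, 0)) := by
    let L : (E × ℝ) [⋀^Fin (k + 1)]→L[ℝ] ℂ →L[ℝ] ℂ :=
      ContinuousAlternatingMap.apply ℝ (E × ℝ) ℂ (fun i => (v i, 0))
    refine intervalIntegral.integral_eq_sub_of_hasDerivAt
      (f := fun s => w (y, s) (fun i => (v i, 0))) (fun s _ => ?_) ?_
    · have h1 : HasDerivAt (fun s : ℝ => (y, s)) ((0 : E), (1 : ℝ)) s :=
        (hasDerivAt_const s y).prodMk (hasDerivAt_id s)
      exact L.hasFDerivAt.comp_hasDerivAt s ((hdiff s).comp_hasDerivAt s h1)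
    · exact (L.continuous.comp (hcF.clm_apply continuous_const)).intervalIntegrable _ _
  refine (Finset.sum_congr rfl fun i _ => congrArg _ (hterm i)).trans ?_
  refine Eq.trans ?_ hFTC
  simp only [hcl]
  rw [intervalIntegral.integral_finsetSum]
  · refine Finset.sum_congr rfl fun i _ => ?_
    rcases neg_one_pow_eq_or ℤ (i : ℕ) with h | h <;> simp [h]
  · intro i _
    have : Continuous fun s => fderiv ℝ w (y, s) (v i, 0) (i.succ.removeNth e) :=
      (ContinuousAlternatingMap.apply ℝ (E × ℝ) ℂ (i.succ.removeNth e)).continuous.comp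
        (hcF.clm_apply continuous_const)
    exact (this.const_smul _).intervalIntegrable _ _

end LocalHomotopy

end FibredDeRham
end

/-! ### Cylinders, homotopy invariance and the Poincaré lemma -/

noncomputable section

open Set Function Filter

namespace FibredDeRham

/-- The product `M × ℝ`, as a manifold modelled on `E × ℝ`. -/
def Cylinder (M : Type*) : Type _ := M × ℝ

/-- The point `(x, t)` of the cylinder. -/
def Cylinder.mk {M : Type*} (x : M) (t : ℝ) : Cylinder M := (x, t)

section Cylinder

universe u
variable {E : Type u} {M : Type*} [NormedAddCommGroup E] [NormedSpace ℝ E] [TopologicalSpace M]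
  [ChartedSpace E M]

instance : TopologicalSpace (Cylinder M) := inferInstanceAs (TopologicalSpace (M × ℝ))

instance : ChartedSpace (E × ℝ) (Cylinder M) :=
  inferInstanceAs (ChartedSpace (ModelProd E ℝ) (M × ℝ))

/-- `Form` refers to models of the type `𝓘(ℝ, ·)`, whereas a product carries `𝓘(ℝ, E).prod 𝓘(ℝ, ℝ)`.
The cylinder is the product viewed over `𝓘(ℝ, E × ℝ)`. -/
instance [IsManifold 𝓘(ℝ, E) ∞ M] : IsManifold 𝓘(ℝ, E × ℝ) ∞ (Cylinder M) := by
  rw [modelWithCornersSelf_prod]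
  exact inferInstanceAs (IsManifold (𝓘(ℝ, E).prod 𝓘(ℝ, ℝ)) ∞ (M × ℝ))

variable [IsManifold 𝓘(ℝ, E) ∞ M]

/-- A smooth map on `M × ℝ`, considered as a map on the cylinder. -/
def cylinderMap {E' N : Type*} [NormedAddCommGroup E'] [NormedSpace ℝ E'] [TopologicalSpace N]
    [ChartedSpace E' N] (F : M × ℝ → N)
    (hF : ContMDiff (𝓘(ℝ, E).prod 𝓘(ℝ, ℝ)) 𝓘(ℝ, E') ∞ F) :
    C^∞⟮𝓘(ℝ, E × ℝ), Cylinder M; 𝓘(ℝ, E'), N⟯ :=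
  ⟨F, by
    rw [modelWithCornersSelf_prod]
    exact hF⟩

/-- The inclusion of `M × {t}` into the cylinder. -/
def cylinderIncl (E : Type u) (M : Type*) [NormedAddCommGroup E] [NormedSpace ℝ E]
    [TopologicalSpace M] [ChartedSpace E M] (t : ℝ) :
    C^∞⟮𝓘(ℝ, E), M; 𝓘(ℝ, E × ℝ), Cylinder M⟯ :=
  ⟨fun x => (x, t), by
    rw [modelWithCornersSelf_prod]
    exact contMDiff_id.prodMk contMDiff_const⟩

theorem tangentCLM_cylinderIncl (t : ℝ) (x : M) :
    tangentCLM (E := E) (E' := E × ℝ) (cylinderIncl E M t) x = ContinuousLinearMap.inl ℝ E ℝ := by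
  rw [mfderiv_eq_localMap (cylinderIncl E M t).contMDiff]
  have h : localMap (E := E) (E' := E × ℝ) (cylinderIncl E M t) x (cylinderIncl E M t x)
      =ᶠ[𝓝 (chartAt E x x)] fun y => (y, t) := by
    filter_upwards [(chartAt E x).open_target.mem_nhds (mem_chart_target E x)] with y hy
    exact Prod.ext ((chartAt E x).right_inv hy) rfl
  rw [h.fderiv_eq]
  exact (hasFDerivAt_prodMk_left _ t).fderiv

theorem tangentCLM_chartAt_symm_self (x : M) :
    tangentCLM (E := E) (E' := E) (chartAt E x).symm (chartAt E x x) =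
      ContinuousLinearMap.id ℝ E := by
  rw [mfderiv_chart_symm_eq x (mem_chart_target E x), (chartAt E x).left_inv (mem_chart_source E x)]
  have h : localMap (E := E) (E' := E) (id : M → M) x x =ᶠ[𝓝 (chartAt E x x)] id := by
    filter_upwards [(chartAt E x).open_target.mem_nhds (mem_chart_target E x)] with y hy
    exact (chartAt E x).right_inv hy
  rw [h.fderiv_eq, fderiv_id]

/-- The tangent space at `x` is identified with `E` through this very chart. -/
theorem localRep_self {k : ℕ} (α : M → E [⋀^Fin k]→L[ℝ] ℂ) (x : M) :
    localRep α x (chartAt E x x) = α x := by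
  unfold localRep
  rw [tangentCLM_chartAt_symm_self, (chartAt E x).left_inv (mem_chart_source E x)]
  ext v
  rfl

theorem tangentCLM_chartAt_cylinder_symm (x : M) (t₀ s : ℝ) {y : E}
    (hy : y ∈ (chartAt E x).target) :
    tangentCLM (E := E × ℝ) (E' := E × ℝ)
      (chartAt (E × ℝ) (Cylinder.mk x t₀)).symm (y, s) =
      (tangentCLM (E := E) (E' := E) (chartAt E x).symm y).prodMap
        (ContinuousLinearMap.id ℝ ℝ) := by
  have hys : ((y, s) : E × ℝ) ∈ (chartAt (E × ℝ) (Cylinder.mk x t₀)).target :=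
    ⟨hy, mem_univ _⟩
  rw [mfderiv_chart_symm_eq _ hys, mfderiv_chart_symm_eq x hy]
  have h1 : ContDiffAt ℝ ∞
      (localMap (E := E) (E' := E) (id : M → M) x ((chartAt E x).symm y)) y :=
    contDiffAt_localMap contMDiff_id x _ hy (mem_chart_source _ _)
  have h2 := (h1.differentiableAt (by simp)).hasFDerivAt
  exact (h2.prodMap (y, s) (hasFDerivAt_id s)).fderiv

theorem localRep_cylinder {k : ℕ} (θ : Cylinder M → (E × ℝ) [⋀^Fin k]→L[ℝ] ℂ) (x : M) (t₀ s : ℝ)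
    {y : E} (hy : y ∈ (chartAt E x).target) :
    localRep θ (Cylinder.mk x t₀) (y, s) = (θ (Cylinder.mk ((chartAt E x).symm y) s)).compContinuousLinearMap
      ((tangentCLM (E := E) (E' := E) (chartAt E x).symm y).prodMap
        (ContinuousLinearMap.id ℝ ℝ)) := by
  rw [← tangentCLM_chartAt_cylinder_symm x t₀ s hy]
  rfl

/-- The preferred charts at `(x, s)` and `(x, 0)` coincide, so one local expression describes `θ`
along the whole line over `x`. -/
theorem IsSmoothForm.continuous_time {k : ℕ} {θ : Cylinder M → (E × ℝ) [⋀^Fin k]→L[ℝ] ℂ}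
    (hθ : IsSmoothForm θ) (x : M) : Continuous fun s : ℝ => θ (Cylinder.mk x s) := by
  have h : ∀ s, θ (Cylinder.mk x s) = localRep θ (Cylinder.mk x 0) (chartAt E x x, s) := fun s =>
    (localRep_self θ (Cylinder.mk x s)).symm
  simp_rw [h]
  exact (hθ (Cylinder.mk x 0)).continuousOn.comp_continuous (by fun_prop)
    fun s => ⟨mem_chart_target E x, mem_univ _⟩

/-- The integral over `0 ≤ t ≤ 1` of the contraction of `θ` with `∂/∂t`. -/
def timeIntegral {k : ℕ} (θ : Cylinder M → (E × ℝ) [⋀^Fin (k + 1)]→L[ℝ] ℂ) (x : M) :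
    E [⋀^Fin k]→L[ℝ] ℂ :=
  ∫ s in (0 : ℝ)..1, contractTime E k (θ (Cylinder.mk x s))

theorem localRep_timeIntegral {k : ℕ} {θ : Cylinder M → (E × ℝ) [⋀^Fin (k + 1)]→L[ℝ] ℂ}
    (hθ : IsSmoothForm θ) (x : M) {y : E} (hy : y ∈ (chartAt E x).target) :
    localRep (timeIntegral θ) x y =
      ∫ s in (0 : ℝ)..1, contractTime E k (localRep θ (Cylinder.mk x 0) (y, s)) := by
  simp_rw [localRep_cylinder θ x 0 _ hy, contractTime_comp]
  exact (integral_unitInterval_comp_clm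
    (ContinuousAlternatingMap.compContinuousLinearMapCLM
      (tangentCLM (E := E) (E' := E) (chartAt E x).symm y))
    ((contractTime E k).continuous.comp (hθ.continuous_time ((chartAt E x).symm y)))).symm

theorem IsSmoothForm.contDiffOn_cylinder {k : ℕ} {θ : Cylinder M → (E × ℝ) [⋀^Fin k]→L[ℝ] ℂ}
    (hθ : IsSmoothForm θ) (x : M) :
    ContDiffOn ℝ ∞ (localRep θ (Cylinder.mk x 0)) ((chartAt E x).target ×ˢ univ) :=
  hθ (Cylinder.mk x 0)

theorem IsSmoothForm.timeIntegral {k : ℕ} {θ : Cylinder M → (E × ℝ) [⋀^Fin (k + 1)]→L[ℝ] ℂ}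
    (hθ : IsSmoothForm θ) : IsSmoothForm (timeIntegral θ) := fun x =>
  (contDiffOn_integral_unitInterval (chartAt E x).open_target
    ((contractTime E k).contDiff.comp_contDiffOn (hθ.contDiffOn_cylinder x))).congr
    fun _ hy => localRep_timeIntegral hθ x hy

/-- The homotopy formula for closed forms on the cylinder. -/
theorem dForm_timeIntegral {k : ℕ} (θ : Form (E × ℝ) (Cylinder M) (k + 1))
    (hθ : dForm (k + 1) θ = 0) :
    dForm k (⟨timeIntegral θ.1, θ.2.timeIntegral⟩ : Form E M k) =
      pullback (cylinderIncl E M 1) (k + 1) θ - pullback (cylinderIncl E M 0) (k + 1) θ := by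
  apply Subtype.ext
  funext x
  have hx := mem_chart_target E x
  have h1 : localRep (timeIntegral θ.1) x =ᶠ[𝓝 (chartAt E x x)] fun y =>
      ∫ s in (0 : ℝ)..1, contractTime E k (localRep θ.1 (Cylinder.mk x 0) (y, s)) := by
    filter_upwards [(chartAt E x).open_target.mem_nhds hx] with y hy
    exact localRep_timeIntegral θ.2 x hy
  have hcl : ∀ s, extDeriv (localRep θ.1 (Cylinder.mk x 0)) (chartAt E x x, s) = 0 := fun s =>
    congrFun (congrArg Subtype.val hθ) (Cylinder.mk x s)
  change extDeriv (localRep (timeIntegral θ.1) x) (chartAt E x x) = _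
  rw [h1.extDeriv_eq, extDeriv_integral_contractTime (chartAt E x).open_target
    (θ.2.contDiffOn_cylinder x) hx hcl]
  have h2 : ∀ t, (localRep θ.1 (Cylinder.mk x 0) (chartAt E x x, t)).compContinuousLinearMap
      (ContinuousLinearMap.inl ℝ E ℝ) = pullbackRaw (cylinderIncl E M t) θ.1 x := fun t => by
    rw [pullbackRaw, tangentCLM_cylinderIncl]
    congr 1
    exact localRep_self θ.1 (Cylinder.mk x t)
  rw [h2, h2]
  rfl

variable {E' N : Type*} [NormedAddCommGroup E'] [NormedSpace ℝ E'] [TopologicalSpace N]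
    [ChartedSpace E' N] [IsManifold 𝓘(ℝ, E') ∞ N]

theorem pullback_comp {E'' P : Type*} [NormedAddCommGroup E''] [NormedSpace ℝ E'']
    [TopologicalSpace P] [ChartedSpace E'' P] [IsManifold 𝓘(ℝ, E'') ∞ P]
    (g : C^∞⟮𝓘(ℝ, E'), N; 𝓘(ℝ, E''), P⟯) (f : C^∞⟮𝓘(ℝ, E), M; 𝓘(ℝ, E'), N⟯) (k : ℕ)
    (α : Form E'' P k) : pullback (g.comp f) k α = pullback f k (pullback g k α) := by
  apply Subtype.ext
  funext x
  change (α.1 (g (f x))).compContinuousLinearMap (mfderiv _ _ (g ∘ f) x) = _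
  rw [mfderiv_comp x (g.contMDiff.mdifferentiable (by simp) _)
    (f.contMDiff.mdifferentiable (by simp) _)]
  rfl

/-- Smoothly homotopic maps induce the same map in de Rham cohomology. -/
theorem exists_dForm_eq_pullback_sub {F : M × ℝ → N}
    (hF : ContMDiff (𝓘(ℝ, E).prod 𝓘(ℝ, ℝ)) 𝓘(ℝ, E') ∞ F) (f₀ f₁ : C^∞⟮𝓘(ℝ, E), M; 𝓘(ℝ, E'), N⟯)
    (h₀ : ∀ x, F (x, 0) = f₀ x) (h₁ : ∀ x, F (x, 1) = f₁ x) {k : ℕ} (α : Form E' N (k + 1))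
    (hα : dForm (k + 1) α = 0) :
    ∃ β : Form E M k, dForm k β = pullback f₁ (k + 1) α - pullback f₀ (k + 1) α := by
  have e₀ : f₀ = (cylinderMap F hF).comp (cylinderIncl E M 0) := ContMDiffMap.ext fun x => (h₀ x).symm
  have e₁ : f₁ = (cylinderMap F hF).comp (cylinderIncl E M 1) := ContMDiffMap.ext fun x => (h₁ x).symm
  refine ⟨⟨_, (pullback (cylinderMap F hF) (k + 1) α).2.timeIntegral⟩, ?_⟩
  rw [dForm_timeIntegral, e₀, e₁, pullback_comp, pullback_comp]
  rw [dForm_pullback, hα, map_zero]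

/-- The differential of `f` vanishes, and an alternating form with at least one argument is killed
by it. For `k = 0` the pullback would be a constant function. -/
theorem pullback_eq_zero_of_const (f : C^∞⟮𝓘(ℝ, E), M; 𝓘(ℝ, E'), N⟯) (y : N) (hf : ∀ x, f x = y)
    {k : ℕ} (hk : 1 ≤ k) (α : Form E' N k) : pullback f k α = 0 := by
  apply Subtype.ext
  funext x
  have hfc : (f : M → N) = fun _ => y := funext hf
  have h : tangentCLM (E := E) (E' := E') f x = 0 := by
    rw [hfc]
    exact mfderiv_const
  ext v
  change α.1 (f x) (fun i => tangentCLM (E := E) (E' := E') f x (v i)) = 0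
  rw [h]
  exact (α.1 (f x)).map_coord_zero (⟨0, hk⟩ : Fin k) rfl

/-- The Poincaré lemma for smoothly contractible manifolds. -/
theorem exists_dForm_eq_of_contraction {G : M × ℝ → M} {x₀ : M}
    (hG : ContMDiff (𝓘(ℝ, E).prod 𝓘(ℝ, ℝ)) 𝓘(ℝ, E) ∞ G) (h₀ : ∀ x, G (x, 0) = x)
    (h₁ : ∀ x, G (x, 1) = x₀) {k : ℕ} (α : Form E M (k + 1)) (hα : dForm (k + 1) α = 0) :
    ∃ β : Form E M k, dForm k β = α := by
  obtain ⟨β, hβ⟩ := exists_dForm_eq_pullback_sub hG ContMDiffMap.id (ContMDiffMap.const x₀)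
    h₀ h₁ α hα
  rw [pullback_eq_zero_of_const (ContMDiffMap.const x₀) x₀ (fun _ => rfl) (by omega)] at hβ
  have hid : pullback (ContMDiffMap.id (I := 𝓘(ℝ, E)) (M := M) (n := ∞)) (k + 1) α = α :=
    Subtype.ext (pullbackRaw_id α.1)
  refine ⟨-β, ?_⟩
  rw [map_neg, hβ, hid, zero_sub, neg_neg]

end Cylinder

end FibredDeRham
end

noncomputable section

open Set Function Filter

namespace FibredDeRham

/-! ### Top forms and Stokes' theorem -/

section TopForms

open MeasureTheory

/-- Real-valued top forms are multiples of the determinant; the real and imaginary parts are treated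
separately. -/
theorem apply_clm_single_eq_det_smul {k : ℕ} (α : EuclideanSpace ℝ (Fin k) [⋀^Fin k]→L[ℝ] ℂ)
    (L : EuclideanSpace ℝ (Fin k) →L[ℝ] EuclideanSpace ℝ (Fin k)) :
    α (fun i => L (EuclideanSpace.single i 1)) =
      L.det • α fun i => EuclideanSpace.single i 1 := by
  let b := (EuclideanSpace.basisFun (Fin k) ℝ).toBasis
  have hb : ∀ i, b i = EuclideanSpace.single i 1 := fun i => by
    simp [b]
  have key : ∀ f : EuclideanSpace ℝ (Fin k) [⋀^Fin k]→ₗ[ℝ] ℝ,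
      f (fun i => L (EuclideanSpace.single i 1)) =
        L.det * f fun i => EuclideanSpace.single i 1 := by
    intro f
    have h1 : (fun i => L (EuclideanSpace.single i 1)) =
        (L : EuclideanSpace ℝ (Fin k) →ₗ[ℝ] EuclideanSpace ℝ (Fin k)) ∘ b := by
      funext i
      simp [hb]
    have h2 : (fun i => EuclideanSpace.single i (1 : ℝ)) = b := funext fun i => (hb i).symm
    rw [h1, h2, AlternatingMap.eq_smul_basis_det b f, AlternatingMap.smul_apply,
      AlternatingMap.smul_apply, Module.Basis.det_comp, Module.Basis.det_self]
    change _ * (L.det * 1) = L.det * (_ * 1)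
    ring
  apply Complex.ext
  · have := key (Complex.reLm.compAlternatingMap α.toAlternatingMap)
    simpa using this
  · have := key (Complex.imLm.compAlternatingMap α.toAlternatingMap)
    simpa using this

/-- The integral of an exact compactly supported top form on `ℝ^k` vanishes. -/
theorem integral_extDeriv_eq_zero {m : ℕ}
    {w : EuclideanSpace ℝ (Fin (m + 1)) → EuclideanSpace ℝ (Fin (m + 1)) [⋀^Fin m]→L[ℝ] ℂ}
    (hw : ContDiff ℝ 1 w) (hc : HasCompactSupport w)
    (v : Fin (m + 1) → EuclideanSpace ℝ (Fin (m + 1))) :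
    ∫ y, extDeriv w y v = 0 := by
  have h0 : ∀ i : Fin (m + 1), ContDiff ℝ 1 fun y => w y (i.removeNth v) := fun i =>
    (ContinuousAlternatingMap.apply ℝ (EuclideanSpace ℝ (Fin (m + 1))) ℂ
      (i.removeNth v)).contDiff.comp hw
  have hcs : ∀ i : Fin (m + 1), HasCompactSupport fun y => w y (i.removeNth v) := fun i =>
    hc.comp_left (g := fun a : EuclideanSpace ℝ (Fin (m + 1)) [⋀^Fin m]→L[ℝ] ℂ =>
      a (i.removeNth v)) rfl
  have hint : ∀ i : Fin (m + 1),
      Integrable fun y => fderiv ℝ (fun y => w y (i.removeNth v)) y (v i) := fun i => by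
    refine Continuous.integrable_of_hasCompactSupport ?_ ?_
    · exact ((h0 i).continuous_fderiv one_ne_zero).clm_apply continuous_const
    · exact ((hcs i).fderiv ℝ).comp_left (g := fun a => a (v i)) rfl
  have hzero : ∀ i : Fin (m + 1),
      ∫ y, fderiv ℝ (fun y => w y (i.removeNth v)) y (v i) = 0 := fun i => by
    -- Integration by parts against the constant function `1`.
    have h1 := integral_mul_fderiv_eq_neg_fderiv_mul_of_integrable (𝕜 := ℂ)
      (μ := (volume : Measure (EuclideanSpace ℝ (Fin (m + 1)))))
      (f := fun _ => 1) (g := fun y => w y (i.removeNth v)) (v := v i)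
      (by simp) (by simpa using hint i)
      (by simpa using (h0 i).continuous.integrable_of_hasCompactSupport (hcs i))
      (fun y _ => differentiableAt_const _)
      (fun y _ => (h0 i).differentiable one_ne_zero y)
    simpa using h1
  simp_rw [fun y => extDeriv_apply ((hw.differentiable one_ne_zero) y) v]
  rw [integral_finsetSum]
  · refine Finset.sum_eq_zero fun i _ => ?_
    rcases neg_one_pow_eq_or ℤ (i : ℕ) with h | h
    · simpa [h] using hzero i
    · simpa [h, integral_neg] using hzero i
  · intro i _
    exact (hint i).smul _

end TopForms

section Multiplication

variable {E M : Type*} [NormedAddCommGroup E] [NormedSpace ℝ E] [TopologicalSpace M]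
  [ChartedSpace E M] [IsManifold 𝓘(ℝ, E) ∞ M]

/-- The product of a smooth function and a form. -/
def mulForm {k : ℕ} (ρ : C^∞⟮𝓘(ℝ, E), M; 𝓘(ℝ, ℝ), ℝ⟯) (α : Form E M k) : Form E M k :=
  ⟨fun x => ρ x • α.1 x, fun x y hy => by
    have h1 : ContDiffAt ℝ ∞ (fun y => ρ ((chartAt E x).symm y)) y := by
      rw [← contMDiffAt_iff_contDiffAt]
      exact ρ.contMDiff.contMDiffAt.comp y (contMDiffAt_chart_symm x hy)
    have h2 := h1.smul (IsSmoothForm.contDiffAt α.2 x hy)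
    exact h2.contDiffWithinAt⟩

theorem extDerivRaw_eq_zero_of_notMem {k : ℕ} {α : Form E M k} {K : Set M} (hK : IsClosed K)
    (hα : ∀ x, x ∉ K → α.1 x = 0) {x : M} (hx : x ∉ K) : (dForm k α).1 x = 0 := by
  have h : localRep α.1 x =ᶠ[𝓝 (chartAt E x x)] fun _ => 0 := by
    have h1 : (chartAt E x).symm ⁻¹' Kᶜ ∈ 𝓝 (chartAt E x x) :=
      ((chartAt E x).continuousAt_symm (mem_chart_target E x)).preimage_mem_nhds
        (by
          rw [(chartAt E x).left_inv (mem_chart_source E x)]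
          exact hK.isOpen_compl.mem_nhds hx)
    filter_upwards [h1] with y hy
    change (α.1 ((chartAt E x).symm y)).compContinuousLinearMap _ = 0
    rw [hα _ hy]
    rfl
  change extDeriv (localRep α.1 x) _ = 0
  rw [h.extDeriv_eq]
  unfold extDeriv
  rw [fderiv_const_apply]
  exact map_zero (ContinuousAlternatingMap.alternatizeUncurryFinCLM ℝ E ℂ)

end Multiplication

namespace ClosedOrientedManifold

open MeasureTheory

variable {k : ℕ} (S : ClosedOrientedManifold k)

/-- The coefficient of `dy₁ ∧ ⋯ ∧ dy_k` in the expression of a form in the chart at `x`. -/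
def coeff (α : S.carrier → EuclideanSpace ℝ (Fin k) [⋀^Fin k]→L[ℝ] ℂ) (x : S.carrier)
    (y : EuclideanSpace ℝ (Fin k)) : ℂ :=
  localRep α x y fun i => EuclideanSpace.single i 1

theorem coeff_eq_det_smul (α : S.carrier → EuclideanSpace ℝ (Fin k) [⋀^Fin k]→L[ℝ] ℂ)
    (x j : S.carrier) {y : EuclideanSpace ℝ (Fin k)}
    (hy : y ∈ (chartAt (EuclideanSpace ℝ (Fin k)) x).target)
    (hj : (chartAt (EuclideanSpace ℝ (Fin k)) x).symm y ∈
      (chartAt (EuclideanSpace ℝ (Fin k)) j).source) :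
    S.coeff α x y =
      (fderiv ℝ (fun z => chartAt (EuclideanSpace ℝ (Fin k)) j
        ((chartAt (EuclideanSpace ℝ (Fin k)) x).symm z)) y).det •
      S.coeff α j (chartAt (EuclideanSpace ℝ (Fin k)) j
        ((chartAt (EuclideanSpace ℝ (Fin k)) x).symm y)) := by
  have h := localRep_pullback
    (contMDiff_id (I := 𝓘(ℝ, EuclideanSpace ℝ (Fin k))) (M := S.carrier) (n := ∞)) α x j hy hj
  rw [pullbackRaw_id] at h
  unfold coeff
  rw [h, ContinuousAlternatingMap.compContinuousLinearMap_apply]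
  exact apply_clm_single_eq_det_smul _ _

/-- Change of charts in the integral of a top form supported in the two chart domains. -/
theorem setIntegral_coeff_eq (α : S.carrier → EuclideanSpace ℝ (Fin k) [⋀^Fin k]→L[ℝ] ℂ)
    (ρ : S.carrier → ℝ) (x j : S.carrier)
    (hρ : ∀ z, z ∉ (chartAt (EuclideanSpace ℝ (Fin k)) x).source → ρ z = 0)
    (hα : ∀ z, z ∉ (chartAt (EuclideanSpace ℝ (Fin k)) j).source → α z = 0) :
    ∫ y in (chartAt (EuclideanSpace ℝ (Fin k)) x).target,
      ρ ((chartAt (EuclideanSpace ℝ (Fin k)) x).symm y) • S.coeff α x y =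
    ∫ y in (chartAt (EuclideanSpace ℝ (Fin k)) j).target,
      ρ ((chartAt (EuclideanSpace ℝ (Fin k)) j).symm y) • S.coeff α j y := by
  set φ := chartAt (EuclideanSpace ℝ (Fin k)) x with hφ
  set ψ := chartAt (EuclideanSpace ℝ (Fin k)) j with hψ
  let τ : EuclideanSpace ℝ (Fin k) → EuclideanSpace ℝ (Fin k) := fun z => ψ (φ.symm z)
  let T : Set (EuclideanSpace ℝ (Fin k)) := φ.target ∩ φ.symm ⁻¹' ψ.source
  have hT : IsOpen T := φ.isOpen_inter_preimage_symm ψ.open_source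
  have hτT : τ '' T = ψ.target ∩ ψ.symm ⁻¹' φ.source := by
    ext z
    constructor
    · rintro ⟨y, ⟨hy, hy'⟩, rfl⟩
      refine ⟨ψ.map_source hy', ?_⟩
      change ψ.symm (ψ (φ.symm y)) ∈ φ.source
      rw [ψ.left_inv hy']
      exact φ.map_target hy
    · rintro ⟨hz, hz'⟩
      refine ⟨φ (ψ.symm z), ⟨φ.map_source hz', ?_⟩, ?_⟩
      · change φ.symm (φ (ψ.symm z)) ∈ ψ.source
        rw [φ.left_inv hz']
        exact ψ.map_target hz
      · change ψ (φ.symm (φ (ψ.symm z))) = z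
        rw [φ.left_inv hz', ψ.right_inv hz]
  have hinj : InjOn τ T := by
    rintro y ⟨hy, hy'⟩ z ⟨hz, hz'⟩ hyz
    have h1 : φ.symm y = φ.symm z := ψ.injOn hy' hz' hyz
    exact φ.symm.injOn hy hz h1
  have hder : ∀ y ∈ T, HasFDerivWithinAt τ (fderiv ℝ τ y) T y := fun y hy =>
    ((contDiffAt_localMap contMDiff_id x j hy.1 hy.2).differentiableAt
      (by simp)).hasFDerivAt.hasFDerivWithinAt
  -- The orientation identifies the factor `|det|` of the change of variables with the factor `det`
  -- by which coefficients transform.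
  have hdet : ∀ y ∈ T, 0 < (fderiv ℝ τ y).det := fun y hy =>
    S.oriented φ (chart_mem_atlas _ x) ψ (chart_mem_atlas _ j) y (by
      rw [OpenPartialHomeomorph.trans_source, OpenPartialHomeomorph.symm_source]
      exact hy)
  have hcoeff0 : ∀ (i : S.carrier) (z : EuclideanSpace ℝ (Fin k)),
      α ((chartAt (EuclideanSpace ℝ (Fin k)) i).symm z) = 0 → S.coeff α i z = 0 := fun i z h => by
    unfold coeff localRep
    rw [h]
    rfl
  -- On the side of `x` the domain shrinks to the overlap because `α` vanishes off the domain of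
  -- `j`; on the side of `j` because `ρ` vanishes off the domain of `x`.
  calc ∫ y in φ.target, ρ (φ.symm y) • S.coeff α x y
      = ∫ y in T, ρ (φ.symm y) • S.coeff α x y := by
        refine setIntegral_eq_of_subset_of_forall_sdiff_eq_zero φ.open_target.measurableSet
          inter_subset_left fun y hy => ?_
        rw [hcoeff0 x y (hα _ fun h => hy.2 ⟨hy.1, h⟩), smul_zero]
    _ = ∫ y in T, |(fderiv ℝ τ y).det| • (ρ (ψ.symm (τ y)) • S.coeff α j (τ y)) := by
        refine setIntegral_congr_fun hT.measurableSet fun y hy => ?_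
        rw [S.coeff_eq_det_smul α x j hy.1 hy.2, abs_of_pos (hdet y hy), smul_comm]
        have : ψ.symm (τ y) = φ.symm y := ψ.left_inv hy.2
        rw [this]
    _ = ∫ y in τ '' T, ρ (ψ.symm y) • S.coeff α j y :=
        (integral_image_eq_integral_abs_det_fderiv_smul volume hT.measurableSet hder hinj
          fun y => ρ (ψ.symm y) • S.coeff α j y).symm
    _ = ∫ y in ψ.target, ρ (ψ.symm y) • S.coeff α j y := by
        rw [hτT]
        refine (setIntegral_eq_of_subset_of_forall_sdiff_eq_zero ψ.open_target.measurableSet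
          inter_subset_left fun y hy => ?_).symm
        rw [hρ _ fun h => hy.2 ⟨hy.1, h⟩, zero_smul]

theorem integrableOn_of_eq_zero_off {j : S.carrier} {K : Set S.carrier} (hK : IsClosed K)
    (hKj : K ⊆ (chartAt (EuclideanSpace ℝ (Fin k)) j).source) {g : EuclideanSpace ℝ (Fin k) → ℂ}
    (hg : ContinuousOn g (chartAt (EuclideanSpace ℝ (Fin k)) j).target)
    (hg0 : ∀ y, (chartAt (EuclideanSpace ℝ (Fin k)) j).symm y ∉ K → g y = 0) :
    IntegrableOn g (chartAt (EuclideanSpace ℝ (Fin k)) j).target := by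
  set φ := chartAt (EuclideanSpace ℝ (Fin k)) j
  have hc : IsCompact (φ '' K) := hK.isCompact.image_of_continuousOn (φ.continuousOn.mono hKj)
  have hsub : φ '' K ⊆ φ.target := by
    rintro _ ⟨z, hz, rfl⟩
    exact φ.map_source (hKj hz)
  refine ((hg.mono hsub).integrableOn_compact hc).of_forall_sdiff_eq_zero
    φ.open_target.measurableSet ?_
  rintro y ⟨hy, hyK⟩
  exact hg0 y fun h => hyK ⟨φ.symm y, h, φ.right_inv hy⟩

theorem coeff_eq_zero {α : S.carrier → EuclideanSpace ℝ (Fin k) [⋀^Fin k]→L[ℝ] ℂ} (j : S.carrier)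
    {y : EuclideanSpace ℝ (Fin k)}
    (h : α ((chartAt (EuclideanSpace ℝ (Fin k)) j).symm y) = 0) : S.coeff α j y = 0 := by
  unfold coeff localRep
  rw [h]
  rfl

theorem continuousOn_coeff {α : S.carrier → EuclideanSpace ℝ (Fin k) [⋀^Fin k]→L[ℝ] ℂ}
    (hα : IsSmoothForm α) (j : S.carrier) :
    ContinuousOn (S.coeff α j) (chartAt (EuclideanSpace ℝ (Fin k)) j).target :=
  (ContinuousAlternatingMap.apply ℝ (EuclideanSpace ℝ (Fin k)) ℂ
    (fun i => EuclideanSpace.single i (1 : ℝ))).continuous.comp_continuousOn (hα j).continuousOn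

/-- The integral of a form supported in a chart domain, computed in this chart. -/
theorem integral_eq_setIntegral_coeff (β : Form (EuclideanSpace ℝ (Fin k)) S.carrier k)
    (j : S.carrier) {K : Set S.carrier} (hK : IsClosed K)
    (hKj : K ⊆ (chartAt (EuclideanSpace ℝ (Fin k)) j).source) (hβ : ∀ z, z ∉ K → β.1 z = 0) :
    S.integral β = ∫ y in (chartAt (EuclideanSpace ℝ (Fin k)) j).target, S.coeff β.1 j y := by
  set φ := chartAt (EuclideanSpace ℝ (Fin k)) j with hφ
  have hfin : {x | (support (S.partition x)).Nonempty}.Finite :=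
    S.partition.locallyFinite.finite_nonempty_of_compact
  have h1 : ∀ x, ∫ y in (chartAt (EuclideanSpace ℝ (Fin k)) x).target, S.density β.1 x y =
      ∫ y in φ.target, S.partition x (φ.symm y) • S.coeff β.1 j y := fun x =>
    S.setIntegral_coeff_eq β.1 (S.partition x) x j
      (fun z hz => image_eq_zero_of_notMem_tsupport fun h => hz (S.partition_subordinate x h))
      fun z hz => hβ z fun h => hz (hKj h)
  have h2 : ∀ x, IntegrableOn (fun y => S.partition x (φ.symm y) • S.coeff β.1 j y) φ.target :=
    fun x => S.integrableOn_of_eq_zero_off hK hKj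
      (((S.partition x).contMDiff.continuous.comp_continuousOn φ.continuousOn_symm).smul
        (S.continuousOn_coeff β.2 j))
      fun y hy => by rw [S.coeff_eq_zero j (hβ _ hy), smul_zero]
  have hone : ∀ z, ∑ x ∈ hfin.toFinset, S.partition x z = 1 := fun z => by
    rw [← S.partition.sum_eq_one (mem_univ z)]
    refine (finsum_eq_sum_of_support_subset _ fun x hx => ?_).symm
    exact hfin.mem_toFinset.2 ⟨z, hx⟩
  change ∑ᶠ x, ∫ y in (chartAt (EuclideanSpace ℝ (Fin k)) x).target, S.density β.1 x y = _
  simp_rw [h1]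
  rw [finsum_eq_sum_of_support_subset (s := hfin.toFinset), ← integral_finsetSum _ fun x _ => h2 x]
  · refine setIntegral_congr_fun φ.open_target.measurableSet fun y _ => ?_
    rw [← Finset.sum_smul, hone, one_smul]
  · intro x hx
    by_contra hx'
    have : ∀ z, S.partition x z = 0 := fun z => by
      by_contra hz
      exact hx' (hfin.mem_toFinset.2 ⟨z, hz⟩)
    simp [this] at hx

end ClosedOrientedManifold

namespace ClosedOrientedManifold

open MeasureTheory

variable {m : ℕ} (S : ClosedOrientedManifold (m + 1))

/-- The local expression, extended by zero, is a compactly supported smooth form on Euclidean space,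
so `integral_extDeriv_eq_zero` applies. A partition of unity then gives Stokes' theorem in general.
-/
theorem integral_dForm_eq_zero_of_support (α : Form (EuclideanSpace ℝ (Fin (m + 1))) S.carrier m)
    (j : S.carrier) {K : Set S.carrier} (hK : IsClosed K)
    (hKj : K ⊆ (chartAt (EuclideanSpace ℝ (Fin (m + 1))) j).source)
    (hα : ∀ z, z ∉ K → α.1 z = 0) : S.integral (dForm m α) = 0 := by
  rw [S.integral_eq_setIntegral_coeff (dForm m α) j hK hKj
    fun z hz => extDerivRaw_eq_zero_of_notMem hK hα hz]
  set φ := chartAt (EuclideanSpace ℝ (Fin (m + 1))) j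
  have hc : IsCompact (φ '' K) := hK.isCompact.image_of_continuousOn (φ.continuousOn.mono hKj)
  let w := φ.target.indicator (localRep α.1 j)
  have hw0 : ∀ y, y ∉ φ '' K → w y = 0 := fun y hy => by
    by_cases hyt : y ∈ φ.target
    · simp only [w, indicator_of_mem hyt]
      unfold localRep
      rw [hα _ fun h => hy ⟨_, h, φ.right_inv hyt⟩]
      rfl
    · exact indicator_of_notMem hyt _
  have hwt : ∀ y ∈ φ.target, w =ᶠ[𝓝 y] localRep α.1 j := fun y hy => by
    filter_upwards [φ.open_target.mem_nhds hy] with z hz using indicator_of_mem hz _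
  have hw : ContDiff ℝ ∞ w := contDiff_iff_contDiffAt.2 fun y => by
    by_cases hyt : y ∈ φ.target
    · exact (IsSmoothForm.contDiffAt α.2 j hyt).congr_of_eventuallyEq (hwt y hyt)
    · have hy : y ∉ φ '' K := by
        rintro ⟨z, hz, rfl⟩
        exact hyt (φ.map_source (hKj hz))
      refine (contDiffAt_const (c := 0)).congr_of_eventuallyEq ?_
      filter_upwards [hc.isClosed.isOpen_compl.mem_nhds hy] with z hz using hw0 z hz
  have hwc : HasCompactSupport w := HasCompactSupport.intro hc hw0
  rw [← integral_extDeriv_eq_zero (hw.of_le (by exact_mod_cast le_top)) hwc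
    fun i => EuclideanSpace.single i 1]
  have h1 : ∀ y ∈ φ.target, S.coeff (dForm m α).1 j y =
      extDeriv w y fun i => EuclideanSpace.single i 1 := fun y hy => by
    rw [(hwt y hy).extDeriv_eq, ← localRep_extDerivRaw α.2 j hy]
    rfl
  rw [setIntegral_congr_fun φ.open_target.measurableSet h1]
  refine setIntegral_eq_integral_of_forall_compl_eq_zero fun y hy => ?_
  have hy' : y ∉ φ '' K := by
    rintro ⟨z, hz, rfl⟩
    exact hy (φ.map_source (hKj hz))
  have h2 : w =ᶠ[𝓝 y] fun _ => 0 := by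
    filter_upwards [hc.isClosed.isOpen_compl.mem_nhds hy'] with z hz using hw0 z hz
  rw [h2.extDeriv_eq]
  unfold extDeriv
  rw [fderiv_const_apply]
  exact DFunLike.congr_fun (map_zero (ContinuousAlternatingMap.alternatizeUncurryFinCLM ℝ
    (EuclideanSpace ℝ (Fin (m + 1))) ℂ)) _

/-- Stokes' theorem on closed oriented manifolds. -/
theorem integral_dForm (α : Form (EuclideanSpace ℝ (Fin (m + 1))) S.carrier m) :
    S.integral (dForm m α) = 0 := by
  have hfin : {x | (support (S.partition x)).Nonempty}.Finite :=
    S.partition.locallyFinite.finite_nonempty_of_compact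
  have h1 : α = ∑ x ∈ hfin.toFinset, mulForm (S.partition x) α := by
    apply Subtype.ext
    rw [AddSubgroup.val_finsetSum]
    funext z
    rw [Finset.sum_apply]
    change α.1 z = ∑ x ∈ hfin.toFinset, S.partition x z • α.1 z
    rw [← Finset.sum_smul]
    have : ∑ x ∈ hfin.toFinset, S.partition x z = 1 := by
      rw [← S.partition.sum_eq_one (mem_univ z)]
      refine (finsum_eq_sum_of_support_subset _ fun x hx => ?_).symm
      exact hfin.mem_toFinset.2 ⟨z, hx⟩
    rw [this, one_smul]
  rw [h1, map_sum, map_sum]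
  refine Finset.sum_eq_zero fun x _ => ?_
  refine S.integral_dForm_eq_zero_of_support _ x (isClosed_tsupport (S.partition x))
    (S.partition_subordinate x) fun z hz => ?_
  change S.partition x z • α.1 z = 0
  rw [image_eq_zero_of_notMem_tsupport hz]
  exact zero_smul ℝ (α.1 z)

end ClosedOrientedManifold

section HomotopyInvariance

universe u
variable {V : Type u} {A : Type*} [NormedAddCommGroup V] [NormedSpace ℝ V] [TopologicalSpace A]
  [ChartedSpace V A] [IsManifold 𝓘(ℝ, V) ∞ A]

/-- The integral of a closed form over a closed manifold is invariant under smooth homotopies. -/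
theorem integral_pullback_eq_of_homotopy {k : ℕ} (hk : 1 ≤ k) (S : ClosedOrientedManifold k)
    {F : S.carrier × ℝ → A}
    (hF : ContMDiff (𝓘(ℝ, EuclideanSpace ℝ (Fin k)).prod 𝓘(ℝ, ℝ)) 𝓘(ℝ, V) ∞ F)
    (f₀ f₁ : C^∞⟮𝓘(ℝ, EuclideanSpace ℝ (Fin k)), S.carrier; 𝓘(ℝ, V), A⟯)
    (h₀ : ∀ x, F (x, 0) = f₀ x) (h₁ : ∀ x, F (x, 1) = f₁ x) (α : Form V A k)
    (hα : dForm k α = 0) : S.integral (pullback f₁ k α) = S.integral (pullback f₀ k α) := by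
  obtain ⟨m, rfl⟩ := Nat.exists_eq_add_of_le' hk
  obtain ⟨β, hβ⟩ := exists_dForm_eq_pullback_sub hF f₀ f₁ h₀ h₁ α hα
  have h := S.integral_dForm β
  rw [hβ, map_sub] at h
  exact sub_eq_zero.1 h

end HomotopyInvariance

end FibredDeRham
end

noncomputable section

open Set Function Filter

namespace FibredDeRham

/-! ### Moving closed manifolds into a fibre -/

section FibreTransport

universe u
variable {V : Type u} {A : Type*} [NormedAddCommGroup V] [NormedSpace ℝ V] [TopologicalSpace A]
  [ChartedSpace V A] [IsManifold 𝓘(ℝ, V) ∞ A]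
variable {E B : Type*} [NormedAddCommGroup E] [NormedSpace ℝ E] [TopologicalSpace B]
  [ChartedSpace E B] [IsManifold 𝓘(ℝ, E) ∞ B]
variable {EF F : Type*} [NormedAddCommGroup EF] [NormedSpace ℝ EF]
  [TopologicalSpace F] [ChartedSpace EF F]
variable {π : C^∞⟮𝓘(ℝ, V), A; 𝓘(ℝ, E), B⟯} {U : Opens B}

/-- Transport of a family of points in the fibres over `g (s, τ s)` to the fibres over
`g (s, τ' s)` by means of a local trivialization. -/
theorem exists_transport {k : ℕ} (hk : 1 ≤ k) {S : ClosedOrientedManifold k}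
    {g : S.carrier × ℝ → B}
    (hg : ContMDiff (𝓘(ℝ, EuclideanSpace ℝ (Fin k)).prod 𝓘(ℝ, ℝ)) 𝓘(ℝ, E) ∞ g)
    (hgU : ∀ z, g z ∈ U) {τ τ' : S.carrier → ℝ}
    (hτ : ContMDiff 𝓘(ℝ, EuclideanSpace ℝ (Fin k)) 𝓘(ℝ, ℝ) ∞ τ)
    (hτ' : ContMDiff 𝓘(ℝ, EuclideanSpace ℝ (Fin k)) 𝓘(ℝ, ℝ) ∞ τ')
    (e : Bundle.Trivialization F π)
    (he : ContMDiffOn 𝓘(ℝ, V) (𝓘(ℝ, E).prod 𝓘(ℝ, EF)) ∞ e e.source)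
    (he' : ContMDiffOn (𝓘(ℝ, E).prod 𝓘(ℝ, EF)) 𝓘(ℝ, V) ∞ e.toOpenPartialHomeomorph.symm e.target)
    {O K : Set S.carrier} (hO : IsOpen O) (hK : IsClosed K) (hKO : K ⊆ O)
    (hττ' : ∀ s, s ∉ K → τ' s = τ s)
    (hbase : ∀ s ∈ O, ∀ c ∈ Icc (0 : ℝ) 1, g (s, τ s + c * (τ' s - τ s)) ∈ e.baseSet)
    (α : Form V (preimage π U) k) (hα : dForm k α = 0)
    (f : C^∞⟮𝓘(ℝ, EuclideanSpace ℝ (Fin k)), S.carrier; 𝓘(ℝ, V), preimage π U⟯)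
    (hf : ∀ s, π (f s).1 = g (s, τ s)) :
    ∃ f' : C^∞⟮𝓘(ℝ, EuclideanSpace ℝ (Fin k)), S.carrier; 𝓘(ℝ, V), preimage π U⟯,
      (∀ s, π (f' s).1 = g (s, τ' s)) ∧
        S.integral (pullback f' k α) = S.integral (pullback f k α) := by
  classical
  -- The homotopy has to be defined and smooth for all real times; `θ` confines it to the interval
  -- where the trivialization is available.
  let θ : ℝ → ℝ := Real.smoothTransition
  have hθ : ∀ c, θ c ∈ Icc (0 : ℝ) 1 := fun c =>
    ⟨Real.smoothTransition.nonneg c, Real.smoothTransition.le_one c⟩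
  let t : S.carrier × ℝ → ℝ := fun z => τ z.1 + θ z.2 * (τ' z.1 - τ z.1)
  have ht : ContMDiff (𝓘(ℝ, EuclideanSpace ℝ (Fin k)).prod 𝓘(ℝ, ℝ)) 𝓘(ℝ, ℝ) ∞ t :=
    (hτ.comp contMDiff_fst).add ((Real.smoothTransition.contDiff.contMDiff.comp contMDiff_snd).mul
      ((hτ'.comp contMDiff_fst).sub (hτ.comp contMDiff_fst)))
  have hgt : ContMDiff (𝓘(ℝ, EuclideanSpace ℝ (Fin k)).prod 𝓘(ℝ, ℝ)) 𝓘(ℝ, E) ∞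
      fun z : S.carrier × ℝ => g (z.1, t z) := hg.comp (contMDiff_fst.prodMk ht)
  have hfA : ContMDiff 𝓘(ℝ, EuclideanSpace ℝ (Fin k)) 𝓘(ℝ, V) ∞ fun s => (f s).1 :=
    contMDiff_subtype_val.comp f.contMDiff
  have hsrc : ∀ s ∈ O, (f s).1 ∈ e.source := fun s hs => by
    rw [e.mem_source, hf s]
    simpa using hbase s hs 0 (by simp)
  -- Over `O` the fibre coordinate of `f` is kept while the base point moves. Off `K` the base point
  -- stands still, so both branches agree on `O \ K` and `Φ` is smooth.
  let Φ : S.carrier × ℝ → A := fun z =>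
    if z.1 ∈ O then e.toOpenPartialHomeomorph.symm (g (z.1, t z), (e (f z.1).1).2) else (f z.1).1
  have hO' : IsOpen {z : S.carrier × ℝ | z.1 ∈ O} := hO.preimage continuous_fst
  have hK' : IsOpen {z : S.carrier × ℝ | z.1 ∉ K} := hK.isOpen_compl.preimage continuous_fst
  have htoff : ∀ z : S.carrier × ℝ, z.1 ∉ K → t z = τ z.1 := fun z hz => by
    simp only [t, hττ' _ hz, sub_self, mul_zero, add_zero]
  have hΦoff : ∀ z : S.carrier × ℝ, z.1 ∉ K → Φ z = (f z.1).1 := fun z hz => by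
    by_cases hzO : z.1 ∈ O
    · simp only [Φ, hzO, if_true]
      rw [htoff z hz, ← hf z.1]
      have h1 : ((π (f z.1).1, (e (f z.1).1).2) : B × F) = e (f z.1).1 :=
        e.mk_proj_snd (hsrc _ hzO)
      rw [h1]
      exact e.toOpenPartialHomeomorph.left_inv (hsrc _ hzO)
    · simp only [Φ, hzO, if_false]
  have htgt : ∀ z : S.carrier × ℝ, z.1 ∈ O → ((g (z.1, t z), (e (f z.1).1).2) : B × F) ∈ e.target :=
    fun z hz => e.mem_target.2 (hbase z.1 hz _ (hθ z.2))
  have hΦπ : ∀ z, π (Φ z) = g (z.1, t z) := fun z => by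
    by_cases hzO : z.1 ∈ O
    · simp only [Φ, hzO, if_true]
      exact e.proj_symm_apply (htgt z hzO)
    · have hzK : z.1 ∉ K := fun h => hzO (hKO h)
      rw [hΦoff z hzK, hf, htoff z hzK]
  have hΦ : ContMDiff (𝓘(ℝ, EuclideanSpace ℝ (Fin k)).prod 𝓘(ℝ, ℝ)) 𝓘(ℝ, V) ∞ Φ := fun z => by
    by_cases hzO : z.1 ∈ O
    · have h1 : Φ =ᶠ[𝓝 z] fun z =>
          e.toOpenPartialHomeomorph.symm (g (z.1, t z), (e (f z.1).1).2) := by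
        filter_upwards [hO'.mem_nhds hzO] with w hw
        exact if_pos hw
      refine ContMDiffAt.congr_of_eventuallyEq ?_ h1
      have h2 : ContMDiffAt (𝓘(ℝ, EuclideanSpace ℝ (Fin k)).prod 𝓘(ℝ, ℝ))
          (𝓘(ℝ, E).prod 𝓘(ℝ, EF)) ∞ (fun z : S.carrier × ℝ => e (f z.1).1) z :=
        ((he.contMDiffAt (e.open_source.mem_nhds (hsrc _ hzO))).comp z.1
          hfA.contMDiffAt).comp z contMDiffAt_fst
      have h3 := he'.contMDiffAt (e.open_target.mem_nhds (htgt z hzO))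
      exact h3.comp z (hgt.contMDiffAt.prodMk (contMDiffAt_snd.comp z h2))
    · have hzK : z.1 ∉ K := fun h => hzO (hKO h)
      refine (hfA.comp contMDiff_fst).contMDiffAt.congr_of_eventuallyEq ?_
      filter_upwards [hK'.mem_nhds hzK] with w hw using hΦoff w hw
  have hΦU : ∀ z, Φ z ∈ preimage π U := fun z => by
    change π (Φ z) ∈ U
    rw [hΦπ]
    exact hgU _
  let Ψ : S.carrier × ℝ → preimage π U := fun z => ⟨Φ z, hΦU z⟩
  have hΨ : ContMDiff (𝓘(ℝ, EuclideanSpace ℝ (Fin k)).prod 𝓘(ℝ, ℝ)) 𝓘(ℝ, V) ∞ Ψ :=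
    (ContMDiff.subtypeVal_comp_iff (preimage π U) Ψ).1 hΦ
  let f' : C^∞⟮𝓘(ℝ, EuclideanSpace ℝ (Fin k)), S.carrier; 𝓘(ℝ, V), preimage π U⟯ :=
    ⟨fun s => Ψ (s, 1), hΨ.comp (contMDiff_id.prodMk contMDiff_const)⟩
  have ht0 : ∀ s, t (s, 0) = τ s := fun s => by
    simp [t, θ]
  have ht1 : ∀ s, t (s, 1) = τ' s := fun s => by
    simp [t, θ]
  refine ⟨f', fun s => ?_, ?_⟩
  · have := hΦπ (s, 1)
    rwa [ht1] at this
  · refine integral_pullback_eq_of_homotopy hk S hΨ f f' (fun s => ?_) (fun s => rfl) α hα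
    apply Subtype.ext
    change Φ (s, 0) = (f s).1
    by_cases hsO : s ∈ O
    · simp only [Φ, hsO, if_true]
      rw [ht0, ← hf s]
      have h1 : ((π (f s).1, (e (f s).1).2) : B × F) = e (f s).1 := e.mk_proj_snd (hsrc _ hsO)
      rw [h1]
      exact e.toOpenPartialHomeomorph.left_inv (hsrc _ hsO)
    · simp only [Φ, hsO, if_false]

/-- A closed manifold in a fibre bundle over a smoothly contractible base can be moved into a
fibre without changing the integrals of a closed form. -/
theorem exists_in_fibre_integral_eq (hπ : IsSmoothFibreBundle (EF := EF) F π)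
    {G : U × ℝ → U} {b₀ : U} (hG : ContMDiff (𝓘(ℝ, E).prod 𝓘(ℝ, ℝ)) 𝓘(ℝ, E) ∞ G)
    (h₀ : ∀ b, G (b, 0) = b) (h₁ : ∀ b, G (b, 1) = b₀)
    {k : ℕ} (hk : 1 ≤ k) (S : ClosedOrientedManifold k) (α : Form V (preimage π U) k)
    (hα : dForm k α = 0)
    (f : C^∞⟮𝓘(ℝ, EuclideanSpace ℝ (Fin k)), S.carrier; 𝓘(ℝ, V), preimage π U⟯) :
    ∃ f' : C^∞⟮𝓘(ℝ, EuclideanSpace ℝ (Fin k)), S.carrier; 𝓘(ℝ, V), preimage π U⟯,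
      (∀ s, π (f' s).1 = b₀) ∧ S.integral (pullback f' k α) = S.integral (pullback f k α) := by
  classical
  let g : S.carrier × ℝ → B := fun z => (G (restrict π U (f z.1), z.2)).1
  have hg : ContMDiff (𝓘(ℝ, EuclideanSpace ℝ (Fin k)).prod 𝓘(ℝ, ℝ)) 𝓘(ℝ, E) ∞ g :=
    contMDiff_subtype_val.comp (hG.comp
      ((((restrict π U).contMDiff.comp f.contMDiff).comp contMDiff_fst).prodMk contMDiff_snd))
  -- The time reached may vary over `S`, so that the manifold can be advanced piece by piece. The
  -- given `f` shows `P 0`, and `P 1` is the claim.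
  let P : (S.carrier → ℝ) → Prop := fun τ =>
    ∃ f' : C^∞⟮𝓘(ℝ, EuclideanSpace ℝ (Fin k)), S.carrier; 𝓘(ℝ, V), preimage π U⟯,
      (∀ s, π (f' s).1 = g (s, τ s)) ∧ S.integral (pullback f' k α) = S.integral (pullback f k α)
  have hloc : ∀ t₀ : ℝ, ∃ ε > 0, ∀ t ∈ Metric.ball t₀ ε, ∀ t' ∈ Metric.ball t₀ ε,
      P (fun _ => t) → P fun _ => t' := by
    intro t₀
    choose e hbe he he' using fun s : S.carrier => hπ (g (s, t₀))
    have h1 : ∀ s, ∃ N : Set S.carrier, IsOpen N ∧ s ∈ N ∧ ∃ ε > 0,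
        ∀ s' ∈ N, ∀ t ∈ Metric.ball t₀ ε, g (s', t) ∈ (e s).baseSet := fun s => by
      have h2 : g ⁻¹' (e s).baseSet ∈ 𝓝 (s, t₀) :=
        hg.continuous.continuousAt.preimage_mem_nhds ((e s).open_baseSet.mem_nhds (hbe s))
      obtain ⟨N, hN, T, hT, hNT⟩ := mem_nhds_prod_iff.1 h2
      obtain ⟨ε, hε, hεT⟩ := Metric.mem_nhds_iff.1 hT
      exact ⟨interior N, isOpen_interior, mem_interior_iff_mem_nhds.2 hN, ε, hε,
        fun s' hs' t ht => hNT ⟨interior_subset hs', hεT ht⟩⟩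
    choose N hNo hsN ε hε hNε using h1
    obtain ⟨T, hT⟩ := isCompact_univ.elim_finite_subcover N hNo
      fun s _ => mem_iUnion.2 ⟨s, hsN s⟩
    obtain ⟨δ, hδ, hδT⟩ : ∃ δ > 0, ∀ s ∈ T, δ ≤ ε s := by
      rcases T.eq_empty_or_nonempty with rfl | hne
      · exact ⟨1, one_pos, by simp⟩
      · obtain ⟨s, hs, hmin⟩ := T.exists_min_image ε hne
        exact ⟨ε s, hε s, hmin⟩
    refine ⟨δ, hδ, fun t ht t' ht' hPt => ?_⟩
    obtain ⟨ρ, hρ⟩ := SmoothPartitionOfUnity.exists_isSubordinate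
      𝓘(ℝ, EuclideanSpace ℝ (Fin k)) (isClosed_univ (X := S.carrier)) (fun s : T => N s)
      (fun s => hNo s) (by
        intro s hs
        obtain ⟨i, hi, hsi⟩ := mem_iUnion₂.1 (hT hs)
        exact mem_iUnion.2 ⟨⟨i, hi⟩, hsi⟩)
    -- Adding one index `i` to `J` changes the time only on the support of `ρ i`, where the single
    -- trivialization `e i` suffices. All times stay between `t` and `t'`, and the full sum reaches
    -- `t'`.
    let τ : Finset T → S.carrier → ℝ := fun J s => t + (∑ i ∈ J, ρ i s) * (t' - t)
    have hτ : ∀ J, ContMDiff 𝓘(ℝ, EuclideanSpace ℝ (Fin k)) 𝓘(ℝ, ℝ) ∞ (τ J) := fun J =>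
      contMDiff_const.add ((contMDiff_finsetSum fun i _ => (ρ i).contMDiff).mul contMDiff_const)
    have hsum1 : ∀ s, ∑ i, ρ i s = 1 := fun s => by
      rw [← ρ.sum_eq_one (mem_univ s), finsum_eq_sum_of_fintype]
    have hsum : ∀ J s, ∑ i ∈ J, ρ i s ∈ Icc (0 : ℝ) 1 := fun J s =>
      ⟨Finset.sum_nonneg fun i _ => ρ.nonneg i s, by
        rw [← hsum1 s]
        exact Finset.sum_le_sum_of_subset_of_nonneg (Finset.subset_univ J)
          fun i _ _ => ρ.nonneg i s⟩
    have hball : ∀ c ∈ Icc (0 : ℝ) 1, t + c * (t' - t) ∈ Metric.ball t₀ δ := fun c hc => by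
      have := convex_ball t₀ δ ht ht' (by linarith [hc.2] : 0 ≤ 1 - c) hc.1 (by ring)
      have h3 : t + c * (t' - t) = (1 - c) • t + c • t' := by
        simp only [smul_eq_mul]
        ring
      rwa [h3]
    have hball' : ∀ J s, τ J s ∈ Metric.ball t₀ δ := fun J s => hball _ (hsum J s)
    have hP : ∀ J : Finset T, P (τ J) := fun J => by
      induction J using Finset.induction_on with
      | empty => simpa [τ] using hPt
      | insert i J hi ih =>
        obtain ⟨f', hf', hf'int⟩ := ih
        obtain ⟨f'', hf'', hf''int⟩ := exists_transport hk hg (U := U)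
          (fun z => (G (restrict π U (f z.1), z.2)).2) (hτ J)
          (hτ (insert i J)) (e i) (he i) (he' i) (hNo i) (isClosed_tsupport (ρ i)) (hρ i)
          (fun s hs => by
            simp only [τ, Finset.sum_insert hi, image_eq_zero_of_notMem_tsupport hs, zero_add])
          (fun s hs c hc => by
            refine hNε i s hs _ (Metric.ball_subset_ball (hδT i i.2) ?_)
            have := convex_ball t₀ δ (hball' J s) (hball' (insert i J) s)
              (by linarith [hc.2] : 0 ≤ 1 - c) hc.1 (by ring)
            have h3 : τ J s + c * (τ (insert i J) s - τ J s) =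
                (1 - c) • τ J s + c • τ (insert i J) s := by
              simp only [smul_eq_mul]
              ring
            rwa [h3])
          α hα f' hf'
        exact ⟨f'', hf'', hf''int.trans hf'int⟩
    have h4 : τ Finset.univ = fun _ => t' := by
      funext s
      simp only [τ, hsum1]
      ring
    exact h4 ▸ hP Finset.univ
  -- By `hloc` the reachable constant times and the unreachable ones both form open sets; `ℝ` is
  -- connected.
  have hclopen : IsClopen {t : ℝ | P fun _ => t} := by
    constructor
    · rw [← isOpen_compl_iff, Metric.isOpen_iff]
      intro t ht
      obtain ⟨ε, hε, h⟩ := hloc t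
      exact ⟨ε, hε, fun t' ht' hP => ht (h t' ht' t (Metric.mem_ball_self hε) hP)⟩
    · rw [Metric.isOpen_iff]
      intro t ht
      obtain ⟨ε, hε, h⟩ := hloc t
      exact ⟨ε, hε, fun t' ht' => h t (Metric.mem_ball_self hε) t' ht' ht⟩
  have h0 : P fun _ => 0 := ⟨f, fun s => by
    simp only [g, h₀]
    rfl, rfl⟩
  have huniv := hclopen.eq_univ ⟨0, h0⟩
  obtain ⟨f', hf', hint⟩ : P fun _ => 1 := by
    have : (1 : ℝ) ∈ {t : ℝ | P fun _ => t} := huniv ▸ mem_univ _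
    exact this
  exact ⟨f', fun s => by rw [hf' s]; simp only [g, h₁], hint⟩

end FibreTransport

end FibredDeRham
end

noncomputable section

open Set Function Filter

namespace FibredDeRham

/-! ### Restriction and gluing of forms -/

section LocalForms

variable {E B : Type*} [NormedAddCommGroup E] [NormedSpace ℝ E] [TopologicalSpace B]
  [ChartedSpace E B]

theorem localMap_val_eq {U : Opens B} (x : U) {y : E} (hy : y ∈ (chartAt E x).target) :
    localMap (E := E) (E' := E) (Subtype.val : U → B) x x.1 y = y :=
  (chartAt E x).right_inv hy

theorem fderiv_localMap_val {U : Opens B} (x : U) {y : E} (hy : y ∈ (chartAt E x).target) :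
    fderiv ℝ (localMap (E := E) (E' := E) (Subtype.val : U → B) x x.1) y =
      ContinuousLinearMap.id ℝ E := by
  have h : localMap (E := E) (E' := E) (Subtype.val : U → B) x x.1 =ᶠ[𝓝 y] id := by
    filter_upwards [(chartAt E x).open_target.mem_nhds hy] with z hz using localMap_val_eq x hz
  rw [h.fderiv_eq, fderiv_id]

/-- The preferred chart of `U` at `x` is the restriction of that of `B`, so pulling back to `U`
literally restricts the function `α`. -/
theorem tangentCLM_val {U : Opens B} (x : U) :
    tangentCLM (E := E) (E' := E) (Subtype.val : U → B) x = ContinuousLinearMap.id ℝ E := by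
  rw [mfderiv_eq_localMap contMDiff_subtype_val, fderiv_localMap_val x (mem_chart_target E x)]

theorem pullbackRaw_val {U : Opens B} {k : ℕ} (α : B → E [⋀^Fin k]→L[ℝ] ℂ) (x : U) :
    pullbackRaw (E := E) (Subtype.val : U → B) α x = α x.1 := by
  rw [pullbackRaw, tangentCLM_val]
  ext v
  rfl

variable [IsManifold 𝓘(ℝ, E) ∞ B]

/-- A change of charts carries smoothness at the centre of the chart at `p` to every other chart
around `p`. -/
theorem isSmoothForm_of_contDiffAt_self {k : ℕ} {α : B → E [⋀^Fin k]→L[ℝ] ℂ}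
    (h : ∀ p, ContDiffAt ℝ ∞ (localRep α p) (chartAt E p p)) : IsSmoothForm α := by
  intro x y hy
  set p := (chartAt E x).symm y
  have hp : id p ∈ (chartAt E p).source := mem_chart_source E p
  have h1 := eventually_localRep_pullback
    (contMDiff_id (I := 𝓘(ℝ, E)) (M := B) (n := ∞)) α x p hy hp
  rw [pullbackRaw_id] at h1
  have h2 := contDiffAt_localMap (contMDiff_id (I := 𝓘(ℝ, E)) (M := B) (n := ∞)) x p hy hp
  exact ((contDiffAt_compCLM ((h p).comp y h2)
    (h2.fderiv_right (by simp))).congr_of_eventuallyEq h1).contDiffWithinAt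

theorem localRep_pullbackRaw_val {U : Opens B} {k : ℕ} (α : B → E [⋀^Fin k]→L[ℝ] ℂ) (x : U) {y : E}
    (hy : y ∈ (chartAt E x).target) :
    localRep (pullbackRaw (E := E) (Subtype.val : U → B) α) x y = localRep α x.1 y := by
  have hz : ((chartAt E x).symm y).1 ∈ (chartAt E x.1).source := by
    have h := (chartAt E x).map_target hy
    simp only [Opens.chartAt_eq, OpenPartialHomeomorph.subtypeRestr_source] at h
    exact h
  rw [localRep_pullback contMDiff_subtype_val α x x.1 hy hz, localMap_val_eq x hy,
    fderiv_localMap_val x hy]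
  ext v
  rfl

/-- Forms on the members of an open covering which agree on the intersections glue. -/
theorem exists_form_of_cover {ι : Type*} {U : ι → Opens B} (hU : ∀ b, ∃ i, b ∈ U i) {k : ℕ}
    (β : ∀ i, Form E (U i) k)
    (h : ∀ i j b (hi : b ∈ U i) (hj : b ∈ U j), (β i).1 ⟨b, hi⟩ = (β j).1 ⟨b, hj⟩) :
    ∃ β₀ : Form E B k, ∀ i, pullback (inclusion (U i)) k β₀ = β i := by
  choose i hi using hU
  let β₀ : B → E [⋀^Fin k]→L[ℝ] ℂ := fun b => (β (i b)).1 ⟨b, hi b⟩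
  have hβ : ∀ j, pullbackRaw (E := E) (Subtype.val : U j → B) β₀ = (β j).1 := fun j => by
    funext x
    rw [pullbackRaw_val]
    exact h _ _ _ _ _
  refine ⟨⟨β₀, isSmoothForm_of_contDiffAt_self fun p => ?_⟩, fun j => Subtype.ext (hβ j)⟩
  let x : U (i p) := ⟨p, hi p⟩
  have h1 : localRep (β (i p)).1 x =ᶠ[𝓝 (chartAt E p p)] localRep β₀ p := by
    filter_upwards [(chartAt E x).open_target.mem_nhds (mem_chart_target E x)] with y hy
    rw [← hβ (i p)]
    exact localRep_pullbackRaw_val β₀ x hy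
  exact (IsSmoothForm.contDiffAt (β (i p)).2 x (mem_chart_target E x)).congr_of_eventuallyEq h1.symm

end LocalForms

/-! ### Injectivity and descent for the pullback along the projection -/

section FibreBundle

variable {V A : Type*} [NormedAddCommGroup V] [NormedSpace ℝ V] [TopologicalSpace A]
  [ChartedSpace V A]
variable {E B : Type*} [NormedAddCommGroup E] [NormedSpace ℝ E] [TopologicalSpace B]
  [ChartedSpace E B]
variable {EF F : Type*} [NormedAddCommGroup EF] [NormedSpace ℝ EF]
  [TopologicalSpace F] [ChartedSpace EF F]
variable {π : C^∞⟮𝓘(ℝ, V), A; 𝓘(ℝ, E), B⟯}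

/-- The typical fibre contains a point because `A` does; the local section with this constant fibre
coordinate gives `a`, and its differential gives `L`. So `π` is surjective, and forms on `B` can be
recovered from their pullbacks by composing with `L`. -/
theorem IsSmoothFibreBundle.exists_rightInverse [Nonempty A]
    (hπ : IsSmoothFibreBundle (EF := EF) F π) (b : B) :
    ∃ a, π a = b ∧ ∃ L : E →L[ℝ] V,
      (tangentCLM (E := V) (E' := E) π a).comp L = ContinuousLinearMap.id ℝ E := by
  obtain ⟨a₀⟩ := ‹Nonempty A›
  obtain ⟨e₀, -, -, -⟩ := hπ (π a₀)
  let f₀ : F := (e₀ a₀).2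
  obtain ⟨e, hb, -, he⟩ := hπ b
  let σ : B → A := fun b => e.toOpenPartialHomeomorph.symm (b, f₀)
  have hbt : (b, f₀) ∈ e.target := e.mem_target.2 hb
  have hσ : ContMDiffAt 𝓘(ℝ, E) 𝓘(ℝ, V) ∞ σ b :=
    (he.contMDiffAt (e.open_target.mem_nhds hbt)).comp b
      (contMDiffAt_id.prodMk contMDiffAt_const)
  have hπσ : π ∘ σ =ᶠ[𝓝 b] id := by
    filter_upwards [e.open_baseSet.mem_nhds hb] with b' hb'
    exact e.proj_symm_apply (e.mem_target.2 hb')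
  refine ⟨σ b, hπσ.eq_of_nhds, tangentCLM (E := E) (E' := V) σ b, ?_⟩
  have h := hπσ.mfderiv_eq (I := 𝓘(ℝ, E)) (I' := 𝓘(ℝ, E))
  rw [mfderiv_comp b (π.contMDiff.mdifferentiable (by simp) _) (hσ.mdifferentiableAt (by simp)),
    mfderiv_id] at h
  exact h

variable [IsManifold 𝓘(ℝ, V) ∞ A] [IsManifold 𝓘(ℝ, E) ∞ B]

theorem pullback_inclusion_apply {U : Opens B} {k : ℕ} (β : Form E B k) (x : U) :
    (pullback (inclusion U) k β).1 x = β.1 x.1 := pullbackRaw_val β.1 x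

theorem tangentCLM_restrict {U : Opens B} (x : preimage π U) :
    tangentCLM (E := V) (E' := E) (restrict π U) x = tangentCLM (E := V) (E' := E) π x.1 := by
  have h2 : mfderiv 𝓘(ℝ, V) 𝓘(ℝ, E) ((inclusion (E := E) U : U → B) ∘ restrict π U) x =
      mfderiv 𝓘(ℝ, V) 𝓘(ℝ, E) (π ∘ inclusion (E := V) (preimage π U)) x := rfl
  rw [mfderiv_comp x ((inclusion (E := E) U).contMDiff.mdifferentiable (by simp) _)
      ((restrict π U).contMDiff.mdifferentiable (by simp) _),
    mfderiv_comp x (π.contMDiff.mdifferentiable (by simp) _)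
      ((inclusion (E := V) (preimage π U)).contMDiff.mdifferentiable (by simp) _)] at h2
  have h3 : (tangentCLM (E := E) (E' := E) (Subtype.val : U → B) (restrict π U x)).comp
      (tangentCLM (E := V) (E' := E) (restrict π U) x) =
      (tangentCLM (E := V) (E' := E) π x.1).comp
        (tangentCLM (E := V) (E' := V) (Subtype.val : preimage π U → A) x) := h2
  rw [tangentCLM_val, tangentCLM_val] at h3
  exact h3

theorem pullback_restrict_apply {U : Opens B} {k : ℕ} (β : Form E U k) (x : preimage π U) :
    (pullback (restrict π U) k β).1 x =
      (β.1 ⟨π x.1, x.2⟩).compContinuousLinearMap (tangentCLM (E := V) (E' := E) π x.1) := by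
  rw [← tangentCLM_restrict x]
  rfl

theorem compContinuousLinearMap_cancel {k : ℕ} {a : E [⋀^Fin k]→L[ℝ] ℂ} {P : V →L[ℝ] E}
    {L : E →L[ℝ] V} (h : P.comp L = ContinuousLinearMap.id ℝ E) :
    (a.compContinuousLinearMap P).compContinuousLinearMap L = a := by
  ext v
  change a (fun i => (P.comp L) (v i)) = a v
  rw [h]
  rfl

variable [Nonempty A]

theorem pullback_restrict_injective (hπ : IsSmoothFibreBundle (EF := EF) F π) (U : Opens B) (k : ℕ) :
    Injective (pullback (restrict π U) k) := by
  refine (injective_iff_map_eq_zero _).2 fun β hβ => Subtype.ext (funext fun b => ?_)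
  obtain ⟨a, ha, L, hL⟩ := hπ.exists_rightInverse b.1
  have h1 : (pullback (restrict π U) k β).1 (⟨a, by
      change π a ∈ U
      rw [ha]; exact b.2⟩ : preimage π U) = 0 := by
    rw [hβ]
    rfl
  rw [pullback_restrict_apply] at h1
  have h2 : b = ⟨π a, by rw [ha]; exact b.2⟩ := Subtype.ext ha.symm
  rw [h2, ← compContinuousLinearMap_cancel (a := β.1 _) hL, h1]
  rfl

theorem pullback_injective (hπ : IsSmoothFibreBundle (EF := EF) F π) (k : ℕ) :
    Injective (pullback π k) := by
  refine (injective_iff_map_eq_zero _).2 fun β hβ => Subtype.ext (funext fun b => ?_)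
  obtain ⟨a, rfl, L, hL⟩ := hπ.exists_rightInverse b
  have h1 : (β.1 (π a)).compContinuousLinearMap (tangentCLM (E := V) (E' := E) π a) = 0 :=
    congrFun (congrArg Subtype.val hβ) a
  rw [← compContinuousLinearMap_cancel (a := β.1 _) hL, h1]
  rfl

/-- A form on the total space which comes from the base over the members of an open covering
comes from the base. -/
theorem exists_pullback_eq_of_cover (hπ : IsSmoothFibreBundle (EF := EF) F π) {ι : Type*}
    {U : ι → Opens B} (hU : ∀ b, ∃ i, b ∈ U i) {k : ℕ} (η : Form V A k) (β : ∀ i, Form E (U i) k)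
    (h : ∀ i, pullback (inclusion (preimage π (U i))) k η = pullback (restrict π (U i)) k (β i)) :
    ∃ β₀ : Form E B k, pullback π k β₀ = η := by
  have h1 : ∀ i a (hi : π a ∈ U i), η.1 a = ((β i).1 ⟨π a, hi⟩).compContinuousLinearMap
      (tangentCLM (E := V) (E' := E) π a) := fun i a hi => by
    have h2 := congrFun (congrArg Subtype.val (h i)) (⟨a, hi⟩ : preimage π (U i))
    rwa [pullback_restrict_apply, pullback_inclusion_apply] at h2
  obtain ⟨β₀, hβ₀⟩ := exists_form_of_cover hU β fun i j b hi hj => by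
    -- Both local forms are recovered at `b` from the same value of `η`, by means of one `L`.
    obtain ⟨a, rfl, L, hL⟩ := hπ.exists_rightInverse b
    rw [← compContinuousLinearMap_cancel (a := (β i).1 _) hL, ← h1 i a hi, h1 j a hj,
      compContinuousLinearMap_cancel hL]
  refine ⟨β₀, Subtype.ext (funext fun a => ?_)⟩
  obtain ⟨i, hi⟩ := hU (π a)
  rw [h1 i a hi, ← hβ₀ i, pullback_inclusion_apply]
  rfl

end FibreBundle

end FibredDeRham
end

noncomputable section

open Set Function Filter

namespace FibredDeRham

/-! ### Maps induced on quotients and cohomology -/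

section AddGroup

variable {G₁ G₂ G₃ : Type*} [AddCommGroup G₁] [AddCommGroup G₂] [AddCommGroup G₃]

theorem exists_addMonoidHom_apply_eq (f : G₁ →+ G₂) (hf : Surjective f) (g : G₁ →+ G₃)
    (h : f.ker ≤ g.ker) : ∃ φ : G₂ →+ G₃, ∀ x, φ (f x) = g x :=
  ⟨f.liftOfSurjective hf ⟨g, h⟩, fun x =>
    AddMonoidHom.liftOfRightInverse_comp_apply f _ (rightInverse_surjInv hf) ⟨g, h⟩ x⟩

theorem exists_addEquiv_of_map_eq (f : G₁ →+ G₂) (hf : Injective f) {P : AddSubgroup G₁}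
    {Q : AddSubgroup G₂} (h : P.map f = Q) : ∃ Φ : P ≃+ Q, ∀ c, (Φ c : G₂) = f c := by
  subst h
  exact ⟨P.equivMapOfInjective f hf, fun _ => rfl⟩

end AddGroup

section CohomologyMap

variable {C D : ℕ → Type*} [∀ k, AddCommGroup (C k)] [∀ k, AddCommGroup (D k)]
  {dC : ∀ k, C k →+ C (k + 1)} {dD : ∀ k, D k →+ D (k + 1)}

/-- The restriction of a cochain map to the cocycles. -/
def cocycleMap (T : ∀ k, C k →+ D k) (hT : ∀ k c, T (k + 1) (dC k c) = dD k (T k c)) (k : ℕ) :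
    (dC k).ker →+ (dD k).ker :=
  ((T k).comp (dC k).ker.subtype).codRestrict (dD k).ker fun c => by
    change dD k (T k c.1) = 0
    rw [← hT, show dC k c.1 = 0 from c.2, map_zero]

/-- The map of cohomology groups induced by a cochain map. -/
def cohMap (T : ∀ k, C k →+ D k) (hT : ∀ k c, T (k + 1) (dC k c) = dD k (T k c)) (k : ℕ) :
    Cohomology dC k →+ Cohomology dD k :=
  QuotientAddGroup.map _ _ (cocycleMap T hT k) (by
    cases k with
    | zero =>
      intro c hc
      have h : c.1 = 0 := hc
      change T 0 c.1 = 0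
      rw [h, map_zero]
    | succ k =>
      rintro c ⟨b, hb⟩
      exact ⟨T k b, by
        rw [← hT, hb]
        rfl⟩)

theorem cohMap_cohClass (T : ∀ k, C k →+ D k)
    (hT : ∀ k c, T (k + 1) (dC k c) = dD k (T k c)) (k : ℕ) (c : (dC k).ker) :
    cohMap T hT k (cohClass dC k c) = cohClass dD k (cocycleMap T hT k c) := rfl

theorem cohMap_injective (T : ∀ k, C k →+ D k)
    (hT : ∀ k c, T (k + 1) (dC k c) = dD k (T k c)) (k : ℕ)
    (h : ∀ c, dC (k + 1) c = 0 → ∀ x, dD k x = T (k + 1) c → ∃ b, dC k b = c) :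
    Injective (cohMap T hT (k + 1)) := by
  refine (injective_iff_map_eq_zero _).2 fun x hx => ?_
  obtain ⟨c, rfl⟩ := QuotientAddGroup.mk'_surjective _ x
  have h1 : cocycleMap T hT (k + 1) c ∈
      (coboundaries dD (k + 1)).addSubgroupOf (dD (k + 1)).ker :=
    (QuotientAddGroup.eq_zero_iff _).1 hx
  obtain ⟨y, hy⟩ := h1
  obtain ⟨b, hb⟩ := h c.1 c.2 y hy
  exact (QuotientAddGroup.eq_zero_iff c).2 ⟨b, hb⟩

end CohomologyMap

/-! ### Smooth contractions and primitives on a good covering -/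

section GoodCovering

variable {E B ι : Type*} [NormedAddCommGroup E] [NormedSpace ℝ E] [TopologicalSpace B]
  [ChartedSpace E B]

theorem IsGoodCovering.contractibleSpace {U : ι → Opens B} (hU : IsGoodCovering U) (i : ι)
    [hne : Nonempty (U i)] : ContractibleSpace (U i) := by
  have h := hU.contractible {i} (Finset.singleton_nonempty i)
  rw [Finset.set_biInter_singleton] at h
  obtain ⟨x⟩ := hne
  exact h ⟨x.1, x.2⟩

variable [IsManifold 𝓘(ℝ, E) ∞ B]

theorem IsGoodCovering.exists_smooth_contraction (hB : HasBumps 𝓘(ℝ, E) B) {U : ι → Opens B}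
    (hU : IsGoodCovering U) (i : ι) [Nonempty (U i)] :
    ∃ (b₀ : U i) (G : U i × ℝ → U i), ContMDiff (𝓘(ℝ, E).prod 𝓘(ℝ, ℝ)) 𝓘(ℝ, E) ∞ G ∧
      (∀ b, G (b, 0) = b) ∧ ∀ b, G (b, 1) = b₀ :=
  have := hU.contractibleSpace i
  (hB.opens (U i)).exists_smooth_contraction

theorem IsGoodCovering.exists_dForm_eq (hB : HasBumps 𝓘(ℝ, E) B) {U : ι → Opens B}
    (hU : IsGoodCovering U) (i : ι) {k : ℕ} (γ : Form E (U i) (k + 1))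
    (hγ : dForm (k + 1) γ = 0) : ∃ δ : Form E (U i) k, dForm k δ = γ := by
  -- Members of the covering may be empty, and then they are not contractible but carry only the
  -- zero form.
  rcases isEmpty_or_nonempty (U i) with hemp | hne
  · exact ⟨0, Subtype.ext (funext fun x => hemp.elim x)⟩
  · obtain ⟨b₀, G, hG, h₀, h₁⟩ := hU.exists_smooth_contraction hB i
    exact exists_dForm_eq_of_contraction hG h₀ h₁ γ hγ

end GoodCovering

/-! ### Comparison of the two complexes -/

section Comparison

universe u
variable {V : Type u} {A : Type*} [NormedAddCommGroup V] [NormedSpace ℝ V] [TopologicalSpace A]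
  [ChartedSpace V A] [IsManifold 𝓘(ℝ, V) ∞ A]
variable {E B : Type*} [NormedAddCommGroup E] [NormedSpace ℝ E] [TopologicalSpace B]
  [ChartedSpace E B] [IsManifold 𝓘(ℝ, E) ∞ B]
variable {EF F : Type*} [NormedAddCommGroup EF] [NormedSpace ℝ EF]
  [TopologicalSpace F] [ChartedSpace EF F]
variable {π : C^∞⟮𝓘(ℝ, V), A; 𝓘(ℝ, E), B⟯} {ι : Type*} {U : ι → Opens B}

theorem exists_eq_tildeForm {k : ℕ} (t : TildeForm π U k) : ∃ η β, t = tildeForm π U k η β := by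
  obtain ⟨⟨η, β⟩, h⟩ := (tildeFamily π U k).rangeRestrict_surjective t
  exact ⟨η, β, h.symm⟩

theorem tildeForm_apply {k : ℕ} (η : Form V A k) (β : ∀ i, Form E (U i) k) (i : ι) :
    (tildeForm π U k η β).1 i = pullback (inclusion (preimage π (U i))) k η -
      pullback (restrict π (U i)) k (β i) := rfl

theorem tildeD_tildeForm {k : ℕ} (η : Form V A k) (β : ∀ i, Form E (U i) k) :
    tildeD π U k (tildeForm π U k η β) =
      tildeForm π U (k + 1) (dForm k η) fun i => dForm k (β i) :=
  Subtype.ext (funext fun i => dForm_tildeFamily π U k (η, β) i)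

theorem relClass_eq_zero_iff {k : ℕ} (η : Form V A k) :
    relClass π k η = 0 ↔ ∃ β, pullback π k β = η :=
  QuotientAddGroup.eq_zero_iff η

theorem relD_relClass {k : ℕ} (η : Form V A k) :
    relD π k (relClass π k η) = relClass π (k + 1) (dForm k η) := rfl

theorem pullback_inclusion_pullback {k : ℕ} (i : ι) (β : Form E B k) :
    pullback (inclusion (preimage π (U i))) k (pullback π k β) =
      pullback (restrict π (U i)) k (pullback (inclusion (U i)) k β) := by
  rw [← pullback_comp, ← pullback_comp]
  rfl

/-- Restricted to a fibre, `π^* β_i` is pulled back along a constant map and vanishes since `k ≥ 1`.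
-/
theorem integral_pullback_tildeForm_of_const {k : ℕ} (hk : 1 ≤ k) (η : Form V A k)
    (β : ∀ i, Form E (U i) k) (i : ι) (S : ClosedOrientedManifold k)
    (f : C^∞⟮𝓘(ℝ, EuclideanSpace ℝ (Fin k)), S.carrier; 𝓘(ℝ, V), preimage π (U i)⟯) {b : B}
    (hf : ∀ s, π (f s).1 = b) :
    S.integral (pullback f k ((tildeForm π U k η β).1 i)) =
      S.integral (pullback ((inclusion (preimage π (U i))).comp f) k η) := by
  have h : pullback f k (pullback (restrict π (U i)) k (β i)) = 0 := by
    rcases isEmpty_or_nonempty S.carrier with hemp | ⟨⟨s₀⟩⟩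
    · exact Subtype.ext (funext fun s => hemp.elim s)
    · rw [← pullback_comp]
      exact pullback_eq_zero_of_const _ (restrict π (U i) (f s₀))
        (fun s => Subtype.ext ((hf s).trans (hf s₀).symm)) hk _
  rw [tildeForm_apply, map_sub, h, sub_zero, pullback_comp]

variable [Nonempty A]

theorem ker_tildeFamily_le (hπ : IsSmoothFibreBundle (EF := EF) F π)
    (hU : ∀ b, ∃ i, b ∈ U i) (k : ℕ) :
    (tildeFamily π U k).rangeRestrict.ker ≤
      ((relClass π k).comp (AddMonoidHom.fst _ _)).ker := by
  rintro ⟨η, β⟩ h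
  have h0 : tildeForm π U k η β = 0 := h
  refine (relClass_eq_zero_iff η).2 (exists_pullback_eq_of_cover hπ hU η β fun i => ?_)
  have h1 := congrFun (congrArg Subtype.val h0) i
  rw [tildeForm_apply] at h1
  exact sub_eq_zero.1 h1

theorem exists_tildeToRel (hπ : IsSmoothFibreBundle (EF := EF) F π) (hU : ∀ b, ∃ i, b ∈ U i)
    (k : ℕ) : ∃ φ : TildeForm π U k →+ RelForm π k,
      ∀ p, φ ((tildeFamily π U k).rangeRestrict p) =
        (relClass π k).comp (AddMonoidHom.fst _ _) p :=
  exists_addMonoidHom_apply_eq _ (tildeFamily π U k).rangeRestrict_surjective _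
    (ker_tildeFamily_le hπ hU k)

/-- The map `Ω̃^k → Ω^k(A → B)` which sends `{η - π^* β_λ}` to the class of `η`. -/
def tildeToRel (hπ : IsSmoothFibreBundle (EF := EF) F π) (hU : ∀ b, ∃ i, b ∈ U i) (k : ℕ) :
    TildeForm π U k →+ RelForm π k :=
  (exists_tildeToRel hπ hU k).choose

theorem tildeToRel_tildeForm (hπ : IsSmoothFibreBundle (EF := EF) F π)
    (hU : ∀ b, ∃ i, b ∈ U i) {k : ℕ} (η : Form V A k) (β : ∀ i, Form E (U i) k) :
    tildeToRel hπ hU k (tildeForm π U k η β) = relClass π k η :=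
  (exists_tildeToRel hπ hU k).choose_spec (η, β)

theorem tildeToRel_tildeD (hπ : IsSmoothFibreBundle (EF := EF) F π) (hU : ∀ b, ∃ i, b ∈ U i)
    (k : ℕ) (t : TildeForm π U k) :
    tildeToRel hπ hU (k + 1) (tildeD π U k t) = relD π k (tildeToRel hπ hU k t) := by
  obtain ⟨η, β, rfl⟩ := exists_eq_tildeForm t
  rw [tildeD_tildeForm, tildeToRel_tildeForm, tildeToRel_tildeForm, relD_relClass]

/-- Injectivity on cohomology. Write `η = dξ + π^* b`; closedness of the family and injectivity of
the pullback make `b - β_i` closed on `U i`, so it has a primitive `δ_i`, and `{ξ + π^* δ_i}` is the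
required cochain. -/
theorem exists_tildeD_eq (hπ : IsSmoothFibreBundle (EF := EF) F π) (hB : HasBumps 𝓘(ℝ, E) B)
    (hU : IsGoodCovering U) {k : ℕ} (t : TildeForm π U (k + 1)) (ht : tildeD π U (k + 1) t = 0)
    (x : RelForm π k) (hx : relD π k x = tildeToRel hπ hU.covers (k + 1) t) :
    ∃ b, tildeD π U k b = t := by
  obtain ⟨η, β, rfl⟩ := exists_eq_tildeForm t
  obtain ⟨ξ, rfl⟩ := QuotientAddGroup.mk'_surjective _ x
  have hx' : relClass π (k + 1) (η - dForm k ξ) = 0 := by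
    rw [map_sub, ← tildeToRel_tildeForm hπ hU.covers η β, ← hx]
    exact sub_self _
  obtain ⟨b, hb⟩ := (relClass_eq_zero_iff _).1 hx'
  have hη : η = dForm k ξ + pullback π (k + 1) b := by rw [hb]; abel
  have hcl : ∀ i, dForm (k + 1) (pullback (inclusion (U i)) (k + 1) b - β i) = 0 := fun i => by
    apply pullback_restrict_injective hπ (U i)
    rw [map_zero, ← dForm_pullback]
    have h1 := congrFun (congrArg Subtype.val ht) i
    have h2 : dForm (k + 1) ((tildeForm π U (k + 1) η β).1 i) = 0 := h1
    rw [tildeForm_apply, hη, map_add, pullback_inclusion_pullback, add_sub_assoc, ← map_sub,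
      map_add, ← dForm_pullback, dForm_dForm, zero_add] at h2
    exact h2
  choose δ hδ using fun i => hU.exists_dForm_eq hB i _ (hcl i)
  refine ⟨tildeForm π U k ξ fun i => -δ i, ?_⟩
  rw [tildeD_tildeForm]
  refine Subtype.ext (funext fun i => ?_)
  rw [tildeForm_apply, tildeForm_apply, map_neg, hδ i, hη, map_add, pullback_inclusion_pullback,
    neg_sub, map_sub]
  abel

/-- Every closed class in `Ω^k(A → B)` lifts to a closed family. -/
theorem exists_closed_tildeForm (hπ : IsSmoothFibreBundle (EF := EF) F π)
    (hB : HasBumps 𝓘(ℝ, E) B) (hU : IsGoodCovering U) {k : ℕ} (η : Form V A k)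
    (hη : relD π k (relClass π k η) = 0) : ∃ β, tildeD π U k (tildeForm π U k η β) = 0 := by
  rw [relD_relClass] at hη
  obtain ⟨b, hb⟩ := (relClass_eq_zero_iff _).1 hη
  -- From `dη = π^* b` follows `π^* (db) = ddη = 0`; the `β i` are then primitives of `b` over `U
  -- i`.
  have hdb : dForm (k + 1) b = 0 := by
    apply pullback_injective hπ
    rw [map_zero, ← dForm_pullback, hb, dForm_dForm]
  choose β hβ using fun i => hU.exists_dForm_eq hB i (pullback (inclusion (U i)) (k + 1) b)
    (by rw [dForm_pullback, hdb, map_zero])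
  refine ⟨β, ?_⟩
  rw [tildeD_tildeForm]
  refine Subtype.ext (funext fun i => ?_)
  rw [tildeForm_apply, hβ, ← hb, pullback_inclusion_pullback, sub_self]
  rfl

/-- One inclusion holds because every fibre lies over some `U i`. For the other, a form with
integral fibre periods is lifted to a closed family, and a closed manifold in `π⁻¹(U i)` is moved
into a fibre. This inclusion also contains surjectivity. -/
theorem map_HTildeInt (hπ : IsSmoothFibreBundle (EF := EF) F π) (hB : HasBumps 𝓘(ℝ, E) B)
    (hU : IsGoodCovering U) {k : ℕ} (hk : 1 ≤ k) :
    (HTildeInt π U k).map (cohMap (dC := tildeD π U) (dD := relD π) (tildeToRel hπ hU.covers)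
      (tildeToRel_tildeD hπ hU.covers) k) = HRelInt π k := by
  ext x
  constructor
  · rintro ⟨_, ⟨⟨t, ht⟩, htint, rfl⟩, rfl⟩
    obtain ⟨η, β, rfl⟩ := exists_eq_tildeForm t
    have htint' : tildeForm π U k η β ∈ tildeIntegralForms π U k := htint
    rw [cohMap_cohClass]
    refine ⟨_, ?_, rfl⟩
    refine ⟨η, fun S f hf => ?_, (tildeToRel_tildeForm hπ hU.covers η β).symm⟩
    obtain ⟨b, hfb⟩ := hf
    obtain ⟨i, hi⟩ := hU.covers b
    let f' : C^∞⟮𝓘(ℝ, EuclideanSpace ℝ (Fin k)), S.carrier; 𝓘(ℝ, V), preimage π (U i)⟯ :=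
      ⟨fun s => ⟨f s, by
        change π (f s) ∈ U i
        rwa [hfb s]⟩, (ContMDiff.subtypeVal_comp_iff (preimage π (U i)) _).1 f.contMDiff⟩
    have h1 := htint' i S f'
    rw [integral_pullback_tildeForm_of_const hk η β i S f' hfb] at h1
    exact h1
  · rintro ⟨⟨y, hy⟩, ⟨η, hη, hηy⟩, rfl⟩
    have hηy' : relClass π k η = y := hηy
    subst hηy'
    obtain ⟨β, hβ⟩ := exists_closed_tildeForm hπ hB hU η hy
    refine ⟨cohClass (tildeD π U) k ⟨tildeForm π U k η β, hβ⟩, ⟨_, fun i S f => ?_, rfl⟩, ?_⟩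
    · rcases isEmpty_or_nonempty S.carrier with hemp | ⟨⟨s₀⟩⟩
      · have : pullback f k ((tildeForm π U k η β).1 i) = 0 :=
          Subtype.ext (funext fun s => hemp.elim s)
        change S.integral (pullback f k ((tildeForm π U k η β).1 i)) ∈ _
        rw [this, map_zero]
        exact zero_mem _
      have : Nonempty (U i) := ⟨restrict π (U i) (f s₀)⟩
      obtain ⟨b₀, G, hG, h₀, h₁⟩ := hU.exists_smooth_contraction hB i
      have hcl : dForm k ((tildeForm π U k η β).1 i) = 0 :=
        congrFun (congrArg Subtype.val hβ) i
      obtain ⟨f', hf', hint⟩ := exists_in_fibre_integral_eq hπ hG h₀ h₁ hk S _ hcl f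
      change S.integral (pullback f k ((tildeForm π U k η β).1 i)) ∈ _
      rw [← hint, integral_pullback_tildeForm_of_const hk η β i S f' hf']
      exact hη S _ ⟨b₀, hf'⟩
    · rw [cohMap_cohClass]
      exact congrArg _ (Subtype.ext (tildeToRel_tildeForm hπ hU.covers η β))

end Comparison

end FibredDeRham
end

/-- The affine space is identified with `V` by a choice of origin; it enters the comparison as a
nonempty manifold, so that `π` is surjective. -/
theorem lemma5 {V E EF B F ι : Type*}
    [NormedAddCommGroup V] [NormedSpace ℝ V]
    [NormedAddCommGroup E] [NormedSpace ℝ E]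
    [TopologicalSpace B] [ChartedSpace E B] [IsManifold 𝓘(ℝ, E) ∞ B] [T2Space B]
    [NormedAddCommGroup EF] [NormedSpace ℝ EF]
    [TopologicalSpace F] [ChartedSpace EF F] [IsManifold 𝓘(ℝ, EF) ∞ F] [T2Space F]
    (hB : AdmitsSmoothPartitionsOfUnity E B)
    (π : C^∞⟮𝓘(ℝ, V), V; 𝓘(ℝ, E), B⟯) (hπ : IsSmoothFibreBundle (EF := EF) F π)
    (U : ι → Opens B) (hU : IsGoodCovering U) (k : ℕ) (hk : 1 ≤ k) :
    ∃ Φ : HTildeInt π U k ≃+ HRelInt π k,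
      ∀ (c : HTildeInt π U k) (η : Form V V k) (β : ∀ i, Form E (U i) k)
        (hc : tildeForm π U k η β ∈ (tildeD π U k).ker),
        (c : HTilde π U k) = cohClass (tildeD π U) k ⟨tildeForm π U k η β, hc⟩ →
          ∃ hη : relClass π k η ∈ (relD π k).ker,
            (Φ c : HRel π k) = cohClass (relD π) k ⟨relClass π k η, hη⟩ := by
  open FibredDeRham in
  -- In degree `m + 1` the coboundaries are by definition the range of the preceding operator, the
  -- form that `cohMap_injective` needs.
  obtain ⟨m, rfl⟩ := Nat.exists_eq_add_of_le' hk
  have hB' := hB.hasBumps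
  have hT := tildeToRel_tildeD (U := U) hπ hU.covers
  obtain ⟨Φ, hΦ⟩ := exists_addEquiv_of_map_eq _
    (cohMap_injective (dC := tildeD π U) (dD := relD π) _ hT m fun t ht x hx =>
      exists_tildeD_eq hπ hB' hU t ht x hx) (map_HTildeInt hπ hB' hU hk)
  refine ⟨Φ, fun c η β hc hcη => ?_⟩
  have hη : relClass π (m + 1) η ∈ (relD π (m + 1)).ker := by
    rw [AddMonoidHom.mem_ker, ← tildeToRel_tildeForm hπ hU.covers η β, ← hT,
      AddMonoidHom.mem_ker.1 hc, map_zero]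
  refine ⟨hη, ?_⟩
  rw [hΦ, hcη, cohMap_cohClass]
  exact congrArg _ (Subtype.ext (tildeToRel_tildeForm hπ hU.covers η β))
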